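/- Let $\Gamma$ be a finite connected multigraph without loops, with vertex set $\mathcal V$ and edge set $\mathcal E$, oriented by choosing for each edge $e$ a left vertex $l(e)$ and a right vertex $r(e)$ (its two distinct end points). Let $F$ be a field and let $F_\bullet$ be a $\Gamma/F$-field: field extensions $F_v$ ($v\in\mathcal V$) and $F_e$ ($e\in\mathcal E$) of $F$, with inclusions over $F$ of $F_{l(e)}$ and $F_{r(e)}$ into $F_e$ for every edge $e$, such that $F$ is the inverse limit of this system, i.e. $F\to\{(a_v)\in\prod_{v} F_v : a_{l(e)}=a_{r(e)} \text{ in } F_e \text{ for all } e\in\mathcal E\}$ is bijective. Let $A$ be a smooth commutative group scheme of finite type over $F$. Assume: 1. $A$ is separably factorizable over $F_\bullet$: the map $\prod_{v} A(F_v\otimes_F F^{\mathrm{sep}})\to\prod_{e}A(F_e\otimes_F F^{\mathrm{sep}})$, $(a_v)_v\mapsto (a_{l(e)}a_{r(e)}^{-1})_e$, is surjective. 2. For every $\xi\in\mathcal V\sqcup\mathcal E$ the cohomology of $A$ over $F_\xi$ is globally dominated: $H^n(F_\xi^{\mathrm{gd}},A)=0$ for all $n>0$, where $F_\xi^{\mathrm{gd}}$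 is the compositum of $F_\xi$ and $F^{\mathrm{sep}}$ in a separable closure $F_\xi^{\mathrm{sep}}$. Here, for a field extension $K/F$, $H^n(K,A)$ denotes the Galois cohomology group $H^n(\mathrm{Gal}(K^{\mathrm{sep}}/K),A(K^{\mathrm{sep}}))$. Then there is a long exact sequence $$0\to H^0(F,A)\to\prod_{v\in\mathcal V}H^0(F_v,A)\to\prod_{e\in\mathcal E}H^0(F_e,A)\xrightarrow{\delta^0}H^1(F,A)\to\prod_{v\in\mathcal V}H^1(F_v,A)\to\prod_{e\in\mathcal E}H^1(F_e,A)\xrightarrow{\delta^1}H^2(F,A)\to\cdots,$$ continuing through all degrees. The maps $H^n(F,A)\to\prod_v H^n(F_v,A)$ are the restriction maps, the maps $\prod_v H^n(F_v,A)\to\prod_e H^n(F_e,A)$ send $(\alpha_v)_v$ to the family of differences $\alpha_{l(e)}|_{F_e}-\alpha_{r(e)}|_{F_e}$, and the maps $\delta^n$ are homomorphisms induced by the connecting homomorphisms of the sequence of $\mathrm{Gal}(F^{\mathrm{sep}}/F)$-modules $0\to A(F^{\mathrm{sep}})\to\prod_v A(F_v\otimes_F F^{\mathrm{sep}})\to\prod_e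 A(F_e\otimes_F F^{\mathrm{sep}})\to 0$, in the following sense. Suppose given $n$-cochains $b_v$ of $\mathrm{Gal}(F^{\mathrm{sep}}/F)$ with values in $A(F_v\otimes_F F^{\mathrm{sep}})$ such that the differences $z_e=b_{l(e)}-b_{r(e)}$, with values in $A(F_e\otimes_F F^{\mathrm{sep}})$, are cocycles, and an $(n+1)$-cocycle $a$ with values in $A(F^{\mathrm{sep}})$ whose image in $A(F_v\otimes_F F^{\mathrm{sep}})$ is the coboundary $db_v$ for every $v$. Then $\delta^n$ sends the family of the images of the classes $[z_e]$ under $H^n(\mathrm{Gal}(F^{\mathrm{sep}}/F),A(F_e\otimes_F F^{\mathrm{sep}}))\to H^n(F_e,A)$ to $[a]$. -/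

import Mathlib

open CategoryTheory AlgebraicGeometry
open scoped TensorProduct

universe u v w

noncomputable section

namespace GammaPatching

/-! ### Oriented graphs -/

/-- A finite multigraph without loops, together with an orientation: every edge `e` has a left
vertex `l e` and a right vertex `r e`, which are distinct. -/
structure OrientedGraph where
  /-- the vertices -/
  V : Type v
  /-- the edges -/
  E : Type w
  [finiteV : Finite V]
  [finiteE : Finite E]
  /-- the left vertex of an edge -/
  l : E → V
  /-- the right vertex of an edge -/
  r : E → V
  l_ne_r : ∀ e, l e ≠ r e

attribute [instance] OrientedGraph.finiteV OrientedGraph.finiteE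

/-- The simple graph of adjacent pairs of vertices. -/
def OrientedGraph.toSimpleGraph (Γ : OrientedGraph.{v, w}) : SimpleGraph Γ.V :=
  SimpleGraph.fromRel fun a b => ∃ e, Γ.l e = a ∧ Γ.r e = b

/-- A graph is connected if it is nonempty and any two vertices are joined by a path of edges. -/
def OrientedGraph.Connected (Γ : OrientedGraph.{v, w}) : Prop :=
  Γ.toSimpleGraph.Connected

/-! ### `Γ`-fields -/

/-- A `Γ`-field in the category of `F`-algebras: a field extension of `F` for every vertex and
every edge, with an inclusion (over `F`) of the field of a vertex into that of an edge for each of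
the two vertices of the edge. -/
structure GammaField (Γ : OrientedGraph.{v, w}) (F : Type u) [Field F] where
  /-- the field of a vertex -/
  Fv : Γ.V → Type u
  /-- the field of an edge -/
  Fe : Γ.E → Type u
  [fieldV : ∀ v, Field (Fv v)]
  [fieldE : ∀ e, Field (Fe e)]
  [algebraV : ∀ v, Algebra F (Fv v)]
  [algebraE : ∀ e, Algebra F (Fe e)]
  /-- the inclusion of the field of the left vertex of an edge -/
  ιl : ∀ e, Fv (Γ.l e) →ₐ[F] Fe e
  /-- the inclusion of the field of the right vertex of an edge -/
  ιr : ∀ e, Fv (Γ.r e) →ₐ[F] Fe e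

attribute [instance] GammaField.fieldV GammaField.fieldE GammaField.algebraV GammaField.algebraE

/-- The inverse limit `F_Γ` of a `Γ`-field: the families `(a_v)` in the product of the vertex
fields such that, for every edge, the entries at its two vertices agree in the field of the edge. -/
def GammaField.limit {Γ : OrientedGraph.{v, w}} {F : Type u} [Field F] (X : GammaField Γ F) :
    Subalgebra F (∀ v, X.Fv v) where
  carrier := {a | ∀ e, X.ιl e (a (Γ.l e)) = X.ιr e (a (Γ.r e))}
  mul_mem' ha hb e := by simp [ha e, hb e]
  add_mem' ha hb e := by simp [ha e, hb e]
  algebraMap_mem' x e := by simp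

/-- A `Γ/F`-field: the graph `Γ` is connected, and `F` is the inverse limit `F_Γ`. -/
structure GammaField.IsGammaOver {Γ : OrientedGraph.{v, w}} {F : Type u} [Field F]
    (X : GammaField Γ F) : Prop where
  connected : Γ.Connected
  bijective : Function.Bijective (algebraMap F X.limit)

/-! ### Points of a commutative group scheme -/

section Points

variable {F : Type u} [Field F] (A : Over (Spec (CommRingCat.of F))) [GrpObj A] [IsCommMonObj A]

/-- `Spec R` as a scheme over `Spec F`, for an `F`-algebra `R`. -/
def specOver (F : Type u) [Field F] (R : Type u) [CommRing R] [Algebra F R] :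
    Over (Spec (CommRingCat.of F)) :=
  Over.mk (Spec.map (CommRingCat.ofHom (algebraMap F R)))

/-- The morphism of `F`-schemes `Spec S ⟶ Spec R` given by a homomorphism of `F`-algebras. -/
def specOverMap {R S : Type u} [CommRing R] [Algebra F R] [CommRing S] [Algebra F S]
    (f : R →ₐ[F] S) : specOver F S ⟶ specOver F R :=
  Over.homMk (Spec.map (CommRingCat.ofHom f.toRingHom)) (by
    simp only [specOver, Over.mk_left, Over.mk_hom, ← Spec.map_comp, ← CommRingCat.ofHom_comp]
    congr 2
    exact f.comp_algebraMap)

/-- The group `A(R)` of `R`-points of a commutative group scheme `A` over `F`, written additively. -/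
def Points (R : Type u) [CommRing R] [Algebra F R] : Type u :=
  Additive (specOver F R ⟶ A)

variable (R S T : Type u) [CommRing R] [Algebra F R] [CommRing S] [Algebra F S]
  [CommRing T] [Algebra F T]

open scoped MonObj in
instance : AddCommGroup (Points A R) :=
  inferInstanceAs (AddCommGroup (Additive (specOver F R ⟶ A)))

/-- Groups of points are regarded as discrete topological groups. -/
instance : TopologicalSpace (Points A R) := ⊥

instance : DiscreteTopology (Points A R) := ⟨rfl⟩

variable {R S T}

open scoped MonObj in
/-- The homomorphism `A(R) → A(S)` induced by a homomorphism `R → S` of `F`-algebras. -/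
def Points.map (f : R →ₐ[F] S) : Points A R →+ Points A S where
  toFun x := Additive.ofMul (specOverMap f ≫ x.toMul)
  map_zero' := by
    change Additive.ofMul (specOverMap f ≫ (1 : specOver F R ⟶ A)) = Additive.ofMul 1
    rw [MonObj.comp_one]
  map_add' x y := by
    change Additive.ofMul (specOverMap f ≫ (x.toMul * y.toMul)) = _
    rw [MonObj.comp_mul]
    rfl

lemma Points.map_id_apply (x : Points A R) : Points.map A (AlgHom.id F R) x = x := by
  have h : specOverMap (AlgHom.id F R) = 𝟙 (specOver F R) := by
    ext1
    exact Spec.map_id _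
  change Additive.ofMul (specOverMap (AlgHom.id F R) ≫ x.toMul) = x
  rw [h, Category.id_comp]
  rfl

lemma Points.map_map (f : R →ₐ[F] S) (g : S →ₐ[F] T) (x : Points A R) :
    Points.map A g (Points.map A f x) = Points.map A (g.comp f) x := by
  have h : specOverMap (g.comp f) = specOverMap g ≫ specOverMap f := by
    ext1
    exact Spec.map_comp (CommRingCat.ofHom f.toRingHom) (CommRingCat.ofHom g.toRingHom)
  change Additive.ofMul (specOverMap g ≫ specOverMap f ≫ x.toMul) =
    Additive.ofMul (specOverMap (g.comp f) ≫ x.toMul)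
  rw [h, Category.assoc]

/-- If a group `G` acts on an `F`-algebra `S` by automorphisms over `F`, then it acts on the
discrete group `A(S)` by functoriality. -/
abbrev pointsRep {G : Type u} [Group G] (ρ : G →* (S ≃ₐ[F] S)) : TopRep.{u} ℤ G :=
  TopRep.of (X := Points A S) (ContRepresentation.ofMonoidHom
    { toFun g :=
        { toLinearMap := (Points.map A (ρ g).toAlgHom).toIntLinearMap
          cont := continuous_of_discreteTopology }
      map_one' := by
        ext x
        change Points.map A (ρ 1).toAlgHom x = x
        rw [map_one]
        exact Points.map_id_apply A x
      map_mul' g h := by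
        ext x
        change Points.map A (ρ (g * h)).toAlgHom x =
          Points.map A (ρ g).toAlgHom (Points.map A (ρ h).toAlgHom x)
        rw [Points.map_map, map_mul]
        rfl })

/-- The map `A(S) → A(T)` induced by a homomorphism `f : S → T` of `F`-algebras that is equivariant
along a group homomorphism `φ : H → G`. -/
def pointsRepMap {G H : Type u} [Group G] [Group H] {ρ : G →* (S ≃ₐ[F] S)}
    {ρ' : H →* (T ≃ₐ[F] T)} (φ : H →* G) (f : S →ₐ[F] T)
    (hf : ∀ h s, f (ρ (φ h) s) = ρ' h (f s)) :
    TopRep.res φ (pointsRep A ρ) ⟶ pointsRep A ρ' :=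
  TopRep.ofHom
    { toLinearMap := (Points.map A f).toIntLinearMap
      cont := continuous_of_discreteTopology
      isIntertwining' h := by
        ext x
        change Points A S at x
        change Points.map A f (Points.map A (ρ (φ h)).toAlgHom x) =
          Points.map A (ρ' h).toAlgHom (Points.map A f x)
        rw [Points.map_map, Points.map_map,
          show f.comp (ρ (φ h)).toAlgHom = (ρ' h).toAlgHom.comp f from AlgHom.ext (hf h)] }

end Points

/-! ### Absolute Galois groups -/

section Galois

variable {F : Type u} [Field F] {K L : Type u} [Field K] [Field L] [Algebra F K] [Algebra F L]

lemma exists_sepEmbedding (φ : K →ₐ[F] L) :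
    ∃ j : SeparableClosure K →ₐ[F] SeparableClosure L,
      ∀ x : K, j (algebraMap K _ x) = algebraMap L _ (φ x) := by
  let : Algebra K (SeparableClosure L) :=
    ((algebraMap L (SeparableClosure L)).comp φ.toRingHom).toAlgebra
  let j : SeparableClosure K →ₐ[K] SeparableClosure L := IsSepClosed.lift
  have hj : ∀ x : K, j (algebraMap K _ x) = algebraMap L _ (φ x) := fun x => j.commutes x
  refine ⟨{ j.toRingHom with commutes' := fun x => ?_ }, hj⟩
  change j (algebraMap F _ x) = _
  rw [IsScalarTower.algebraMap_apply F K (SeparableClosure K), hj, AlgHom.commutes,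
    ← IsScalarTower.algebraMap_apply F L (SeparableClosure L)]

/-- A chosen embedding `K^sep → L^sep` that extends `φ : K → L`. -/
def sepEmbedding (φ : K →ₐ[F] L) : SeparableClosure K →ₐ[F] SeparableClosure L :=
  (exists_sepEmbedding φ).choose

lemma sepEmbedding_algebraMap (φ : K →ₐ[F] L) (x : K) :
    sepEmbedding φ (algebraMap K _ x) = algebraMap L _ (φ x) :=
  (exists_sepEmbedding φ).choose_spec x

lemma exists_absGalRestrict (φ : K →ₐ[F] L) :
    ∃ r : Gal(SeparableClosure L/L) →ₜ* Gal(SeparableClosure K/K),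
      ∀ σ x, sepEmbedding φ (r σ x) = σ (sepEmbedding φ x) := by
  let : Algebra K L := φ.toRingHom.toAlgebra
  let : Algebra K (SeparableClosure L) :=
    ((algebraMap L (SeparableClosure L)).comp φ.toRingHom).toAlgebra
  let : Algebra (SeparableClosure K) (SeparableClosure L) := (sepEmbedding φ).toRingHom.toAlgebra
  have : IsScalarTower K L (SeparableClosure L) := .of_algebraMap_eq fun _ => rfl
  have : IsScalarTower K (SeparableClosure K) (SeparableClosure L) :=
    .of_algebraMap_eq fun x => (sepEmbedding_algebraMap φ x).symm
  let r : Gal(SeparableClosure L/L) →* Gal(SeparableClosure K/K) :=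
    IntermediateField.restrictRestrictAlgEquivMapHom K (SeparableClosure K) L (SeparableClosure L)
  have hr : ∀ σ x, sepEmbedding φ (r σ x) = σ (sepEmbedding φ x) := fun σ x =>
    AlgEquiv.restrictNormal_commutes
      (MulSemiringAction.toAlgAut Gal(SeparableClosure L/L) K (SeparableClosure L) σ)
      (SeparableClosure K) x
  refine ⟨⟨r, ?_⟩, hr⟩
  refine continuous_of_continuousAt_one r ?_
  rw [ContinuousAt, map_one, Filter.tendsto_def]
  intro U hU
  obtain ⟨E, hE, hEU⟩ := (krullTopology_mem_nhds_one_iff K (SeparableClosure K) U).1 hU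
  let b := Module.finBasis K E
  have key : ∀ i, (MulAction.stabilizer Gal(SeparableClosure L/L)
      (sepEmbedding φ (b i : SeparableClosure K)) : Set Gal(SeparableClosure L/L)) ∈
        nhds (1 : Gal(SeparableClosure L/L)) := fun i =>
    (stabilizer_isOpen_of_isIntegral _).mem_nhds (one_mem _)
  refine Filter.mem_of_superset (Filter.iInter_mem.2 key) fun σ hσ => hEU ?_
  have hfix : ∀ i, r σ (b i : SeparableClosure K) = b i := fun i =>
    (sepEmbedding φ).toRingHom.injective ((hr σ _).trans (Set.mem_iInter.1 hσ i))
  have hlin : (r σ).toLinearMap ∘ₗ E.val.toLinearMap = E.val.toLinearMap :=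
    b.ext hfix
  rw [SetLike.mem_coe, IntermediateField.mem_fixingSubgroup_iff]
  exact fun x hx => LinearMap.congr_fun hlin ⟨x, hx⟩

/-- The homomorphism of absolute Galois groups `Gal(L) → Gal(K)` given by restricting automorphisms
of `L^sep` to `K^sep`, which is embedded in `L^sep` by `sepEmbedding φ`. -/
def absGalRestrict (φ : K →ₐ[F] L) : Gal(SeparableClosure L/L) →ₜ* Gal(SeparableClosure K/K) :=
  (exists_absGalRestrict φ).choose

lemma sepEmbedding_absGalRestrict (φ : K →ₐ[F] L) (σ : Gal(SeparableClosure L/L))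
    (x : SeparableClosure K) : sepEmbedding φ (absGalRestrict φ σ x) = σ (sepEmbedding φ x) :=
  (exists_absGalRestrict φ).choose_spec σ x

variable (F K)

/-- The action of the absolute Galois group of `K` on `K^sep`, by automorphisms over `F`. -/
def galAction : Gal(SeparableClosure K/K) →*
    (SeparableClosure K ≃ₐ[F] SeparableClosure K) where
  toFun σ := σ.restrictScalars F
  map_one' := rfl
  map_mul' _ _ := rfl

/-- The action of the absolute Galois group of `F` on `K ⊗ F^sep`, through the second factor. -/
def tensorAction : Gal(SeparableClosure F/F) →*
    ((K ⊗[F] SeparableClosure F) ≃ₐ[F] (K ⊗[F] SeparableClosure F)) where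
  toFun σ := Algebra.TensorProduct.congr AlgEquiv.refl σ
  map_one' := by
    apply AlgEquiv.ext
    intro x
    induction x with
    | zero => simp
    | tmul a b => rfl
    | add a b ha hb => rw [map_add, ha, hb, map_add]
  map_mul' σ τ := by
    apply AlgEquiv.ext
    intro x
    induction x with
    | zero => simp
    | tmul a b => rfl
    | add a b ha hb => rw [map_add, ha, hb, map_add]

end Galois

/-! ### Cochains and cohomology of topological groups -/

section Cochains

open ContinuousCohomology

variable {G G' : Type u} [Group G] [TopologicalSpace G] [IsTopologicalGroup G]
  [Group G'] [TopologicalSpace G'] [IsTopologicalGroup G']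

/-- The continuous cohomology group `H^n(G, M)`. -/
abbrev HCont (M : TopRep.{u} ℤ G) (n : ℕ) : Type u :=
  continuousCohomology.{0, u, u} n M

/-- The map `H^n(G, M) → H^n(G', N)` induced by a continuous homomorphism `φ : G' → G` and a
`G'`-equivariant homomorphism `f : M → N`. -/
def mapHCont {M : TopRep.{u} ℤ G} {N : TopRep.{u} ℤ G'} (φ : G' →ₜ* G)
    (f : TopRep.res φ M ⟶ N) (n : ℕ) : HCont M n →+ HCont N n :=
  (map.{0, u, u} φ f n).hom.toLinearMap.toAddMonoidHom

/-- The continuous (homogeneous) `n`-cochains of `G` with values in `M`. -/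
abbrev Cochains (M : TopRep.{u} ℤ G) (n : ℕ) : Type u :=
  (TopRep.homogeneousCochains.{0, u, u} M).X n

/-- The continuous `n`-cocycles of `G` with values in `M`. -/
abbrev Cocycles (M : TopRep.{u} ℤ G) (n : ℕ) : Type u :=
  cocycles.{0, u, u} M n

/-- The coboundary of a cochain. -/
def coboundary (M : TopRep.{u} ℤ G) (n : ℕ) : Cochains M n →+ Cochains M (n + 1) :=
  ((TopRep.homogeneousCochains.{0, u, u} M).d n (n + 1)).hom.toLinearMap.toAddMonoidHom

/-- The inclusion of the cocycles into the cochains. -/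
def cocycleVal (M : TopRep.{u} ℤ G) (n : ℕ) : Cocycles M n →+ Cochains M n :=
  ((TopRep.homogeneousCochains.{0, u, u} M).iCycles n).hom.toLinearMap.toAddMonoidHom

/-- The cohomology class of a cocycle. -/
def cocycleClass (M : TopRep.{u} ℤ G) (n : ℕ) : Cocycles M n →+ HCont M n :=
  (π.{0, u, u} M n).hom.toLinearMap.toAddMonoidHom

/-- The map on cochains induced by a homomorphism of `G`-modules. -/
def mapCochains {M N : TopRep.{u} ℤ G} (f : TopRep.res (ContinuousMonoidHom.id G) M ⟶ N) (n : ℕ) :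
    Cochains M n →+ Cochains N n :=
  ((cochainsMap.{0, u, u} (ContinuousMonoidHom.id G) f).f n).hom.toLinearMap.toAddMonoidHom

end Cochains

/-! ### Galois cohomology -/

section Cohomology

variable {F : Type u} [Field F] (A : Over (Spec (CommRingCat.of F))) [GrpObj A] [IsCommMonObj A]
variable {K L : Type u} [Field K] [Field L] [Algebra F K] [Algebra F L]

/-- The discrete `Gal(K)`-module `A(K^sep)`. -/
def galRep (K : Type u) [Field K] [Algebra F K] : TopRep.{u} ℤ Gal(SeparableClosure K/K) :=
  pointsRep A (galAction F K)

/-- The discrete `Gal(F)`-module `A(K ⊗ F^sep)`. -/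
def tensorRep (K : Type u) [Field K] [Algebra F K] : TopRep.{u} ℤ Gal(SeparableClosure F/F) :=
  pointsRep A (S := K ⊗[F] SeparableClosure F) (tensorAction F K)

/-- The Galois cohomology group `H^n(K, A) = H^n(Gal(K), A(K^sep))` of a field extension `K` of
`F`, i.e. the continuous cohomology of the absolute Galois group. -/
abbrev H (K : Type u) [Field K] [Algebra F K] (n : ℕ) : Type u :=
  HCont (galRep A K) n

/-- The map of Galois modules `A(K^sep) → A(L^sep)` for an extension `φ : K → L`. -/
def galRepMap (φ : K →ₐ[F] L) : TopRep.res (absGalRestrict φ) (galRep A K) ⟶ galRep A L :=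
  pointsRepMap A (absGalRestrict φ).toMonoidHom (sepEmbedding φ) (sepEmbedding_absGalRestrict φ)

/-- The restriction map `H^n(K, A) → H^n(L, A)` for an extension `φ : K → L` of fields over `F`. -/
def resH (φ : K →ₐ[F] L) (n : ℕ) : H A K n →+ H A L n :=
  mapHCont (absGalRestrict φ) (galRepMap A φ) n


/-- The map of `Gal(F)`-modules `A(F^sep) → A(K ⊗ F^sep)`. -/
def toTensorRep (K : Type u) [Field K] [Algebra F K] :
    TopRep.res (ContinuousMonoidHom.id Gal(SeparableClosure F/F)) (galRep A F) ⟶ tensorRep A K :=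
  pointsRepMap A (MonoidHom.id _) Algebra.TensorProduct.includeRight (fun _ _ => rfl)

/-- The map of `Gal(F)`-modules `A(K ⊗ F^sep) → A(L ⊗ F^sep)` for an extension `φ : K → L`. -/
def tensorRepMap (φ : K →ₐ[F] L) :
    TopRep.res (ContinuousMonoidHom.id Gal(SeparableClosure F/F)) (tensorRep A K) ⟶ tensorRep A L :=
  pointsRepMap A (MonoidHom.id _) (Algebra.TensorProduct.map φ (AlgHom.id F _)) (fun σ x => by
    induction x with
    | zero => simp
    | tmul a b => rfl
    | add a b ha hb => simp only [map_add, ha, hb])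

/-- The homomorphism `K ⊗ F^sep → K^sep` given by the embedding of `F^sep` in `K^sep`. -/
def tensorToSep (F K : Type u) [Field F] [Field K] [Algebra F K] :
    K ⊗[F] SeparableClosure F →ₐ[F] SeparableClosure K :=
  Algebra.TensorProduct.productMap (IsScalarTower.toAlgHom F K (SeparableClosure K))
    (sepEmbedding (Algebra.ofId F K))

/-- The map of Galois modules `A(K ⊗ F^sep) → A(K^sep)`. -/
def fromTensorRep (K : Type u) [Field K] [Algebra F K] :
    TopRep.res (absGalRestrict (Algebra.ofId F K)) (tensorRep A K) ⟶ galRep A K :=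
  pointsRepMap A (absGalRestrict (Algebra.ofId F K)).toMonoidHom (tensorToSep F K) (fun σ x => by
    induction x with
    | zero => simp
    | tmul a b =>
      change tensorToSep F K (a ⊗ₜ absGalRestrict (Algebra.ofId F K) σ b) =
        σ (tensorToSep F K (a ⊗ₜ b))
      simp only [tensorToSep, Algebra.TensorProduct.productMap_apply_tmul, map_mul,
        sepEmbedding_absGalRestrict]
      congr 1
      exact (σ.commutes a).symm
    | add a b ha hb => simp only [map_add, ha, hb])

/-! ### Global domination and separable factorization -/

/-- The compositum `L^gd` of `L` and `F^sep` inside `L^sep`, where `F^sep` is the separable closure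
of `F` in `L^sep`. -/
def gd (F L : Type u) [Field F] [Field L] [Algebra F L] :
    IntermediateField L (SeparableClosure L) :=
  IntermediateField.adjoin L (separableClosure F (SeparableClosure L) : Set (SeparableClosure L))

/-- The cohomology of `A` over `L` is globally dominated (with respect to `F`):
`H^n(L^gd, A) = 0` for all `n > 0`. -/
def IsGloballyDominated (L : Type u) [Field L] [Algebra F L] : Prop :=
  ∀ n : ℕ, 0 < n → Subsingleton (H A (gd F L) n)

variable {Γ : OrientedGraph.{v, w}} (X : GammaField Γ F)

/-- The group scheme `A` is separably factorizable over `F_•`: the map from the product of the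
groups `A(F_v ⊗ F^sep)` to the product of the groups `A(F_e ⊗ F^sep)` that sends `(a_v)` to
`(a_{l(e)} a_{r(e)}⁻¹)` is surjective. (The groups are written additively.) -/
def IsSeparablyFactorizable : Prop :=
  Function.Surjective
    fun (a : ∀ v, Points A (X.Fv v ⊗[F] SeparableClosure F)) (e : Γ.E) =>
      Points.map A (Algebra.TensorProduct.map (X.ιl e) (AlgHom.id F (SeparableClosure F)))
          (a (Γ.l e)) -
        Points.map A (Algebra.TensorProduct.map (X.ιr e) (AlgHom.id F (SeparableClosure F)))
          (a (Γ.r e))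

/-! ### The maps of the long exact sequence -/

/-- The map from `H^n(F, A)` to the product of the groups `H^n(F_v, A)`. -/
def resV (n : ℕ) : H A F n →+ ∀ v, H A (X.Fv v) n :=
  AddMonoidHom.pi fun v => resH A (Algebra.ofId F (X.Fv v)) n

/-- The map from the product of the groups `H^n(F_v, A)` to the product of the groups `H^n(F_e, A)`
that sends `(α_v)` to the differences of the restrictions of `α_{l(e)}` and `α_{r(e)}`. -/
def diffVE (n : ℕ) : (∀ v, H A (X.Fv v) n) →+ ∀ e, H A (X.Fe e) n :=
  AddMonoidHom.pi fun e =>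
    (resH A (X.ιl e) n).comp (Pi.evalAddMonoidHom _ (Γ.l e)) -
      (resH A (X.ιr e) n).comp (Pi.evalAddMonoidHom _ (Γ.r e))

/-- The map `H^n(Gal(F), A(K ⊗ F^sep)) → H^n(K, A)`. -/
def tensorToH (K : Type u) [Field K] [Algebra F K] (n : ℕ) :
    HCont (tensorRep A K) n →+ H A K n :=
  mapHCont (absGalRestrict (Algebra.ofId F K)) (fromTensorRep A K) n

/-- A homomorphism `δ` from the product of the groups `H^n(F_e, A)` to `H^{n+1}(F, A)` is the
connecting homomorphism if it is induced by the snake construction for the sequence of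
`Gal(F)`-modules `A(F^sep) → ∏ A(F_v ⊗ F^sep) → ∏ A(F_e ⊗ F^sep)`: let `b_v` be `n`-cochains with
values in `A(F_v ⊗ F^sep)` whose differences are `n`-cocycles `z_e` with values in
`A(F_e ⊗ F^sep)` and whose coboundaries all come from one `(n+1)`-cocycle `a` with values in
`A(F^sep)`. Then `δ` sends the family of the images of the classes of the `z_e` in `H^n(F_e, A)` to
the class of `a`. -/
def IsConnecting (n : ℕ) (δ : (∀ e, H A (X.Fe e) n) →+ H A F (n + 1)) : Prop :=
  ∀ (b : ∀ v, Cochains (tensorRep A (X.Fv v)) n)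
    (z : ∀ e, Cocycles (tensorRep A (X.Fe e)) n) (a : Cocycles (galRep A F) (n + 1)),
    (∀ v, coboundary (tensorRep A (X.Fv v)) n (b v) =
      mapCochains (toTensorRep A (X.Fv v)) (n + 1) (cocycleVal (galRep A F) (n + 1) a)) →
    (∀ e, cocycleVal (tensorRep A (X.Fe e)) n (z e) =
      mapCochains (tensorRepMap A (X.ιl e)) n (b (Γ.l e)) -
        mapCochains (tensorRepMap A (X.ιr e)) n (b (Γ.r e))) →
    δ (fun e => tensorToH A (X.Fe e) n (cocycleClass (tensorRep A (X.Fe e)) n (z e))) =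
      cocycleClass (galRep A F) (n + 1) a

end Cohomology

end GammaPatching

end

set_option linter.unusedSectionVars false

/-! Write `G` for the Galois group of `F^sep/F`. The sequence of `G`-modules `0 → A(F^sep) → ∏ A(F_v
⊗ F^sep) → ∏ A(F_e ⊗ F^sep) → 0` is exact: on the right by separable factorizability, elsewhere
because `A(F^sep)` is the limit of the groups `A(F_v ⊗ F^sep)` (`isPatchingSequence`). Its long
exact cohomology sequence becomes the asserted one once `H^n(G, A(K ⊗ F^sep))` is identified with
`H^n(K, A)` for `K = F_v` and `K = F_e`, compatibly with restriction.

The identification (`tensorToH_bijective`) is a form of Shapiro's lemma. Let `φ : G' → G` be the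
restriction map from the absolute Galois group of `K`. The module `A(K ⊗ F^sep)` is coinduced: it
consists of the smooth functions `G → A(K^sep)` that are equivariant along `φ`. The map `φ` need not
be injective, but its kernel is the Galois group of `K^gd`, and global domination says that this
kernel has no higher cohomology. Consider the double complex of smooth equivariant functions on
pairs of a list in `G` and a list in `G'`. Its rows are always exact, its columns are exact because
the kernel is acyclic, and its two edges compute the cohomology of the coinduced module and of `G'`.
Chasing through it gives injectivity (`exists_diff_eq_of_map_eq`) and surjectivity
(`exists_map_eq_add_diff`), combined in `mapHCont_bijective`.

Since `A` need not be affine, statements about points are reduced to rings by means of affine opens.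
An equivariant function meets only finitely many points of `A`, so it factors through a finite
disjoint union of affine opens (`Points.exists_map_eq`). A compatible family over the vertices lands
in one affine open, because the rings `F_v ⊗ F^sep` are zero-dimensional and the idempotents that
cut out the preimages glue to an idempotent of the field `F^sep` (`Points.exists_map_eq_of_limit`).
Open stabilizers come from `A` being locally of finite type.

Compatibility with restriction along `K → L` involves two embeddings of `F^sep` in `L^sep`. They
differ by an element of `G`, and inner automorphisms act trivially on cohomology
(`mapHCont_eq_of_conj`).

Cochains are handled as functions on lists, with cohomological degree `n` on lists of length `n +
1`. Lifts of cochains are made smooth and equivariant by `exists_equivariant_choice`, which replaces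
continuous sections. -/

noncomputable section

namespace GammaPatching

/-! ### Alternating differences of functions on lists -/

section Diff

variable {Y Z M M' : Type*} [AddCommGroup M] [AddCommGroup M']

/-- The alternating sum of the values of `u` at the lists obtained from a list by deleting one
entry. -/
def altSum : List Y → (List Y → M) → M
  | [], _ => 0
  | y :: l, u => u l - altSum l fun l' => u (y :: l')

lemma altSum_add (l : List Y) (u u' : List Y → M) :
    altSum l (u + u') = altSum l u + altSum l u' := by
  induction l generalizing u u' with
  | nil => simp [altSum]
  | cons y l ih =>
    have := ih (fun l' => u (y :: l')) (fun l' => u' (y :: l'))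
    simp only [altSum, Pi.add_apply]
    rw [show (fun l' => u (y :: l') + u' (y :: l')) =
      (fun l' => u (y :: l')) + fun l' => u' (y :: l') from rfl, this]
    abel

/-- The differential of the complex of functions on lists. -/
def diff : (List Y → M) →+ (List Y → M) where
  toFun u l := altSum l u
  map_zero' := by
    ext l
    have := altSum_add l (0 : List Y → M) 0
    simpa using this
  map_add' u u' := by
    ext l
    exact altSum_add l u u'

@[simp] lemma diff_nil (u : List Y → M) : diff u [] = 0 := rfl

lemma diff_cons (u : List Y → M) (y : Y) (l : List Y) :
    diff u (y :: l) = u l - diff (fun l' => u (y :: l')) l := rfl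

lemma diff_diff (u : List Y → M) : diff (diff u) = 0 := by
  ext l
  induction l generalizing u with
  | nil => rfl
  | cons y l ih =>
    rw [diff_cons, show (fun l' => diff u (y :: l')) = u - diff (fun l' => u (y :: l')) from rfl,
      map_sub, Pi.sub_apply, ih]
    simp

lemma map_diff (f : M →+ M') (u : List Y → M) (l : List Y) :
    f (diff u l) = diff (fun l' => f (u l')) l := by
  induction l generalizing u with
  | nil => simp
  | cons y l ih => rw [diff_cons, diff_cons, map_sub, ih]

lemma diff_map (α : Y → Z) (u : List Z → M) (l : List Y) :
    diff (fun l' => u (l'.map α)) l = diff u (l.map α) := by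
  induction l generalizing u with
  | nil => rfl
  | cons y l ih =>
    rw [diff_cons, List.map_cons, diff_cons, ← ih]
    simp

lemma diff_congr_rel {R : Y → Z → Prop} {u : List Y → M} {u' : List Z → M}
    (h : ∀ l l', List.Forall₂ R l l' → u l = u' l') {l : List Y} {l' : List Z}
    (hl : List.Forall₂ R l l') : diff u l = diff u' l' := by
  induction hl generalizing u u' with
  | nil => rfl
  | @cons x y l l' hxy hl ih =>
    rw [diff_cons, diff_cons, h _ _ hl, ih fun l l' hl => h _ _ (.cons hxy hl)]

lemma diff_congr_length {u u' : List Y → M} {l : List Y}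
    (h : ∀ l', l'.length + 1 = l.length → u l' = u' l') : diff u l = diff u' l := by
  induction l generalizing u u' with
  | nil => rfl
  | cons y l ih =>
    rw [diff_cons, diff_cons, h l rfl, ih fun l' hl' => h _ (by simpa using hl')]

lemma diff_eq_zero_of_length {u : List Y → M} {n : ℕ} (h : ∀ l, l.length ≠ n → u l = 0)
    {l : List Y} (hl : l.length ≠ n + 1) : diff u l = 0 := by
  rw [diff_congr_length (u' := 0) fun l' hl' => h l' (by omega), map_zero]
  rfl

/-- The prism operator that compares the maps on functions on lists given by two maps `α` and
`β`. -/
def prism (α β : Y → Z) : List Y → (List Z → M) → M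
  | [], _ => 0
  | x :: l, u => u (α x :: β x :: l.map β) - prism α β l fun l' => u (α x :: l')

lemma prism_sub (α β : Y → Z) (l : List Y) (u u' : List Z → M) :
    prism α β l (u - u') = prism α β l u - prism α β l u' := by
  induction l generalizing u u' with
  | nil => simp [prism]
  | cons y l ih =>
    have := ih (fun l' => u (α y :: l')) (fun l' => u' (α y :: l'))
    simp only [prism, Pi.sub_apply]
    rw [show (fun l' => u (α y :: l') - u' (α y :: l')) =
      (fun l' => u (α y :: l')) - fun l' => u' (α y :: l') from rfl, this]
    abel

/-- The chain homotopy behind the triviality of inner automorphisms on cohomology. -/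
lemma prism_diff (α β : Y → Z) (u : List Z → M) (l : List Y) :
    prism α β l (diff u) + diff (fun l' => prism α β l' u) l = u (l.map β) - u (l.map α) := by
  induction l generalizing u with
  | nil => simp [prism]
  | cons x l ih =>
    have h1 : (fun l' => diff u (α x :: l')) = u - diff fun l' => u (α x :: l') := rfl
    have h2 : (fun l' => prism α β (x :: l') u) =
      (fun l' => u (α x :: β x :: l'.map β)) - fun l' => prism α β l' fun l' => u (α x :: l') := rfl
    have h3 := ih fun l' => u (α x :: l')
    have h4 := diff_map β (fun l' => u (α x :: β x :: l')) l
    rw [diff_cons, h2, map_sub, Pi.sub_apply, h4]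
    simp only [prism]
    rw [h1, prism_sub, diff_cons, diff_cons]
    simp only [List.map_cons]
    rw [eq_sub_iff_add_eq'] at h3
    rw [← sub_eq_zero] at h3 ⊢
    rw [← h3]
    abel

end Diff

/-! ### Lists modulo open normal subgroups -/

section ModRel

variable {G H : Type*} [Group G] [TopologicalSpace G] [Group H] [TopologicalSpace H]

/-- Two lists of elements of `G` are related if their entries agree modulo `U`. -/
def ModRel (U : OpenNormalSubgroup G) : List G → List G → Prop :=
  List.Forall₂ fun x y => x⁻¹ * y ∈ U

lemma OpenNormalSubgroup.conj_inv_mem {U : OpenNormalSubgroup G} {x : G} (hx : x ∈ U) (g : G) :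
    g⁻¹ * x * g ∈ U := by
  have h : g⁻¹ * x * g⁻¹⁻¹ ∈ U := U.isNormal'.conj_mem x hx g⁻¹
  rwa [inv_inv] at h

lemma ModRel.length_eq {U : OpenNormalSubgroup G} {l l' : List G} (h : ModRel U l l') :
    l.length = l'.length := List.Forall₂.length_eq h

lemma ModRel.refl (U : OpenNormalSubgroup G) (l : List G) : ModRel U l l := by
  induction l with
  | nil => exact .nil
  | cons x l ih => exact .cons (by simp [one_mem]) ih

lemma ModRel.symm {U : OpenNormalSubgroup G} {l l' : List G} (h : ModRel U l l') :
    ModRel U l' l := by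
  induction h with
  | nil => exact .nil
  | cons hx _ ih => exact .cons (by simpa using inv_mem hx) ih

lemma ModRel.trans {U : OpenNormalSubgroup G} {l l' l'' : List G} (h : ModRel U l l')
    (h' : ModRel U l' l'') : ModRel U l l'' := by
  induction h generalizing l'' with
  | nil => exact h'
  | cons hx _ ih =>
    obtain _ | ⟨hy, h'⟩ := h'
    exact .cons (by simpa [mul_assoc] using mul_mem hx hy) (ih h')

lemma ModRel.mono {U V : OpenNormalSubgroup G} (hUV : U ≤ V) {l l' : List G}
    (h : ModRel U l l') : ModRel V l l' :=
  List.Forall₂.imp (fun _ _ hx => hUV hx) h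

lemma ModRel.mul_left {U : OpenNormalSubgroup G} {l l' : List G} (h : ModRel U l l') (g : G) :
    ModRel U (l.map (g * ·)) (l'.map (g * ·)) := by
  induction h with
  | nil => exact .nil
  | cons hx _ ih => exact .cons (by simpa [mul_assoc] using hx) ih

lemma ModRel.map {U : OpenNormalSubgroup H} {V : OpenNormalSubgroup G} {φ : G →* H}
    (h : ∀ x ∈ V, φ x ∈ U) {l l' : List G} (hl : ModRel V l l') :
    ModRel U (l.map φ) (l'.map φ) := by
  induction hl with
  | nil => exact .nil
  | cons hx _ ih => exact .cons (by simpa using h _ hx) ih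

lemma ModRel.append {U : OpenNormalSubgroup G} {l l' m m' : List G} (h : ModRel U l l')
    (h' : ModRel U m m') : ModRel U (l ++ m) (l' ++ m') := by
  induction h with
  | nil => exact h'
  | cons hx _ ih => exact .cons hx ih

/-- Congruence is by right cosets of the form `xU`, so invariance under left translation by `U`
rests on normality. -/
lemma modRel_mul_left_self {U : OpenNormalSubgroup G} {σ : G} (hσ : σ ∈ U) (l : List G) :
    ModRel U (l.map (σ * ·)) l := by
  induction l with
  | nil => exact .nil
  | cons x l ih =>
    refine .cons ?_ ih
    simpa [mul_assoc] using OpenNormalSubgroup.conj_inv_mem (inv_mem hσ) x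

lemma modRel_iff {U : OpenNormalSubgroup G} {l l' : List G} :
    ModRel U l l' ↔
      l.map (QuotientGroup.mk (s := U.toSubgroup)) = l'.map (QuotientGroup.mk (s := U.toSubgroup)) := by
  rw [← List.forall₂_eq_eq_eq, List.forall₂_map_left_iff, List.forall₂_map_right_iff]
  simp only [QuotientGroup.eq]
  rfl

instance : Nonempty (OpenNormalSubgroup G) :=
  ⟨{ toOpenSubgroup := ⊤, isNormal' := inferInstanceAs (⊤ : Subgroup G).Normal }⟩

lemma exists_comap_le {φ : G →* H} (hφ : Continuous φ) (U : OpenNormalSubgroup H) :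
    ∃ V : OpenNormalSubgroup G, ∀ x ∈ V, φ x ∈ U :=
  ⟨{ toOpenSubgroup := U.toOpenSubgroup.comap φ hφ
     isNormal' := U.isNormal'.comap φ }, fun _ hx => hx⟩

variable [IsTopologicalGroup G] [CompactSpace G]

instance (U : OpenNormalSubgroup G) : Finite (G ⧸ U.toSubgroup) :=
  Subgroup.quotient_finite_of_isOpen _ U.isOpen'

/-- A property of lists of length `n` and of open normal subgroups that only depends on the list
modulo `V` and holds for some subgroup for every list holds for one subgroup for all lists. -/
lemma exists_uniform {α : Type*} [Preorder α] [IsCodirectedOrder α] [Nonempty α]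
    (V : OpenNormalSubgroup G) (n : ℕ)
    (Q : List G → α → Prop) (mono : ∀ l W W', W' ≤ W → Q l W → Q l W')
    (inv : ∀ l l' W, ModRel V l l' → l.length = n → Q l W → Q l' W)
    (ex : ∀ l, l.length = n → ∃ W, Q l W) : ∃ W, ∀ l, l.length = n → Q l W := by
  -- Since `G ⧸ V` is finite, lists of length `n` fall into finitely many classes modulo `V`; one
  -- witness per class and a common lower bound of these suffice.
  have hsurj : ∀ q : List.Vector (G ⧸ V.toSubgroup) n, ∃ l : List G, l.length = n ∧
      l.map (QuotientGroup.mk (s := V.toSubgroup)) = q.1 := by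
    intro q
    obtain ⟨l, hl⟩ := List.map_surjective_iff.2 (QuotientGroup.mk_surjective (s := V.toSubgroup)) q.1
    refine ⟨l, ?_, hl⟩
    rw [← q.2, ← hl, List.length_map]
  choose r hr hr' using hsurj
  choose W hW using fun q => ex (r q) (hr q)
  have := Fintype.ofFinite (G ⧸ V.toSubgroup)
  obtain ⟨W₀, hW₀⟩ := Finite.exists_ge W
  refine ⟨W₀, fun l hl => ?_⟩
  let q : List.Vector (G ⧸ V.toSubgroup) n := ⟨l.map QuotientGroup.mk, by simpa using hl⟩
  exact inv (r q) l _ (modRel_iff.2 (hr' q)) (hr q) (mono _ _ _ (hW₀ q) (hW q))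

end ModRel

/-! ### Locally constant equivariant choices -/

section Choice

variable {G G' : Type*} [Group G] [TopologicalSpace G] [Group G']

/-- Two lists are related if the orbits under `G'` of their classes modulo `V` agree. -/
def orbitSetoid (φ : G' →* G) (V : OpenNormalSubgroup G) : Setoid (List G) where
  r l l' := ∃ σ, ModRel V (l.map (φ σ * ·)) l'
  iseqv :=
    { refl l := ⟨1, by simpa using ModRel.refl V l⟩
      symm := by
        rintro l l' ⟨σ, h⟩
        refine ⟨σ⁻¹, ?_⟩
        have := (h.mul_left (φ σ⁻¹)).symm
        simpa [Function.comp_def] using this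
      trans := by
        rintro l l' l'' ⟨σ, h⟩ ⟨τ, h'⟩
        refine ⟨τ * σ, ?_⟩
        have := (h.mul_left (φ τ)).trans h'
        simpa [Function.comp_def, mul_assoc] using this }

/-- Locally constant equivariant choices over the lists of length `n + 1`. -/
lemma exists_equivariant_choice [IsTopologicalGroup G] [CompactSpace G] {J : Type*}
    (φ : G' →* G) (α : G' → J → J)
    (α_one : ∀ b, α 1 b = b) (α_mul : ∀ σ τ b, α (σ * τ) b = α σ (α τ b)) (n : ℕ) (S : List G → Set J)
    (hS : ∀ σ l b, l.length = n + 1 → b ∈ S l → α σ b ∈ S (l.map (φ σ * ·)))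
    (U : OpenNormalSubgroup G)
    (hU : ∀ l l', ModRel U l l' → l.length = n + 1 → S l ⊆ S l')
    (hne : ∀ l, l.length = n + 1 →
      ∃ b ∈ S l, ∃ V : OpenNormalSubgroup G, ∀ σ, φ σ ∈ V → α σ b = b) :
    ∃ (β : List G → J) (V : OpenNormalSubgroup G), (∀ l, l.length = n + 1 → β l ∈ S l) ∧
      (∀ σ l, l.length = n + 1 → β (l.map (φ σ * ·)) = α σ (β l)) ∧
      ∀ l l', ModRel V l l' → l.length = n + 1 → β l = β l' := by
  have : Nonempty J := (hne (List.replicate (n + 1) 1) (by simp)).nonempty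
  obtain ⟨W, hW⟩ := exists_uniform U (n + 1)
    (fun l W => ∃ b ∈ S l, ∀ σ, φ σ ∈ (W : OpenNormalSubgroup G) → α σ b = b)
    (fun l W W' hWW' ⟨b, hb, h⟩ => ⟨b, hb, fun σ hσ => h σ (SetLike.le_def.1 hWW' hσ)⟩)
    (fun l l' W hl hn ⟨b, hb, h⟩ => ⟨b, hU l l' hl hn hb, h⟩)
    (fun l hl => by
      obtain ⟨b, hb, V, hV⟩ := hne l hl
      exact ⟨V, b, hb, hV⟩)
  choose! b hb hbfix using hW
  -- One representative is taken in every orbit of `G'` on lists modulo `V`, and the values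
  -- elsewhere are transported from it. Elements over `W` fix the chosen `b l`, and congruence
  -- modulo `U` preserves `S l`.
  let V := W ⊓ U
  let s : List G → List G := fun l => (Quotient.mk (orbitSetoid φ V) l).out
  have hs : ∀ l, ∃ σ, ModRel V ((s l).map (φ σ * ·)) l := fun l =>
    Quotient.exact (Quotient.out_eq (Quotient.mk (orbitSetoid φ V) l))
  choose τ hτ using hs
  have hlen : ∀ l, (s l).length = l.length := fun l => by simpa using (hτ l).length_eq
  -- Transport is well defined: the list is nonempty, so translations that agree modulo `V` at its
  -- first entry differ, by normality, by an element over `V`, which fixes `b l`.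
  have key : ∀ l σ σ', l.length = n + 1 → ModRel V (l.map (φ σ * ·)) (l.map (φ σ' * ·)) →
      α σ (b l) = α σ' (b l) := by
    intro l σ σ' hl h
    obtain _ | ⟨g, l⟩ := l
    · simp at hl
    rw [List.map_cons, List.map_cons] at h
    obtain _ | ⟨h, -⟩ := h
    have h1 : g⁻¹ * φ (σ⁻¹ * σ') * g ∈ V := by simpa [mul_assoc] using h
    have h2 : φ (σ⁻¹ * σ') ∈ V := by
      simpa [mul_assoc] using OpenNormalSubgroup.conj_inv_mem h1 g⁻¹
    have h3 := hbfix _ hl _ h2.1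
    conv_lhs => rw [← h3]
    rw [← α_mul, mul_inv_cancel_left]
  have hbeta : ∀ l l' σ, l.length = n + 1 → ModRel V (l.map (φ σ * ·)) l' →
      α (τ l') (b (s l')) = α σ (α (τ l) (b (s l))) := by
    intro l l' σ hl h
    have hss : s l' = s l := by
      simp only [s]
      rw [Quotient.sound (s := orbitSetoid φ V) ⟨σ, h⟩]
    have h1 : ModRel V ((s l).map (φ (σ * τ l) * ·)) l' := by
      have := ((hτ l).mul_left (φ σ)).trans h
      simpa [Function.comp_def, mul_assoc] using this
    have h2 := hτ l'
    rw [hss] at h2 ⊢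
    rw [key (s l) (τ l') (σ * τ l) (by rw [hlen, hl]) (h2.trans h1.symm), α_mul]
  refine ⟨fun l => α (τ l) (b (s l)), V, fun l hl => ?_, fun σ l hl => ?_, fun l l' h hl => ?_⟩
  · have h1 : (s l).length = n + 1 := by rw [hlen, hl]
    exact hU _ _ ((hτ l).mono inf_le_right) (by simpa using h1) (hS _ _ _ h1 (hb _ h1))
  · exact hbeta l _ σ hl (ModRel.refl _ _)
  · have := hbeta l l' 1 hl (by simpa using h)
    simpa only [α_one] using this.symm

end Choice

/-! ### Double complexes -/

section Zigzag

variable {T : Type*} [AddCommGroup T] (d e : T →+ T) (D : ℕ → ℕ → AddSubgroup T)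

/-- A chase in a double complex with exact columns. -/
lemma zigzag (hde : ∀ c, d (e c) = e (d c)) (hdd : ∀ c, d (d c) = 0)
    (hd : ∀ a b c, c ∈ D a b → d c ∈ D (a + 1) b)
    (hex : ∀ a b c, c ∈ D (a + 1) (b + 1) → e c = 0 → ∃ y ∈ D (a + 1) b, e y = c)
    (hinj : ∀ a c, c ∈ D (a + 1) 0 → e c = 0 → c = 0)
    (m : ℕ) (E : ℕ → ℕ → T) (hE : ∀ a b, a + b = m + 1 → E a b ∈ D a b)
    (hEE : ∀ a b, a + b = m → d (E a (b + 1)) = e (E (a + 1) b))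
    (w : T) (hw : w ∈ D 0 m) (hEw : E 0 (m + 1) = e w) :
    ∃ w' ∈ D m 0, E (m + 1) 0 = d w' := by
  -- Up to a `d`-coboundary, every entry of the zigzag is an `e`-coboundary; exactness for `e`
  -- carries this one step along the antidiagonal.
  have claim : ∀ a b, a + b = m → ∃ w ∈ D a b, ∃ w', E a (b + 1) = e w + d w' := by
    intro a
    induction a with
    | zero =>
      rintro b hb
      obtain rfl : b = m := by omega
      exact ⟨w, hw, 0, by simpa using hEw⟩
    | succ a ih =>
      intro b hb
      obtain ⟨w, hw, w', h⟩ := ih (b + 1) (by omega)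
      have h1 : e (E (a + 1) (b + 1) - d w) = 0 := by
        rw [map_sub, ← hEE a (b + 1) (by omega), h, map_add, hdd, hde]
        simp
      obtain ⟨y, hy, hye⟩ := hex a b _ (sub_mem (hE (a + 1) (b + 1) (by omega)) (hd _ _ _ hw)) h1
      exact ⟨y, hy, w, by rw [hye]; abel⟩
  obtain ⟨w, hw, w', h⟩ := claim m 0 (by omega)
  refine ⟨w, hw, ?_⟩
  rw [← sub_eq_zero]
  refine hinj m _ (sub_mem (hE _ _ (by omega)) (hd _ _ _ hw)) ?_
  rw [map_sub, ← hEE m 0 (by omega), h, map_add, hdd, hde]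
  simp

/-- In a double complex with exact columns, a cocycle of the left boundary extends to a zigzag. -/
lemma exists_zigzag (hde : ∀ c, d (e c) = e (d c)) (hdd : ∀ c, d (d c) = 0)
    (hd : ∀ a b c, c ∈ D a b → d c ∈ D (a + 1) b)
    (hex : ∀ a b c, c ∈ D (a + 1) (b + 1) → e c = 0 → ∃ y ∈ D (a + 1) b, e y = c)
    (b : ℕ) (a : ℕ) (c : T) (hc : c ∈ D a b) (hec : e (d c) = 0) :
    ∃ E : ℕ → T, E 0 = c ∧ (∀ i j, i + j = b → E i ∈ D (a + i) j) ∧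
      (∀ i j, i + j + 1 = b → d (E i) = e (E (i + 1))) ∧ e (d (E b)) = 0 := by
  induction b generalizing a c with
  | zero =>
    refine ⟨fun _ => c, rfl, fun i j h => ?_, fun i j h => by omega, hec⟩
    obtain ⟨rfl, rfl⟩ : i = 0 ∧ j = 0 := by omega
    exact hc
  | succ b ih =>
    obtain ⟨y, hy, hye⟩ := hex a b _ (hd _ _ _ hc) hec
    obtain ⟨E, h0, h1, h2, h3⟩ := ih (a + 1) y hy (by rw [← hde, hye, hdd])
    refine ⟨fun i => Nat.casesOn i c E, rfl, fun i j h => ?_, fun i j h => ?_, h3⟩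
    · cases i with
      | zero =>
        obtain rfl : j = b + 1 := by omega
        exact hc
      | succ i =>
        rw [show a + (i + 1) = a + 1 + i by omega]
        exact h1 i j (by omega)
    · cases i with
      | zero => exact hye.symm.trans (congrArg e h0.symm)
      | succ i => exact h2 i j (by omega)

end Zigzag

/-! ### Smooth equivariant cochains as functions on lists -/

section Cochains

variable {G G' : Type*} [Group G] [TopologicalSpace G] [Group G'] [TopologicalSpace G']
  {M N : Type*} [AddCommGroup M] [AddCommGroup N]

/-- A function on lists is smooth if it only depends on the entries modulo an open normal
subgroup. -/
def IsSmooth (u : List G → M) : Prop :=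
  ∃ U : OpenNormalSubgroup G, ∀ l l', ModRel U l l' → u l = u l'

lemma isSmooth_zero : IsSmooth (0 : List G → M) := ⟨Classical.arbitrary _, fun _ _ _ => rfl⟩

lemma IsSmooth.add {u u' : List G → M} (h : IsSmooth u) (h' : IsSmooth u') : IsSmooth (u + u') := by
  obtain ⟨U, hU⟩ := h
  obtain ⟨U', hU'⟩ := h'
  refine ⟨U ⊓ U', fun l l' hl => ?_⟩
  rw [Pi.add_apply, Pi.add_apply, hU l l' (hl.mono inf_le_left), hU' l l' (hl.mono inf_le_right)]

lemma IsSmooth.comp {M' : Type*} [AddCommGroup M'] {u : List G → M} (h : IsSmooth u) (f : M → M') :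
    IsSmooth fun l => f (u l) := by
  obtain ⟨U, hU⟩ := h
  exact ⟨U, fun l l' hl => congrArg f (hU l l' hl)⟩

lemma IsSmooth.neg {u : List G → M} (h : IsSmooth u) : IsSmooth (-u) := h.comp (- ·)

lemma IsSmooth.diff {u : List G → M} (h : IsSmooth u) : IsSmooth (diff u) := by
  obtain ⟨U, hU⟩ := h
  exact ⟨U, fun l l' hl => diff_congr_rel hU hl⟩

lemma IsSmooth.map {u : List G → M} (h : IsSmooth u) {φ : G' →* G} (hφ : Continuous φ) :
    IsSmooth fun l => u (l.map φ) := by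
  obtain ⟨U, hU⟩ := h
  obtain ⟨V, hV⟩ := exists_comap_le hφ U
  exact ⟨V, fun l l' hl => hU _ _ (hl.map hV)⟩

lemma IsSmooth.mul_left {u : List G → M} (h : IsSmooth u) (g : G) :
    IsSmooth fun l => u (l.map (g * ·)) := by
  obtain ⟨U, hU⟩ := h
  exact ⟨U, fun l l' hl => hU _ _ (hl.mul_left g)⟩

end Cochains

section Cochains

variable {G G' : Type*} [Group G] [TopologicalSpace G] [Group G']
  {N : Type*} [AddCommGroup N]

/-- The smooth functions on lists of length `n > 0` of elements of `G` with values in `N` that are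
equivariant along `φ : G' → G`. -/
def listCochains (φ : G' →* G) (ρ : G' →* AddMonoid.End N) (n : ℕ) : AddSubgroup (List G → N) where
  carrier := {u | u [] = 0 ∧ (∀ l, l.length ≠ n → u l = 0) ∧
    (∀ σ l, u (l.map (φ σ * ·)) = ρ σ (u l)) ∧ IsSmooth u}
  zero_mem' := ⟨rfl, fun _ _ => rfl, fun _ _ => by simp, isSmooth_zero⟩
  add_mem' := by
    rintro u u' ⟨h1, h2, h3, h4⟩ ⟨h1', h2', h3', h4'⟩
    refine ⟨by simp [h1, h1'], fun l hl => by simp [h2 l hl, h2' l hl],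
      fun σ l => by simp [h3, h3'], h4.add h4'⟩
  neg_mem' := by
    rintro u ⟨h1, h2, h3, h4⟩
    refine ⟨by simp [h1], fun l hl => by simp [h2 l hl], fun σ l => by simp [h3], h4.neg⟩

lemma diff_mem_listCochains {φ : G' →* G} {ρ : G' →* AddMonoid.End N} {n : ℕ} {u : List G → N}
    (hu : u ∈ listCochains φ ρ n) : diff u ∈ listCochains φ ρ (n + 1) := by
  obtain ⟨h1, h2, h3, h4⟩ := hu
  refine ⟨rfl, fun l hl => diff_eq_zero_of_length h2 hl, fun σ l => ?_, h4.diff⟩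
  rw [← diff_map]
  simp_rw [h3]
  exact (map_diff (ρ σ : N →+ N) u l).symm

/-- The condition `u [] = 0` removes the augmentation, so that there are no nonzero coboundaries
among lists of length one, that is, in cohomological degree zero. -/
lemma listCochains_zero {φ : G' →* G} {ρ : G' →* AddMonoid.End N} {u : List G → N}
    (hu : u ∈ listCochains φ ρ 0) : u = 0 := by
  ext l
  obtain _ | ⟨x, l⟩ := l
  · exact hu.1
  · exact hu.2.1 _ (by simp)

/-- The complex of smooth functions on lists of elements of `G'` that are equivariant under the
kernel of `φ` has no higher cohomology. -/
def IsKerAcyclic [TopologicalSpace G'] (φ : G' →* G) (ρ : G' →* AddMonoid.End N) : Prop :=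
  ∀ n, ∀ u ∈ listCochains φ.ker.subtype (ρ.comp φ.ker.subtype) (n + 2), diff u = 0 →
    ∃ w ∈ listCochains φ.ker.subtype (ρ.comp φ.ker.subtype) (n + 1), diff w = u

/-- The action of `G'` on functions on lists of elements of `G'`. -/
def listAct (ρ : G' →* AddMonoid.End N) (σ : G') (u : List G' → N) : List G' → N :=
  fun l => ρ σ (u (l.map (σ⁻¹ * ·)))

lemma listAct_one (ρ : G' →* AddMonoid.End N) (u : List G' → N) : listAct ρ 1 u = u := by
  ext l
  simp [listAct]

lemma listAct_mul (ρ : G' →* AddMonoid.End N) (σ τ : G') (u : List G' → N) :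
    listAct ρ (σ * τ) u = listAct ρ σ (listAct ρ τ u) := by
  ext l
  simp [listAct, Function.comp_def, mul_assoc]

lemma diff_listAct (ρ : G' →* AddMonoid.End N) (σ : G') (u : List G' → N) :
    diff (listAct ρ σ u) = listAct ρ σ (diff u) := by
  ext l
  simp only [listAct]
  rw [← diff_map]
  exact (map_diff (ρ σ : N →+ N) _ l).symm

lemma listAct_eq_iff {ρ : G' →* AddMonoid.End N} {σ : G'} {u : List G' → N} :
    listAct ρ σ u = u ↔ ∀ l, u (l.map (σ * ·)) = ρ σ (u l) := by
  constructor
  · intro h l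
    have := congrFun h (l.map (σ * ·))
    simpa [listAct, Function.comp_def] using this.symm
  · intro h
    ext l
    have := h (l.map (σ⁻¹ * ·))
    simpa [listAct, Function.comp_def] using this.symm

end Cochains

/-! ### Stabilizers of smooth cochains -/

section Stabilizers

variable {G G' : Type*} [Group G] [TopologicalSpace G] [Group G'] [TopologicalSpace G']
  [IsTopologicalGroup G'] [CompactSpace G']
  {N : Type*} [AddCommGroup N]

/-- The stabilizers of the elements of `N` are open. -/
def HasOpenStabilizers (ρ : G' →* AddMonoid.End N) : Prop :=
  ∀ n, ∃ U : OpenNormalSubgroup G', ∀ σ ∈ U, ρ σ n = n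

/-- On lists of length `n` only finitely many values matter, and their open stabilizers can be
intersected. -/
lemma exists_listAct_eq {ρ : G' →* AddMonoid.End N} (hρ : HasOpenStabilizers ρ) {n : ℕ}
    {u : List G' → N} (hn : ∀ l, l.length ≠ n → u l = 0) (hu : IsSmooth u) :
    ∃ W : OpenNormalSubgroup G', ∀ σ ∈ W, listAct ρ σ u = u := by
  obtain ⟨U, hU⟩ := hu
  obtain ⟨W, hW⟩ := exists_uniform U n
    (fun l W => ∀ σ ∈ (W : OpenNormalSubgroup G'), ρ σ (u l) = u l)
    (fun l W W' h hl σ hσ => hl σ (SetLike.le_def.1 h hσ))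
    (fun l l' W hl _ h σ hσ => by rw [← hU l l' hl, h σ hσ])
    (fun l _ => hρ _)
  refine ⟨W ⊓ U, fun σ hσ => listAct_eq_iff.2 fun l => ?_⟩
  rw [hU _ _ (modRel_mul_left_self hσ.2 l)]
  by_cases hl : l.length = n
  · exact (hW l hl σ hσ.1).symm
  · simp [hn l hl]

variable [IsTopologicalGroup G] [CompactSpace G] [TotallyDisconnectedSpace G] [T2Space G]

/-- The image of the complement of `O` is compact, hence closed, and does not contain `1`. -/
lemma exists_preimage_subset {φ : G' →* G} (hφ : Continuous φ) {O : Set G'} (hO : IsOpen O)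
    (hker : ∀ σ, φ σ = 1 → σ ∈ O) : ∃ V : OpenNormalSubgroup G, ∀ σ, φ σ ∈ V → σ ∈ O := by
  have h1 : IsClosed (φ '' Oᶜ) := (hO.isClosed_compl.isCompact.image hφ).isClosed
  obtain ⟨V, hV⟩ := ProfiniteGrp.exist_openNormalSubgroup_sub_open_nhds_of_one
    h1.isOpen_compl (by rintro ⟨σ, hσ, h⟩; exact hσ (hker σ h))
  refine ⟨V, fun σ hσ => ?_⟩
  by_contra h
  exact hV hσ ⟨σ, h, rfl⟩

/-- An open subgroup of `G'` that fixes `u` generates with the kernel an open subgroup that still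
fixes `u`, and this contains the preimage of an open subgroup of `G`. -/
lemma exists_listAct_eq_of_ker {φ : G' →* G} (hφ : Continuous φ) {ρ : G' →* AddMonoid.End N}
    (hρ : HasOpenStabilizers ρ) {n : ℕ} {u : List G' → N} (hn : ∀ l, l.length ≠ n → u l = 0)
    (hu : IsSmooth u) (hker : ∀ σ, φ σ = 1 → ∀ l, u (l.map (σ * ·)) = ρ σ (u l)) :
    ∃ V : OpenNormalSubgroup G, ∀ σ, φ σ ∈ V → listAct ρ σ u = u := by
  obtain ⟨W, hW⟩ := exists_listAct_eq hρ hn hu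
  obtain ⟨V, hV⟩ := exists_preimage_subset hφ (O := (φ.ker ⊔ W.toSubgroup : Subgroup G'))
    (Subgroup.isOpen_mono le_sup_right W.isOpen')
    (fun σ hσ => (le_sup_left : φ.ker ≤ φ.ker ⊔ W.toSubgroup) hσ)
  refine ⟨V, fun σ hσ => ?_⟩
  obtain ⟨k, hk, w, hw, rfl⟩ := Subgroup.mem_sup_of_normal_right.1 (hV σ hσ)
  rw [listAct_mul, hW w hw, listAct_eq_iff.2 (hker k hk)]

end Stabilizers

/-! ### The double complex of a homomorphism of groups -/

section Bicochains

variable {G G' : Type*} [Group G] [TopologicalSpace G] [Group G'] [TopologicalSpace G']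
  {N : Type*} [AddCommGroup N] (φ : G' →* G) (ρ : G' →* AddMonoid.End N)

/-- The smooth functions on pairs of a list of length `a` of elements of `G` and a list of length
`b` of elements of `G'` that are equivariant under `G'`. -/
def bicochains (a b : ℕ) : AddSubgroup (List G → List G' → N) where
  carrier := {c | c [] [] = 0 ∧ (∀ l m, l.length ≠ a → c l m = 0) ∧
    (∀ l m, m.length ≠ b → c l m = 0) ∧
    (∀ σ l m, c (l.map (φ σ * ·)) (m.map (σ * ·)) = ρ σ (c l m)) ∧
    ∃ (U : OpenNormalSubgroup G) (V : OpenNormalSubgroup G'), ∀ l l' m m', ModRel U l l' →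
      ModRel V m m' → c l m = c l' m'}
  zero_mem' := ⟨rfl, fun _ _ _ => rfl, fun _ _ _ => rfl, fun _ _ _ => by simp,
    Classical.arbitrary _, Classical.arbitrary _, fun _ _ _ _ _ _ => rfl⟩
  add_mem' := by
    rintro c c' ⟨h1, h2, h3, h4, U, V, h5⟩ ⟨h1', h2', h3', h4', U', V', h5'⟩
    refine ⟨by simp [h1, h1'], fun l m h => by simp [h2 l m h, h2' l m h],
      fun l m h => by simp [h3 l m h, h3' l m h], fun σ l m => by simp [h4, h4'],
      U ⊓ U', V ⊓ V', fun l l' m m' hl hm => ?_⟩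
    simp only [Pi.add_apply]
    rw [h5 l l' m m' (hl.mono inf_le_left) (hm.mono inf_le_left),
      h5' l l' m m' (hl.mono inf_le_right) (hm.mono inf_le_right)]
  neg_mem' := by
    rintro c ⟨h1, h2, h3, h4, U, V, h5⟩
    exact ⟨by simp [h1], fun l m h => by simp [h2 l m h],
      fun l m h => by simp [h3 l m h], fun σ l m => by simp [h4],
      U, V, fun l l' m m' hl hm => congrArg (- ·) (h5 l l' m m' hl hm)⟩

/-- The differential in the second variable. -/
def vdiff : (List G → List G' → N) →+ (List G → List G' → N) where
  toFun c l := diff (c l)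
  map_zero' := by
    ext l : 1
    exact map_zero _
  map_add' c c' := by
    ext l : 1
    exact map_add _ _ _

lemma vdiff_apply (c : List G → List G' → N) (l : List G) : vdiff c l = diff (c l) := rfl

lemma diff_apply_apply (c : List G → List G' → N) (l : List G) (m : List G') :
    diff c l m = diff (fun l' => c l' m) l :=
  map_diff (Pi.evalAddMonoidHom (fun _ : List G' => N) m) c l

lemma diff_vdiff (c : List G → List G' → N) : diff (vdiff c) = vdiff (diff c) := by
  ext l : 1
  exact (map_diff (diff : (List G' → N) →+ (List G' → N)) c l).symm

variable {φ ρ}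

lemma diff_mem_bicochains (a b : ℕ) (c : List G → List G' → N) (hc : c ∈ bicochains φ ρ a b) :
    diff c ∈ bicochains φ ρ (a + 1) b := by
  obtain ⟨h1, h2, h3, h4, U, V, h5⟩ := hc
  refine ⟨rfl, fun l m hl => ?_, fun l m hm => ?_, fun σ l m => ?_, U, V,
    fun l l' m m' hl hm => ?_⟩
  · rw [diff_apply_apply]
    exact diff_eq_zero_of_length (fun l hl => h2 l m hl) hl
  · rw [diff_apply_apply, diff_congr_length (u' := 0) fun l' _ => h3 l' m hm, map_zero]
    rfl
  · rw [diff_apply_apply, diff_apply_apply, ← diff_map]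
    simp_rw [h4]
    exact (map_diff (ρ σ : N →+ N) _ l).symm
  · rw [diff_apply_apply, diff_apply_apply]
    exact diff_congr_rel (fun l l' hl => h5 l l' m m' hl hm) hl

lemma vdiff_mem_bicochains (a b : ℕ) (c : List G → List G' → N) (hc : c ∈ bicochains φ ρ a b) :
    vdiff c ∈ bicochains φ ρ a (b + 1) := by
  obtain ⟨h1, h2, h3, h4, U, V, h5⟩ := hc
  refine ⟨rfl, fun l m hl => ?_, fun l m hm => ?_, fun σ l m => ?_, U, V,
    fun l l' m m' hl hm => ?_⟩
  · rw [vdiff_apply, diff_congr_length (u' := 0) fun m' _ => h2 l m' hl, map_zero]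
    rfl
  · exact diff_eq_zero_of_length (fun m hm => h3 l m hm) hm
  · rw [vdiff_apply, vdiff_apply, ← diff_map]
    simp_rw [h4]
    exact (map_diff (ρ σ : N →+ N) _ m).symm
  · rw [vdiff_apply, vdiff_apply]
    exact diff_congr_rel (fun m m' hm => h5 l l' m m' hl hm) hm

/-- The rows of the double complex are exact. -/
lemma exists_diff_eq (hφ : Continuous φ) (a b : ℕ) (c : List G → List G' → N)
    (hc : c ∈ bicochains φ ρ a (b + 1)) (hd : diff c = 0) :
    ∃ y : List G → List G' → N, (∀ a', a' + 1 = a → y ∈ bicochains φ ρ a' (b + 1)) ∧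
      (a = 0 → y = 0) ∧ diff y = c := by
  obtain ⟨h1, h2, h3, h4, U, V, h5⟩ := hc
  -- Contracting homotopy of the rows: prepend to `l` the image of the first entry of `m`. This
  -- needs a nonempty `m`, hence the length `b + 1`.
  let y : List G → List G' → N := fun l m =>
    match m with
    | [] => 0
    | x :: m => c (φ x :: l) (x :: m)
  refine ⟨y, ?_, ?_, ?_⟩
  · rintro a' rfl
    obtain ⟨V', hV'⟩ := exists_comap_le hφ U
    refine ⟨rfl, fun l m hl => ?_, fun l m hm => ?_, fun σ l m => ?_, U, V ⊓ V',
      fun l l' m m' hl hm => ?_⟩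
    · obtain _ | ⟨x, m⟩ := m
      · rfl
      · exact h2 _ _ (by simpa using hl)
    · obtain _ | ⟨x, m⟩ := m
      · rfl
      · exact h3 _ _ hm
    · obtain _ | ⟨x, m⟩ := m
      · simp [y]
      · simpa [y] using h4 σ (φ x :: l) (x :: m)
    · obtain _ | ⟨hx, hm⟩ := hm
      · rfl
      · refine h5 _ _ _ _ (.cons ?_ hl)
          (.cons hx.1 (ModRel.mono inf_le_left hm))
        simpa using hV' _ hx.2
  · rintro rfl
    ext l m
    obtain _ | ⟨x, m⟩ := m
    · rfl
    · exact h2 _ _ (by simp)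
  · ext l m
    rw [diff_apply_apply]
    obtain _ | ⟨x, m⟩ := m
    · rw [show (fun l' => y l' []) = 0 from rfl, map_zero, h3 l [] (by simp)]
      rfl
    · have h := congrFun (congrFun hd (φ x :: l)) (x :: m)
      rw [diff_apply_apply, diff_cons] at h
      exact (sub_eq_zero.1 h).symm

end Bicochains

section Columns

variable {G G' : Type*} [Group G] [TopologicalSpace G] [Group G'] [TopologicalSpace G']
  {N : Type*} [AddCommGroup N] {φ : G' →* G} {ρ : G' →* AddMonoid.End N}

/-- The differential at the one-entry list `[1]` is already `c l []`. -/
lemma eq_zero_of_vdiff_eq_zero (a : ℕ) (c : List G → List G' → N) (hc : c ∈ bicochains φ ρ a 0)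
    (hd : vdiff c = 0) : c = 0 := by
  ext l m
  obtain _ | ⟨x, m⟩ := m
  · have h := congrFun (congrFun hd l) [1]
    rw [vdiff_apply, diff_cons, diff_nil, sub_zero] at h
    exact h
  · exact hc.2.2.1 _ _ (by simp)

variable [IsTopologicalGroup G] [CompactSpace G] [TotallyDisconnectedSpace G] [T2Space G]
  [IsTopologicalGroup G'] [CompactSpace G']

/-- The columns of the double complex are exact. -/
lemma exists_vdiff_eq (hφ : Continuous φ) (hρ : HasOpenStabilizers ρ) (hac : IsKerAcyclic φ ρ)
    (a b : ℕ) (c : List G → List G' → N) (hc : c ∈ bicochains φ ρ (a + 1) (b + 1))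
    (hd : vdiff c = 0) : ∃ y ∈ bicochains φ ρ (a + 1) b, vdiff y = c := by
  classical
  obtain ⟨h1, h2, h3, h4, U, V, h5⟩ := hc
  have hker : ∀ σ : G', φ σ = 1 → ∀ l m, c l (m.map (σ * ·)) = ρ σ (c l m) := by
    intro σ hσ l m
    have := h4 σ l m
    rwa [hσ, show ((1 : G) * ·) = id from funext one_mul, List.map_id] at this
  -- The candidates over `l` are all smooth primitives of `c l`, with no equivariance imposed;
  -- equivariance in both variables results from choosing them equivariantly in `l`.
  let S : List G → Set (List G' → N) := fun l =>
    {u | (∀ m, m.length ≠ b → u m = 0) ∧ IsSmooth u ∧ diff u = c l}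
  have hS : ∀ σ l u, l.length = a + 1 → u ∈ S l → listAct ρ σ u ∈ S (l.map (φ σ * ·)) := by
    rintro σ l u hl ⟨hu1, hu2, hu3⟩
    refine ⟨fun m hm => ?_, (hu2.mul_left σ⁻¹).comp (ρ σ), ?_⟩
    · simp [listAct, hu1 (m.map (σ⁻¹ * ·)) (by simpa using hm)]
    · rw [diff_listAct, hu3]
      ext m
      rw [listAct, ← h4]
      simp [Function.comp_def]
  have hSU : ∀ l l', ModRel U l l' → l.length = a + 1 → S l ⊆ S l' := by
    rintro l l' hl - u ⟨hu1, hu2, hu3⟩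
    refine ⟨hu1, hu2, hu3.trans ?_⟩
    ext m
    exact h5 l l' m m hl (ModRel.refl _ _)
  have hne : ∀ l, l.length = a + 1 →
      ∃ u ∈ S l, ∃ V : OpenNormalSubgroup G, ∀ σ, φ σ ∈ V → listAct ρ σ u = u := by
    intro l hl
    have hcd : diff (c l) = 0 := congrFun hd l
    have hcs : IsSmooth (c l) := ⟨V, fun m m' hm => h5 l l m m' (ModRel.refl _ _) hm⟩
    obtain ⟨w, hw, hw1, hw2, hw3⟩ : ∃ w : List G' → N, diff w = c l ∧
        (∀ m, m.length ≠ b → w m = 0) ∧ IsSmooth w ∧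
        ∀ σ, φ σ = 1 → ∀ m, w (m.map (σ * ·)) = ρ σ (w m) := by
      -- For `b = 0` the slice `c l` is a constant function of one variable, and its primitive is
      -- that constant placed at the empty list. This is allowed since bicochains are only required
      -- to vanish at the pair of two empty lists, and `l` is nonempty. For larger `b` the kernel is
      -- acyclic in the degree concerned.
      obtain _ | b := b
      · have hconst : ∀ x y, c l [x] = c l [y] := by
          intro x y
          have := congrFun hcd [x, y]
          simp only [diff_cons, diff_nil, sub_zero, Pi.zero_apply] at this
          exact (sub_eq_zero.1 this).symm
        refine ⟨fun m => if m = [] then c l [1] else 0, ?_, fun m hm => ?_,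
          ⟨V, fun m m' hm => ?_⟩, fun σ hσ m => ?_⟩
        · ext m
          obtain _ | ⟨x, _ | ⟨y, m⟩⟩ := m
          · exact (h3 l [] (by simp)).symm
          · simp [diff_cons, hconst 1 x]
          · exact (diff_eq_zero_of_length (n := 0)
              (fun m hm => if_neg fun h => hm (by simp [h])) (by simp)).trans
              (h3 l _ (by simp)).symm
        · simpa using fun h => absurd h (by simpa using hm)
        · obtain _ | ⟨_, _⟩ := hm <;> simp
        · obtain _ | ⟨x, m⟩ := m
          · simpa [hconst 1 (σ * 1)] using hker σ hσ l [1]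
          · simp
      · obtain ⟨w, ⟨hw1, hw2, hw3, hw4⟩, hw⟩ := hac b (c l)
          ⟨h3 l [] (by simp), fun m hm => h3 l m hm, fun σ m => hker σ σ.2 l m, hcs⟩ hcd
        exact ⟨w, hw, hw2, hw4, fun σ hσ m => hw3 ⟨σ, hσ⟩ m⟩
    -- Equivariance of `w` under the kernel is what makes its stabilizer contain the preimage of an
    -- open subgroup of `G`.
    obtain ⟨V', hV'⟩ := exists_listAct_eq_of_ker hφ hρ hw1 hw2 hw3
    exact ⟨w, ⟨hw1, hw2, hw⟩, V', hV'⟩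
  obtain ⟨β, W, hβ, hβ', hβ''⟩ := exists_equivariant_choice φ (listAct ρ) (listAct_one ρ)
    (listAct_mul ρ) a S hS U hSU hne
  obtain ⟨W', hW'⟩ := exists_uniform W (a + 1)
    (fun l W' => ∀ m m', ModRel (W' : OpenNormalSubgroup G') m m' → β l m = β l m')
    (fun l W₁ W₂ h hl m m' hm => hl m m' (hm.mono h))
    (fun l l' W' hl hn h m m' hm => by rw [← hβ'' l l' hl hn, h m m' hm])
    (fun l hl => (hβ l hl).2.1)
  refine ⟨fun l => if l.length = a + 1 then β l else 0, ⟨by simp, fun l m hl => by simp [hl],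
    fun l m hm => ?_, fun σ l m => ?_, W, W', fun l l' m m' hl hm => ?_⟩, ?_⟩
  · by_cases hl : l.length = a + 1
    · simpa [hl] using (hβ l hl).1 m hm
    · simp [hl]
  · by_cases hl : l.length = a + 1
    · simp only [List.length_map, hl, if_true, hβ']
      simp [listAct, Function.comp_def]
    · simp [hl]
  · by_cases hn : l.length = a + 1
    · beta_reduce
      rw [if_pos hn, if_pos (hl.length_eq.symm.trans hn), ← hβ'' l l' hl hn]
      exact hW' l hn _ _ hm
    · beta_reduce
      rw [if_neg hn, if_neg (by rwa [← hl.length_eq])]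
      rfl
  · ext l : 1
    rw [vdiff_apply]
    by_cases hl : l.length = a + 1
    · rw [if_pos hl, (hβ l hl).2.2]
    · rw [if_neg hl, map_zero]
      ext m
      exact (h2 l m hl).symm

end Columns

/-! ### Comparison of the two edges of the double complex -/

section Concat

variable {Y : Type*} {N : Type*} [AddCommGroup N]

/-- The Leibniz rule for concatenation. -/
lemma diff_append (v : List Y → N) (l m : List Y) :
    diff v (l ++ m) = diff (fun l' => v (l' ++ m)) l +
      (-1 : ℤ) ^ l.length • diff (fun m' => v (l ++ m')) m := by
  induction l generalizing v with
  | nil => simp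
  | cons x l ih =>
    rw [List.cons_append, diff_cons, diff_cons, ih]
    simp only [List.length_cons, pow_succ, List.cons_append]
    rw [mul_neg_one, neg_smul]
    abel

/-- Signs that turn the commuting squares of a zigzag into the terms of a total differential. -/
def zigzagSign : ℕ → ℤ
  | 0 => 1
  | a + 1 => (-1) ^ a * zigzagSign a

lemma zigzagSign_mul_self (a : ℕ) : zigzagSign a * zigzagSign a = 1 := by
  induction a with
  | zero => rfl
  | succ a ih =>
    rw [zigzagSign, mul_mul_mul_comm, ih, ← pow_add, ← two_mul, pow_mul]
    simp

end Concat

section Boundary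

variable {G G' : Type*} [Group G] [TopologicalSpace G] [Group G'] [TopologicalSpace G']
  {N : Type*} [AddCommGroup N] {φ : G' →* G} {ρ : G' →* AddMonoid.End N}

/-- The component of bidegree `(a, b)` of the zigzag that joins a cochain `v` on `G` to its
restriction to `G'`. -/
def concat (φ : G' →* G) (v : List G → N) (a b : ℕ) : List G → List G' → N := fun l m =>
  if l.length = a ∧ m.length = b then zigzagSign a • v (l ++ m.map φ) else 0

lemma concat_mem (hφ : Continuous φ) {n : ℕ} {v : List G → N} (hv : v ∈ listCochains φ ρ n)
    (a b : ℕ) : concat φ v a b ∈ bicochains φ ρ a b := by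
  obtain ⟨h1, h2, h3, U, h4⟩ := hv
  obtain ⟨V, hV⟩ := exists_comap_le hφ U
  refine ⟨by simp [concat, h1], fun l m hl => by simp [concat, hl],
    fun l m hm => by simp [concat, hm], fun σ l m => ?_, U, V, fun l l' m m' hl hm => ?_⟩
  · simp only [concat, List.length_map]
    split_ifs with h
    · rw [map_zsmul, ← h3]
      simp [Function.comp_def]
    · simp
  · simp only [concat, hl.length_eq, hm.length_eq]
    rw [h4 _ _ (hl.append (hm.map hV))]

/-- For a cocycle the two terms of `diff_append` cancel, and the recursion for `zigzagSign` absorbs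
the sign that remains. -/
lemma diff_concat {v : List G → N} (hv : diff v = 0) (a b : ℕ) :
    diff (concat φ v a (b + 1)) = vdiff (concat φ v (a + 1) b) := by
  ext l m
  rw [diff_apply_apply, vdiff_apply]
  by_cases hl : l.length = a + 1
  · by_cases hm : m.length = b + 1
    · rw [diff_congr_length (u := fun l' => concat φ v a (b + 1) l' m)
        (u' := fun l' => zigzagSign a • v (l' ++ m.map φ))
        fun l' hl' => if_pos ⟨by omega, hm⟩,
        diff_congr_length (u := concat φ v (a + 1) b l)
        (u' := fun m' => zigzagSign (a + 1) • v (l ++ m'.map φ))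
        fun m' hm' => if_pos ⟨hl, by omega⟩]
      have h1 := map_diff (zsmulAddGroupHom (zigzagSign a) : N →+ N)
        (fun l' => v (l' ++ m.map φ)) l
      have h2 := map_diff (zsmulAddGroupHom (zigzagSign (a + 1)) : N →+ N)
        (fun m' => v (l ++ m'.map φ)) m
      simp only [zsmulAddGroupHom_apply] at h1 h2
      rw [← h1, ← h2, diff_map φ fun m' => v (l ++ m')]
      have h3 := congrFun hv (l ++ m.map φ)
      rw [diff_append, hl] at h3
      rw [eq_neg_of_add_eq_zero_left h3, zigzagSign, pow_succ, mul_neg_one, neg_smul, neg_neg,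
        smul_smul, mul_comm]
    · rw [diff_congr_length (u := fun l' => concat φ v a (b + 1) l' m) (u' := 0)
        fun l' hl' => if_neg fun h => hm h.2, map_zero]
      exact (diff_eq_zero_of_length (fun m' hm' => if_neg fun h => hm' h.2) hm).symm
  · rw [diff_congr_length (u := concat φ v (a + 1) b l) (u' := 0)
      fun m' hm' => if_neg fun h => hl h.1, map_zero]
    exact diff_eq_zero_of_length (fun l' hl' => if_neg fun h => hl' h.1) hl

/-- A cochain on `G'` as a function on pairs of lists. -/
def ofRight (u : List G' → N) : List G → List G' → N := fun l m =>
  match l with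
  | [] => u m
  | _ :: _ => 0

lemma ofRight_mem {n : ℕ} {u : List G' → N} (hu : u ∈ listCochains (MonoidHom.id G') ρ n) :
    ofRight u ∈ bicochains φ ρ 0 n := by
  obtain ⟨h1, h2, h3, V, h4⟩ := hu
  refine ⟨h1, fun l m hl => ?_, fun l m hm => ?_, fun σ l m => ?_, Classical.arbitrary _, V,
    fun l l' m m' hl hm => ?_⟩
  · obtain _ | ⟨_, _⟩ := l
    · simp at hl
    · rfl
  · obtain _ | ⟨_, _⟩ := l
    · exact h2 m hm
    · rfl
  · obtain _ | ⟨_, _⟩ := l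
    · exact h3 σ m
    · simp [ofRight]
  · obtain _ | ⟨_, _⟩ := hl
    · exact h4 m m' hm
    · rfl

lemma right_mem {n : ℕ} {c : List G → List G' → N} (hc : c ∈ bicochains φ ρ 0 n) :
    c [] ∈ listCochains (MonoidHom.id G') ρ n := by
  obtain ⟨h1, h2, h3, h4, U, V, h5⟩ := hc
  exact ⟨h1, fun m hm => h3 _ m hm, fun σ m => h4 σ [] m, V, fun m m' hm => h5 _ _ _ _ .nil hm⟩

lemma left_mem {n : ℕ} {c : List G → List G' → N} (hc : c ∈ bicochains φ ρ n 0) :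
    (fun l => c l []) ∈ listCochains φ ρ n := by
  obtain ⟨h1, h2, h3, h4, U, V, h5⟩ := hc
  exact ⟨h1, fun l hl => h2 l _ hl, fun σ l => h4 σ l [], U, fun l l' hl => h5 _ _ _ _ hl .nil⟩

variable [IsTopologicalGroup G] [CompactSpace G] [TotallyDisconnectedSpace G] [T2Space G]
  [IsTopologicalGroup G'] [CompactSpace G']

/-- If the kernel of `φ` has no higher cohomology, then a cocycle on `G` is a coboundary if its
restriction to `G'` is a coboundary. -/
theorem exists_diff_eq_of_map_eq (hφ : Continuous φ) (hρ : HasOpenStabilizers ρ)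
    (hac : IsKerAcyclic φ ρ) {n : ℕ} {v : List G → N} (hv : v ∈ listCochains φ ρ (n + 1))
    (hd : diff v = 0) {w : List G' → N} (hw : w ∈ listCochains (MonoidHom.id G') ρ n)
    (h : ∀ m, v (m.map φ) = diff w m) : ∃ y ∈ listCochains φ ρ n, diff y = v := by
  -- The entries `concat φ v a b` join the restriction of `v` to `G'`, at `a = 0`, to `v` up to
  -- sign, at `b = 0`. The chase starts from the primitive `w` of the former and ends with a
  -- primitive of the latter.
  obtain ⟨y, hy, hyE⟩ := zigzag diff vdiff (bicochains φ ρ) diff_vdiff diff_diff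
    diff_mem_bicochains (exists_vdiff_eq hφ hρ hac)
    (fun a c hc h => eq_zero_of_vdiff_eq_zero _ c hc h) n (concat φ v)
    (fun a b _ => concat_mem hφ hv a b) (fun a b _ => diff_concat hd a b) (ofRight w)
    (ofRight_mem hw) (by
      ext l m
      rw [vdiff_apply]
      obtain _ | ⟨x, l⟩ := l
      · change (if _ then _ else _) = diff w m
        rw [← h]
        split_ifs with hm
        · simp [zigzagSign]
        · exact (hv.2.1 _ (by simpa using hm)).symm
      · rw [show ofRight w (x :: l) = 0 from rfl, map_zero]
        exact if_neg (by simp))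
  refine ⟨fun l => zigzagSign (n + 1) • y l [], zsmul_mem (left_mem hy) _, ?_⟩
  ext l
  have h1 := map_diff (zsmulAddGroupHom (zigzagSign (n + 1)) : N →+ N) (fun l => y l []) l
  simp only [zsmulAddGroupHom_apply] at h1
  rw [← h1, ← diff_apply_apply, ← hyE]
  simp only [concat]
  split_ifs with hl
  · rw [smul_smul, zigzagSign_mul_self]
    simp
  · rw [hv.2.1 l (by simpa using hl), smul_zero]

/-- If the kernel of `φ` has no higher cohomology, then every cocycle on `G'` is cohomologous to
the restriction of a cocycle on `G`. -/
theorem exists_map_eq_add_diff (hφ : Continuous φ) (hρ : HasOpenStabilizers ρ)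
    (hac : IsKerAcyclic φ ρ) {n : ℕ} {w : List G' → N}
    (hw : w ∈ listCochains (MonoidHom.id G') ρ (n + 1)) (hd : diff w = 0) :
    ∃ v ∈ listCochains φ ρ (n + 1), diff v = 0 ∧ ∃ y ∈ listCochains (MonoidHom.id G') ρ n,
      ∀ m, v (m.map φ) = w m + diff y m := by
  have hdw : vdiff (diff (ofRight (G := G) w)) = 0 := by
    rw [← diff_vdiff, show vdiff (ofRight (G := G) w) = 0 from ?_, map_zero]
    ext l m
    rw [vdiff_apply]
    obtain _ | ⟨x, l⟩ := l
    · exact congrFun hd m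
    · rw [show ofRight w (x :: l) = 0 from rfl, map_zero]
      rfl
  -- Exact columns extend `w` to a zigzag, whose last entry is a cocycle on `G`.
  obtain ⟨E, hE0, hE1, hE2, hE3⟩ := exists_zigzag diff vdiff (bicochains φ ρ) diff_vdiff diff_diff
    diff_mem_bicochains (exists_vdiff_eq hφ hρ hac) (n + 1) 0 _ (ofRight_mem hw) hdw
  have hE1' : ∀ i j, i + j = n + 1 → E i ∈ bicochains φ ρ i j := fun i j h => by
    simpa using hE1 i j h
  have hEd : diff (E (n + 1)) = 0 :=
    eq_zero_of_vdiff_eq_zero _ _ (diff_mem_bicochains _ _ _ (hE1' (n + 1) 0 rfl)) hE3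
  let v : List G → N := fun l => zigzagSign (n + 1) • E (n + 1) l []
  have hv : v ∈ listCochains φ ρ (n + 1) := zsmul_mem (left_mem (hE1' (n + 1) 0 rfl)) _
  have hdv : diff v = 0 := by
    ext l
    have h1 := map_diff (zsmulAddGroupHom (zigzagSign (n + 1)) : N →+ N)
      (fun l => E (n + 1) l []) l
    simp only [zsmulAddGroupHom_apply] at h1
    rw [← h1, ← diff_apply_apply, hEd]
    simp
  have hvE : concat φ v (n + 1) 0 = E (n + 1) := by
    ext l m
    simp only [concat, v]
    split_ifs with h
    · obtain rfl := List.eq_nil_of_length_eq_zero h.2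
      rw [smul_smul, zigzagSign_mul_self]
      simp
    · rw [not_and_or] at h
      obtain h | h := h
      · exact ((hE1' (n + 1) 0 rfl).2.1 l m h).symm
      · exact ((hE1' (n + 1) 0 rfl).2.2.1 l m h).symm
  -- `concat φ v` and `E` are two zigzags with the same last entry. A chase through the exact rows,
  -- with the two directions exchanged, shows that their first entries differ by a coboundary on
  -- `G'`.
  obtain ⟨y, hy, hyE⟩ := zigzag vdiff diff (fun a b => bicochains φ ρ b a)
    (fun c => (diff_vdiff c).symm)
    (fun c => by ext l : 1; exact diff_diff (c l)) (fun a b => vdiff_mem_bicochains b a)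
    (fun a b c hc h => by
      obtain ⟨y, hy, -, hyc⟩ := exists_diff_eq hφ (b + 1) a c hc h
      exact ⟨y, hy b rfl, hyc⟩)
    (fun a c hc h => by
      obtain ⟨y, -, hy, hyc⟩ := exists_diff_eq hφ 0 a c hc h
      rw [← hyc, hy rfl, map_zero]) n (fun a b => concat φ v b a - E b)
    (fun a b hab => sub_mem (concat_mem hφ hv b a) (hE1' b a (by omega)))
    (fun a b hab => by
      rw [map_sub, map_sub, diff_concat hdv, hE2 b a (by omega)]) 0 (zero_mem _) (by
      rw [hvE, sub_self, map_zero])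
  refine ⟨v, hv, hdv, y [], right_mem hy, fun m => ?_⟩
  have h := congrFun (congrFun hyE []) m
  rw [vdiff_apply, hE0] at h
  rw [← h]
  change _ = w m + ((if _ then _ else _) - w m)
  rw [add_sub_cancel]
  split_ifs with hm
  · simp [zigzagSign]
  · exact hv.2.1 _ (by simpa using hm)

end Boundary

/-! ### Acyclicity of the kernel -/

section Acyclic

variable {P G G' : Type*} [Group P] [TopologicalSpace P] [Group G] [TopologicalSpace G]
  [Group G'] [TopologicalSpace G'] {N : Type*} [AddCommGroup N]

/-- Prepending `1` is a contracting homotopy; it is equivariant because the kernel is trivial. -/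
lemma isKerAcyclic_of_injective {φ : G' →* G} (hφ : Function.Injective φ)
    (ρ : G' →* AddMonoid.End N) : IsKerAcyclic φ ρ := by
  rintro n u ⟨h1, h2, h3, U, h4⟩ hd
  refine ⟨fun l => u (1 :: l), ⟨h2 _ (by simp), fun l hl => h2 _ (by simpa using hl), fun σ l => ?_,
    U, fun l l' hl => h4 _ _ (.cons (by simp [one_mem]) hl)⟩, ?_⟩
  · obtain rfl : σ = 1 := Subtype.ext (hφ (σ.2.trans (map_one φ).symm))
    simp
  · ext l
    have h := congrFun hd (1 :: l)
    rw [diff_cons] at h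
    exact (sub_eq_zero.1 h).symm

variable [IsTopologicalGroup P] [CompactSpace P] [IsTopologicalGroup G'] [CompactSpace G']
  [TotallyDisconnectedSpace G'] [T2Space G']

/-- If the kernel of `φ` is the image of an injective homomorphism `ψ : P → G'` and the group `P`
has no higher cohomology, then `φ` satisfies `IsKerAcyclic`. -/
lemma isKerAcyclic_of_range_eq {φ : G' →* G} {ρ : G' →* AddMonoid.End N}
    (hρ : HasOpenStabilizers ρ) {ψ : P →* G'} (hψ : Continuous ψ) (hinj : Function.Injective ψ)
    (hrange : ψ.range = φ.ker)
    (hP : ∀ n, ∀ u ∈ listCochains (MonoidHom.id P) (ρ.comp ψ) (n + 2), diff u = 0 →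
      ∃ w ∈ listCochains (MonoidHom.id P) (ρ.comp ψ) (n + 1), diff w = u) :
    IsKerAcyclic φ ρ := by
  have hρ' : HasOpenStabilizers (ρ.comp ψ) := fun x => by
    obtain ⟨U, hU⟩ := hρ x
    obtain ⟨V, hV⟩ := exists_comap_le hψ U
    exact ⟨V, fun σ hσ => hU _ (hV σ hσ)⟩
  rintro n u ⟨h1, h2, h3, h4⟩ hd
  have hker : ∀ σ, ψ σ ∈ φ.ker := fun σ => hrange ▸ ⟨σ, rfl⟩
  have hu : u ∈ listCochains ψ (ρ.comp ψ) (n + 2) := ⟨h1, h2, fun σ l => h3 ⟨ψ σ, hker σ⟩ l, h4⟩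
  obtain ⟨w, hw, hwu⟩ := hP n (fun l => u (l.map ψ))
    ⟨h1, fun l hl => h2 _ (by simpa using hl), fun σ l => by
      simpa [Function.comp_def] using h3 ⟨ψ σ, hker σ⟩ (l.map ψ), h4.map hψ⟩ (by
      ext l
      rw [diff_map, hd]
      rfl)
  -- Cochains on `G'` that are equivariant under `P` only still compute the cohomology of `P`: this
  -- is the injectivity half of the comparison along `ψ`, whose kernel is trivial.
  obtain ⟨y, ⟨hy1, hy2, hy3, hy4⟩, hyu⟩ := exists_diff_eq_of_map_eq hψ hρ'
    (isKerAcyclic_of_injective hinj _) hu hd hw fun m => (congrFun hwu m).symm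
  refine ⟨y, ⟨hy1, hy2, fun σ l => ?_, hy4⟩, hyu⟩
  obtain ⟨τ, hτ⟩ : (σ : G') ∈ ψ.range := by
    rw [hrange]
    exact σ.2
  have := hy3 τ l
  rwa [hτ, MonoidHom.comp_apply, hτ] at this

end Acyclic

/-! ### Invariance of cohomology classes under translation -/

section Prism

/-- The relational form serves twice: for smoothness, with congruence modulo an open subgroup, and
for equivariance, with the graph of a left translation. -/
lemma prism_congr_rel {Y Y' Z Z' N : Type*} [AddCommGroup N] {R : Y → Y' → Prop}
    {S : Z → Z' → Prop} {α β : Y → Z} {α' β' : Y' → Z'} (hα : ∀ x y, R x y → S (α x) (α' y))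
    (hβ : ∀ x y, R x y → S (β x) (β' y)) {u : List Z → N} {u' : List Z' → N}
    (hu : ∀ l l', List.Forall₂ S l l' → u l = u' l') {l : List Y} {l' : List Y'}
    (hl : List.Forall₂ R l l') : prism α β l u = prism α' β' l' u' := by
  induction hl generalizing u u' with
  | nil => rfl
  | @cons x y l l' hxy hl ih =>
    rw [prism, prism, ih fun l l' hl => hu _ _ (.cons (hα _ _ hxy) hl), hu]
    refine .cons (hα _ _ hxy) (.cons (hβ _ _ hxy) ?_)
    rw [List.forall₂_map_left_iff, List.forall₂_map_right_iff]
    exact hl.imp hβ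

lemma map_prism {Y Z N N' : Type*} [AddCommGroup N] [AddCommGroup N'] (f : N →+ N') (α β : Y → Z)
    (l : List Y) (u : List Z → N) : f (prism α β l u) = prism α β l fun l' => f (u l') := by
  induction l generalizing u with
  | nil => exact map_zero f
  | cons x l ih => rw [prism, prism, map_sub, ih]

lemma prism_eq_zero {Y Z N : Type*} [AddCommGroup N] {α β : Y → Z} {l : List Y} {u : List Z → N}
    (hu : ∀ l', l'.length = l.length + 1 → u l' = 0) : prism α β l u = 0 := by
  induction l generalizing u with
  | nil => rfl
  | cons x l ih =>
    rw [prism, hu _ (by simp), ih fun l' hl' => hu _ (by simpa using hl'), sub_zero]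

variable {G G' : Type*} [Group G] [TopologicalSpace G] [Group G'] [TopologicalSpace G']
  {N : Type*} [AddCommGroup N]

/-- Translating the arguments of a cocycle does not change its cohomology class. -/
lemma exists_sub_eq_diff {φ : G' →* G} (hφ : Continuous φ) {ρ : G' →* AddMonoid.End N} {n : ℕ}
    {u : List G → N} (hu : u ∈ listCochains φ ρ (n + 1)) (hd : diff u = 0) (γ : G) :
    ∃ w ∈ listCochains (MonoidHom.id G') ρ n,
      ∀ l, u (l.map φ) - u (l.map fun x => φ x * γ) = diff w l := by
  obtain ⟨h1, h2, h3, U, h4⟩ := hu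
  obtain ⟨V, hV⟩ := exists_comap_le hφ U
  -- The prism is equivariant because right multiplication by `γ` commutes with left translations.
  refine ⟨fun l => prism (fun x => φ x * γ) φ l u, ⟨rfl,
    fun l hl => prism_eq_zero fun l' hl' => h2 l' (by omega),
    fun σ l => ?_, V, fun l l' hl => ?_⟩, fun l => ?_⟩
  · refine Eq.trans ?_ (map_prism (ρ σ : N →+ N) _ _ l u).symm
    refine prism_congr_rel (R := fun x y => x = σ * y) (S := fun x y => x = φ σ * y)
      (by rintro x y rfl; simp [mul_assoc]) (by rintro x y rfl; simp) (fun l l' hl => ?_) ?_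
    · refine Eq.trans (congrArg u ?_) (h3 σ l')
      induction hl with
      | nil => rfl
      | cons h _ ih => simp [h, ih]
    · rw [List.forall₂_map_left_iff]
      exact List.forall₂_same.2 fun _ _ => rfl
  · refine prism_congr_rel (S := fun x y => x⁻¹ * y ∈ U) (fun x y hxy => ?_) (fun x y hxy => ?_)
      h4 hl
    · have := OpenNormalSubgroup.conj_inv_mem (hV _ hxy) γ
      simpa [mul_assoc] using this
    · simpa using hV _ hxy
  · have h := prism_diff (fun x => φ x * γ) φ u l
    rw [hd, show prism (fun x => φ x * γ) φ l (0 : List G → N) = 0 from ?_, zero_add] at h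
    · exact h.symm
    · simpa using prism_sub (fun x => φ x * γ) φ l (0 : List G → N) 0

end Prism

/-! ### From continuous cochains to functions on lists -/

section Topology

/-- Continuous maps from a compact space to a discrete space form a discrete space. -/
lemma discreteTopology_continuousMap (Y D : Type*) [TopologicalSpace Y] [CompactSpace Y]
    [TopologicalSpace D] [DiscreteTopology D] : DiscreteTopology C(Y, D) := by
  refine discreteTopology_iff_isOpen_singleton.2 fun f => ?_
  -- Since `f` has finitely many values, finitely many conditions of the compact-open topology
  -- single it out: each fibre, which is compact, must go to the corresponding value.
  have hfin : (Set.range f).Finite := (isCompact_range f.continuous).finite_of_discrete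
  have h : ({f} : Set C(Y, D)) = ⋂ d ∈ Set.range f, {g : C(Y, D) | Set.MapsTo g (f ⁻¹' {d}) {d}} := by
    ext g
    simp only [Set.mem_singleton_iff, Set.mem_iInter, Set.mem_ofPred_eq]
    constructor
    · rintro rfl d - y hy
      exact hy
    · intro h
      ext y
      exact h (f y) ⟨y, rfl⟩ rfl
  rw [h]
  exact hfin.isOpen_biInter fun d _ => ContinuousMap.isOpen_setOfPred_mapsTo
    ((isClosed_discrete {d}).preimage f.continuous).isCompact (isOpen_discrete _)

end Topology

section TopModule

open Limits

variable {R : Type u} [Ring R] [TopologicalSpace R]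

/-- Every cokernel is isomorphic to the explicit quotient `TopModuleCat.cokerπ`, whose elements are
known. The three lemmas that follow argue in the same way, with this quotient or with
`TopModuleCat.kerι`. -/
lemma surjective_of_isColimit {M N P : TopModuleCat.{v} R} {f : M ⟶ N} {p : N ⟶ P} (w : f ≫ p = 0)
    (h : IsColimit (CokernelCofork.ofπ p w)) : Function.Surjective p.hom := by
  let e := h.coconePointUniqueUpToIso (TopModuleCat.isColimitCoker f)
  have he : p = TopModuleCat.cokerπ f ≫ e.inv :=
    (h.comp_coconePointUniqueUpToIso_inv (TopModuleCat.isColimitCoker f)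
      WalkingParallelPair.one).symm
  intro x
  obtain ⟨y, hy⟩ := TopModuleCat.cokerπ_surjective f (e.hom.hom x)
  refine ⟨y, ?_⟩
  rw [he]
  change e.inv.hom ((TopModuleCat.cokerπ f).hom y) = x
  rw [hy]
  exact ConcreteCategory.congr_hom e.hom_inv_id x

lemma eq_zero_iff_of_isColimit {M N P : TopModuleCat.{v} R} {f : M ⟶ N} {p : N ⟶ P}
    (w : f ≫ p = 0) (h : IsColimit (CokernelCofork.ofπ p w)) (x : N) :
    p.hom x = 0 ↔ ∃ y, f.hom y = x := by
  let e := h.coconePointUniqueUpToIso (TopModuleCat.isColimitCoker f)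
  have he : p ≫ e.hom = TopModuleCat.cokerπ f :=
    h.comp_coconePointUniqueUpToIso_hom (TopModuleCat.isColimitCoker f) WalkingParallelPair.one
  constructor
  · intro hx
    have h1 : (TopModuleCat.cokerπ f).hom x = 0 := by
      rw [← he]
      change e.hom.hom (p.hom x) = 0
      rw [hx, map_zero]
    rw [TopModuleCat.hom_cokerπ] at h1
    exact (Submodule.Quotient.mk_eq_zero _).1 h1
  · rintro ⟨y, rfl⟩
    exact ConcreteCategory.congr_hom w y

lemma injective_of_isLimit {M N P : TopModuleCat.{v} R} {f : M ⟶ N} {i : P ⟶ M} (w : i ≫ f = 0)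
    (h : IsLimit (KernelFork.ofι i w)) : Function.Injective i.hom := by
  let e := h.conePointUniqueUpToIso (TopModuleCat.isLimitKer f)
  have he : i = e.hom ≫ TopModuleCat.kerι f :=
    (h.conePointUniqueUpToIso_hom_comp (TopModuleCat.isLimitKer f)
      WalkingParallelPair.zero).symm
  rw [he]
  refine Function.Injective.comp (g := (TopModuleCat.kerι f).hom) Subtype.val_injective
    (f := e.hom.hom) ?_
  exact Function.LeftInverse.injective fun x => ConcreteCategory.congr_hom e.hom_inv_id x

lemma exists_eq_of_isLimit {M N P : TopModuleCat.{v} R} {f : M ⟶ N} {i : P ⟶ M} (w : i ≫ f = 0)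
    (h : IsLimit (KernelFork.ofι i w)) (x : M) (hx : f.hom x = 0) : ∃ y, i.hom y = x := by
  let e := h.conePointUniqueUpToIso (TopModuleCat.isLimitKer f)
  have he : e.inv ≫ i = TopModuleCat.kerι f :=
    h.conePointUniqueUpToIso_inv_comp (TopModuleCat.isLimitKer f) WalkingParallelPair.zero
  refine ⟨e.inv.hom ⟨x, hx⟩, ?_⟩
  exact ConcreteCategory.congr_hom he ⟨x, hx⟩

end TopModule

section HCont

variable {G : Type u} [Group G] [TopologicalSpace G] [IsTopologicalGroup G] (M : TopRep.{u} ℤ G)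

lemma cocycleClass_surjective (n : ℕ) : Function.Surjective (cocycleClass M n) :=
  surjective_of_isColimit _
    ((TopRep.homogeneousCochains.{0, u, u} M).homologyIsCokernel _ n rfl)

lemma cocycleVal_injective (n : ℕ) : Function.Injective (cocycleVal M n) :=
  injective_of_isLimit _
    ((TopRep.homogeneousCochains.{0, u, u} M).cyclesIsKernel n (n + 1) (by simp))

lemma coboundary_cocycleVal (n : ℕ) (z : Cocycles M n) :
    coboundary M n (cocycleVal M n z) = 0 :=
  ConcreteCategory.congr_hom ((TopRep.homogeneousCochains.{0, u, u} M).iCycles_d n (n + 1)) z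

lemma exists_cocycleVal_eq (n : ℕ) (c : Cochains M n) (hc : coboundary M n c = 0) :
    ∃ z, cocycleVal M n z = c :=
  exists_eq_of_isLimit _
    ((TopRep.homogeneousCochains.{0, u, u} M).cyclesIsKernel n (n + 1) (by simp)) c hc

lemma cocycleClass_eq_zero_iff_succ (n : ℕ) (z : Cocycles M (n + 1)) :
    cocycleClass M (n + 1) z = 0 ↔ ∃ c, coboundary M n c = cocycleVal M (n + 1) z := by
  refine (eq_zero_iff_of_isColimit _ ((TopRep.homogeneousCochains.{0, u, u} M).homologyIsCokernel
    n (n + 1) (by simp)) z).trans (exists_congr fun c => ?_)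
  rw [← (cocycleVal_injective M (n + 1)).eq_iff]
  have h : cocycleVal M (n + 1)
      (((TopRep.homogeneousCochains.{0, u, u} M).toCycles n (n + 1)).hom c) = coboundary M n c :=
    ConcreteCategory.congr_hom ((TopRep.homogeneousCochains.{0, u, u} M).toCycles_i n (n + 1)) c
  exact Eq.congr_left h

lemma cocycleClass_eq_zero_iff_zero (z : Cocycles M 0) :
    cocycleClass M 0 z = 0 ↔ z = 0 := by
  refine ⟨fun hz => ?_, fun h => by rw [h, map_zero]⟩
  obtain ⟨c, hc⟩ := (eq_zero_iff_of_isColimit _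
    ((TopRep.homogeneousCochains.{0, u, u} M).homologyIsCokernel _ 0 rfl) z).1 hz
  refine cocycleVal_injective M 0 ?_
  rw [map_zero, ← hc]
  have h := ConcreteCategory.congr_hom
    ((TopRep.homogeneousCochains.{0, u, u} M).toCycles_i ((ComplexShape.up ℕ).prev 0) 0) c
  refine h.trans ?_
  -- No index precedes `0` in `ComplexShape.up ℕ`, so the differential out of the default index
  -- `prev 0` vanishes.
  rw [HomologicalComplex.shape _ _ _ (by simp)]
  rfl

/-- The action of `G` on `M` by endomorphisms of the group `M`. -/
def endHom : G →* AddMonoid.End M where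
  toFun g := AddMonoidHom.mk' (fun x => M.ρ g x) fun x y => map_add (M.ρ g) x y
  map_one' := by
    ext x
    change M.ρ 1 x = x
    rw [map_one]
    rfl
  map_mul' g h := by
    ext x
    change M.ρ (g * h) x = M.ρ g (M.ρ h x)
    rw [map_mul]
    rfl

/-- An element of the iterated function space `C(G, C(G, ..., M))` as a function on lists. -/
def uncurryList : (n : ℕ) → TopRep.resolutionX M n → List G → M
  | 0, m, [] => m
  | 0, _, _ :: _ => 0
  | _ + 1, _, [] => 0
  | n + 1, F, x :: l => uncurryList n ((F : C(G, TopRep.resolutionX M n)) x) l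

end HCont

section Uncurry

variable {G G' : Type u} [Group G] [TopologicalSpace G] [IsTopologicalGroup G]
  [Group G'] [TopologicalSpace G'] [IsTopologicalGroup G']
  (M : TopRep.{u} ℤ G)

lemma uncurryList_add (n : ℕ) (F F' : TopRep.resolutionX M n) :
    uncurryList M n (F + F') = uncurryList M n F + uncurryList M n F' := by
  induction n with
  | zero =>
    ext l
    obtain _ | ⟨x, l⟩ := l
    · rfl
    · exact (add_zero _).symm
  | succ n ih =>
    ext l
    obtain _ | ⟨x, l⟩ := l
    · exact (add_zero _).symm
    · exact congrFun (ih (F.1 x) (F'.1 x)) l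

/-- `uncurryList` as a homomorphism. -/
def uncurryHom (n : ℕ) : TopRep.resolutionX M n →+ (List G → M) :=
  AddMonoidHom.mk' (uncurryList M n) (uncurryList_add M n)

lemma uncurryHom_cons (n : ℕ) (F : TopRep.resolutionX M (n + 1)) (x : G) (l : List G) :
    uncurryHom M (n + 1) F (x :: l) = uncurryHom M n ((F : C(G, TopRep.resolutionX M n)) x) l := rfl

lemma uncurryHom_of_length (n : ℕ) (F : TopRep.resolutionX M n) (l : List G) (hl : l.length ≠ n) :
    uncurryHom M n F l = 0 := by
  induction n generalizing l with
  | zero =>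
    obtain _ | ⟨x, l⟩ := l
    · simp at hl
    · rfl
  | succ n ih =>
    obtain _ | ⟨x, l⟩ := l
    · rfl
    · exact ih _ _ (by simpa using hl)

lemma uncurryHom_injective (n : ℕ) : Function.Injective (uncurryHom M n) := by
  induction n with
  | zero => exact fun F F' h => congrFun h []
  | succ n ih =>
    intro F F' h
    refine ContinuousMap.ext fun x => ih ?_
    ext l
    exact congrFun h (x :: l)

/-- Both differentials obey one recursion: the slice of `d F` at `x` is `F` minus the differential
of the slice of `F` at `x`. -/
lemma uncurryHom_d (n : ℕ) (F : TopRep.resolutionX M n) :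
    uncurryHom M (n + 1) ((TopRep.d M n).hom F) = diff (uncurryHom M n F) := by
  induction n with
  | zero =>
    ext l
    obtain _ | ⟨x, _ | ⟨y, l⟩⟩ := l
    · rfl
    · exact (sub_zero _).symm
    · rw [diff_cons, uncurryHom_of_length M 0 F (y :: l) (by simp),
        uncurryHom_of_length M 1 _ _ (by simp), diff_congr_length (u' := 0)
        fun l' hl' => uncurryHom_of_length M 0 F _ (by simp), map_zero]
      simp
  | succ n ih =>
    ext l
    obtain _ | ⟨x, l⟩ := l
    · rfl
    · rw [diff_cons, uncurryHom_cons]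
      change uncurryHom M (n + 1) (F - (TopRep.d M n).hom ((F : C(G, TopRep.resolutionX M n)) x)) l =
        _
      rw [map_sub, ih]
      rfl

lemma uncurryHom_rho (n : ℕ) (F : TopRep.resolutionX M n) (g : G) (l : List G) :
    uncurryHom M n ((TopRep.resolutionX M n).ρ g F) l =
      endHom M g (uncurryHom M n F (l.map (g⁻¹ * ·))) := by
  induction n generalizing l with
  | zero =>
    obtain _ | ⟨x, l⟩ := l
    · rfl
    · exact (map_zero (M.ρ g)).symm
  | succ n ih =>
    obtain _ | ⟨x, l⟩ := l
    · exact (map_zero (M.ρ g)).symm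
    · exact ih _ l

lemma uncurryHom_resolutionMap {N : TopRep.{u} ℤ G'} (φ : G' →ₜ* G) (f : TopRep.res φ M ⟶ N)
    (n : ℕ) (F : TopRep.resolutionX M n) (l : List G') :
    uncurryHom N n ((ContinuousCohomology.resolutionMap φ f n).hom F) l =
      f.hom (uncurryHom M n F (l.map φ)) := by
  induction n generalizing l with
  | zero =>
    obtain _ | ⟨x, l⟩ := l
    · rfl
    · exact (map_zero f.hom).symm
  | succ n ih =>
    obtain _ | ⟨x, l⟩ := l
    · exact (map_zero f.hom).symm
    · exact ih _ l

-- By smoothness the slices are locally constant in the first entry, so the iterated function is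
-- continuous whatever the topology of the function space.
variable {M} in
lemma exists_uncurryHom_eq (n : ℕ) (u : List G → M) (hu : IsSmooth u)
    (hn : ∀ l, l.length ≠ n → u l = 0) : ∃ F, uncurryHom M n F = u := by
  induction n generalizing u with
  | zero =>
    refine ⟨u [], ?_⟩
    ext l
    obtain _ | ⟨x, l⟩ := l
    · rfl
    · exact (hn _ (by simp)).symm
  | succ n ih =>
    obtain ⟨U, hU⟩ := hu
    choose F hF using fun x => ih (fun l => u (x :: l))
      ⟨U, fun l l' hl => hU _ _ (.cons (by simp [one_mem]) hl)⟩
      (fun l hl => hn _ (by simpa using hl))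
    have hFc : IsLocallyConstant F := by
      refine (IsLocallyConstant.iff_exists_open F).2 fun x => ?_
      refine ⟨(x⁻¹ * ·) ⁻¹' (U : Set G), U.isOpen'.preimage (continuous_const_mul x⁻¹),
        by simp [one_mem], fun y hy => uncurryHom_injective M n ?_⟩
      rw [hF, hF]
      ext l
      exact (hU _ _ (.cons hy (ModRel.refl U l))).symm
    refine ⟨(⟨F, hFc.continuous⟩ : C(G, TopRep.resolutionX M n)), ?_⟩
    ext l
    obtain _ | ⟨x, l⟩ := l
    · exact (hn _ (by simp)).symm
    · exact congrFun (hF x) l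

end Uncurry

section Smooth

/-- The equality `f (x * g) = f x` holds for all pairs near `(x, 1)`, and compactness gives one
neighbourhood of `1` that serves all `x`. -/
lemma exists_openNormalSubgroup_of_continuous {G D : Type*} [Group G] [TopologicalSpace G]
    [IsTopologicalGroup G] [CompactSpace G] [TotallyDisconnectedSpace G] [TopologicalSpace D]
    [DiscreteTopology D] {f : G → D} (hf : Continuous f) :
    ∃ U : OpenNormalSubgroup G, ∀ x y, x⁻¹ * y ∈ U → f x = f y := by
  have h : ∀ᶠ g in nhds (1 : G), ∀ x ∈ (Set.univ : Set G), f (x * g) = f x := by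
    refine isCompact_univ.eventually_forall_of_forall_eventually fun x _ => ?_
    have hc : Continuous fun p : G × G => (f (p.2 * p.1), f p.2) := by fun_prop
    have ho : IsOpen {p : G × G | f (p.2 * p.1) = f p.2} :=
      (isOpen_discrete {q : D × D | q.1 = q.2}).preimage hc
    exact ho.mem_nhds (x := (1, x)) (by simp)
  obtain ⟨O, hO, hOo, h1⟩ := eventually_nhds_iff.1 h
  obtain ⟨U, hU⟩ := ProfiniteGrp.exist_openNormalSubgroup_sub_open_nhds_of_one hOo h1
  refine ⟨U, fun x y hxy => ?_⟩
  have := hO _ (hU hxy) x (Set.mem_univ _)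
  rw [mul_inv_cancel_left] at this
  exact this.symm

variable {G : Type u} [Group G] [TopologicalSpace G] [IsTopologicalGroup G] [CompactSpace G]
  (M : TopRep.{u} ℤ G) [DiscreteTopology M]

lemma discreteTopology_resolutionX (n : ℕ) : DiscreteTopology (TopRep.resolutionX M n) := by
  induction n with
  | zero => infer_instance
  | succ n ih => exact discreteTopology_continuousMap G (TopRep.resolutionX M n)

/-- Induction on the number of variables: the function space is discrete, so there are only finitely
many slices in the first variable, each smooth, and `exists_uniform` finds a common subgroup. -/
lemma isSmooth_uncurryHom [TotallyDisconnectedSpace G] (n : ℕ) (F : TopRep.resolutionX M n) :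
    IsSmooth (uncurryHom M n F) := by
  induction n with
  | zero =>
    refine ⟨Classical.arbitrary _, fun l l' hl => ?_⟩
    obtain _ | ⟨_, _⟩ := hl <;> rfl
  | succ n ih =>
    have := discreteTopology_resolutionX M n
    let F' : C(G, TopRep.resolutionX M n) := F
    obtain ⟨U, hU⟩ := exists_openNormalSubgroup_of_continuous F'.continuous
    obtain ⟨W, hW⟩ := exists_uniform U 1
      (fun k (W : OpenNormalSubgroup G) => ∀ x, k = [x] → ∀ l l', ModRel W l l' →
        uncurryHom M n (F' x) l = uncurryHom M n (F' x) l')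
      (fun k W W' h hk x hx l l' hl => hk x hx l l' (hl.mono h))
      (fun k k' W hk _ h x hx l l' hl => by
        subst hx
        obtain ⟨y, rfl⟩ := List.length_eq_one_iff.1 (hk.length_eq.trans rfl)
        obtain _ | ⟨hy, -⟩ := hk
        rw [← hU _ _ hy]
        exact h _ rfl l l' hl)
      (fun k hk => by
        obtain ⟨x, rfl⟩ := List.length_eq_one_iff.1 hk
        obtain ⟨W, hW⟩ := ih (F' x)
        exact ⟨W, fun y hy => by obtain rfl := List.singleton_injective hy; exact hW⟩)
    refine ⟨U ⊓ W, fun l l' hl => ?_⟩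
    obtain _ | ⟨hx, hl⟩ := hl
    · rfl
    · rw [uncurryHom_cons, uncurryHom_cons]
      change uncurryHom M n (F' _) _ = uncurryHom M n (F' _) _
      rw [← hU _ _ hx.1]
      exact hW [_] rfl _ rfl _ _ (ModRel.mono inf_le_right hl)

end Smooth

/-! ### Cohomology classes of cocycles on lists -/

section ListClass

lemma iCycles_cyclesMap_apply {K L : CochainComplex (TopModuleCat.{u} ℤ) ℕ} (f : K ⟶ L) (n : ℕ)
    (z : K.cycles n) : (L.iCycles n).hom ((HomologicalComplex.cyclesMap f n).hom z) =
      (f.f n).hom ((K.iCycles n).hom z) :=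
  ConcreteCategory.congr_hom (HomologicalComplex.cyclesMap_i f n) z

variable {G : Type u} [Group G] [TopologicalSpace G] [IsTopologicalGroup G] (M : TopRep.{u} ℤ G)

/-- Cochains as functions on lists. -/
def toList (n : ℕ) : Cochains M n →+ (List G → M) :=
  AddMonoidHom.mk' (fun c => uncurryHom M (n + 1) c.1)
    fun _ _ => map_add (uncurryHom M (n + 1)) _ _

lemma toList_apply (n : ℕ) (c : Cochains M n) : toList M n c = uncurryHom M (n + 1) c.1 := rfl

lemma toList_injective (n : ℕ) : Function.Injective (toList M n) :=
  fun _ _ h => Subtype.ext (uncurryHom_injective M (n + 1) h)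

lemma toList_coboundary (n : ℕ) (c : Cochains M n) :
    toList M (n + 1) (coboundary M n c) = diff (toList M n c) := by
  rw [toList_apply, toList_apply, ← uncurryHom_d]
  exact congrArg (uncurryHom M (n + 2)) (TopRep.homogeneousCochains.d_apply M n c)

lemma toList_cochainsMap {G' : Type u} [Group G'] [TopologicalSpace G'] [IsTopologicalGroup G']
    {N : TopRep.{u} ℤ G'} (φ : G' →ₜ* G) (f : TopRep.res φ M ⟶ N) (n : ℕ) (c : Cochains M n)
    (l : List G') :
    toList N n (((ContinuousCohomology.cochainsMap φ f).f n).hom c) l =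
      f.hom (toList M n c (l.map φ)) :=
  uncurryHom_resolutionMap M φ f (n + 1) _ l

lemma exists_toList_eq {n : ℕ} {u : List G → M}
    (hu : u ∈ listCochains (MonoidHom.id G) (endHom M) (n + 1)) : ∃ c, toList M n c = u := by
  obtain ⟨h1, h2, h3, h4⟩ := hu
  obtain ⟨F, hF⟩ := exists_uncurryHom_eq (n + 1) u h4 h2
  have hinv : ∀ g, (M.resolutionX (n + 1)).ρ g F = F := by
    intro g
    refine uncurryHom_injective M (n + 1) ?_
    ext l
    rw [uncurryHom_rho, hF, ← h3]
    simp [Function.comp_def]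
  exact ⟨⟨F, hinv⟩, hF⟩

variable [CompactSpace G] [TotallyDisconnectedSpace G] [DiscreteTopology M]

lemma toList_mem (n : ℕ) (c : Cochains M n) :
    toList M n c ∈ listCochains (MonoidHom.id G) (endHom M) (n + 1) := by
  rw [toList_apply]
  refine ⟨rfl, fun l hl => uncurryHom_of_length M _ _ l hl, fun σ l => ?_,
    isSmooth_uncurryHom M _ _⟩
  have h : (M.resolutionX (n + 1)).ρ σ c.1 = c.1 := c.2 σ
  have h' := uncurryHom_rho M (n + 1) c.1 σ (l.map (σ * ·))
  rw [h] at h'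
  refine h'.trans (congrArg (fun l' => endHom M σ (uncurryHom M (n + 1) c.1 l')) ?_)
  simp [Function.comp_def]

/-- The cocycles as functions on lists. -/
def listCocycles (n : ℕ) : AddSubgroup (List G → M) :=
  listCochains (MonoidHom.id G) (endHom M) (n + 1) ⊓ diff.ker

/-- Cocycles are the same as cocycles on lists. -/
def cocyclesEquiv (n : ℕ) : Cocycles M n ≃+ listCocycles M n :=
  AddEquiv.ofBijective (((toList M n).comp (cocycleVal M n)).codRestrict (listCocycles M n)
    fun z => ⟨toList_mem M n _, by
      change diff (toList M n (cocycleVal M n z)) = 0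
      rw [← toList_coboundary, coboundary_cocycleVal, map_zero]⟩) (by
    constructor
    · intro z z' h
      exact cocycleVal_injective M n (toList_injective M n (congrArg Subtype.val h))
    · rintro ⟨u, hu, hd⟩
      obtain ⟨c, rfl⟩ := exists_toList_eq M hu
      obtain ⟨z, rfl⟩ := exists_cocycleVal_eq M n c (toList_injective M (n + 1) (by
        rw [toList_coboundary, map_zero]
        exact hd))
      exact ⟨z, rfl⟩)

lemma cocyclesEquiv_apply (n : ℕ) (z : Cocycles M n) :
    (cocyclesEquiv M n z : List G → M) = toList M n (cocycleVal M n z) := rfl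

/-- The cohomology class of a cocycle on lists. -/
def listClass (n : ℕ) : listCocycles M n →+ HCont M n :=
  (cocycleClass M n).comp (cocyclesEquiv M n).symm.toAddMonoidHom

lemma listClass_cocyclesEquiv (n : ℕ) (z : Cocycles M n) :
    listClass M n (cocyclesEquiv M n z) = cocycleClass M n z :=
  congrArg (cocycleClass M n) ((cocyclesEquiv M n).symm_apply_apply z)

lemma listClass_surjective (n : ℕ) : Function.Surjective (listClass M n) :=
  (cocycleClass_surjective M n).comp (cocyclesEquiv M n).symm.surjective

/-- Degree zero needs no separate form, because `listCochains` of length zero is trivial. -/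
lemma listClass_eq_zero_iff (n : ℕ) (u : listCocycles M n) :
    listClass M n u = 0 ↔ ∃ w ∈ listCochains (MonoidHom.id G) (endHom M) n, diff w = u := by
  obtain ⟨z, rfl⟩ := (cocyclesEquiv M n).surjective u
  rw [listClass_cocyclesEquiv, cocyclesEquiv_apply]
  obtain _ | n := n
  · rw [cocycleClass_eq_zero_iff_zero]
    constructor
    · rintro rfl
      exact ⟨0, zero_mem _, by simp⟩
    · rintro ⟨w, hw, h⟩
      refine cocycleVal_injective M 0 (toList_injective M 0 ?_)
      rw [← h, listCochains_zero hw, map_zero, map_zero, map_zero]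
  · rw [cocycleClass_eq_zero_iff_succ]
    constructor
    · rintro ⟨c, hc⟩
      exact ⟨toList M n c, toList_mem M n c, by rw [← toList_coboundary, hc]⟩
    · rintro ⟨w, hw, h⟩
      obtain ⟨c, rfl⟩ := exists_toList_eq M hw
      exact ⟨c, toList_injective M (n + 1) (by rw [toList_coboundary, h])⟩

lemma mapHCont_listClass {G' : Type u} [Group G'] [TopologicalSpace G'] [IsTopologicalGroup G']
    [CompactSpace G'] [TotallyDisconnectedSpace G'] {N : TopRep.{u} ℤ G'} [DiscreteTopology N]
    (φ : G' →ₜ* G) (f : TopRep.res φ M ⟶ N) (n : ℕ) (u : listCocycles M n) (u' : listCocycles N n)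
    (h : ∀ l, (u' : List G' → N) l = f.hom ((u : List G → M) (l.map φ))) :
    mapHCont φ f n (listClass M n u) = listClass N n u' := by
  obtain ⟨z, rfl⟩ := (cocyclesEquiv M n).surjective u
  have h1 : mapHCont φ f n (cocycleClass M n z) =
      cocycleClass N n ((ContinuousCohomology.cocyclesMap φ f n).hom z) :=
    ConcreteCategory.congr_hom (ContinuousCohomology.π_map φ f n) z
  rw [listClass_cocyclesEquiv, h1, ← listClass_cocyclesEquiv]
  congr 1
  ext l
  rw [h, cocyclesEquiv_apply, cocyclesEquiv_apply]
  have h2 : cocycleVal N n ((ContinuousCohomology.cocyclesMap φ f n).hom z) =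
      ((ContinuousCohomology.cochainsMap φ f).f n).hom (cocycleVal M n z) :=
    iCycles_cyclesMap_apply (ContinuousCohomology.cochainsMap.{0, u, u} φ f) n z
  rw [h2, toList_cochainsMap]

end ListClass

/-! ### Functoriality, inner automorphisms and coinduced modules -/

section HomOf

variable {G G' : Type u} [Group G] [TopologicalSpace G] [IsTopologicalGroup G]
  [Group G'] [TopologicalSpace G'] [IsTopologicalGroup G']
  {M : TopRep.{u} ℤ G} {N : TopRep.{u} ℤ G'}

/-- The homomorphism of groups underlying an equivariant map. -/
def homOf {φ : G' →ₜ* G} (f : TopRep.res φ M ⟶ N) : M →+ N :=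
  AddMonoidHom.mk' (fun m => f.hom m) fun x y => map_add f.hom x y

lemma homOf_endHom {φ : G' →ₜ* G} (f : TopRep.res φ M ⟶ N) (σ : G') (m : M) :
    homOf f (endHom M (φ σ) m) = endHom N σ (homOf f m) :=
  TopRep.hom_comm_apply f σ m

lemma comp_homOf_mem {φ : G' →ₜ* G} (f : TopRep.res φ M ⟶ N) {n : ℕ} {u : List G → M}
    (hu : u ∈ listCochains (MonoidHom.id G) (endHom M) n) :
    (fun l => homOf f (u l)) ∈ listCochains (φ : G' →* G) (endHom N) n := by
  obtain ⟨h1, h2, h3, h4⟩ := hu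
  refine ⟨by simp [h1], fun l hl => by simp [h2 l hl], fun σ l => ?_, h4.comp _⟩
  rw [← homOf_endHom, ← h3]
  rfl

lemma comp_map_mem {φ : G' →ₜ* G} {ρ : G' →* AddMonoid.End N} {n : ℕ} {u : List G → N}
    (hu : u ∈ listCochains (φ : G' →* G) ρ n) :
    (fun l => u (l.map φ)) ∈ listCochains (MonoidHom.id G') ρ n := by
  obtain ⟨h1, h2, h3, h4⟩ := hu
  refine ⟨h1, fun l hl => h2 _ (by simpa using hl), fun σ l => ?_, h4.map φ.continuous_toFun⟩
  rw [← h3]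
  simp [Function.comp_def]

lemma diff_homOf {φ : G' →ₜ* G} (f : TopRep.res φ M ⟶ N) (u : List G → M) :
    diff (fun l => homOf f (u l)) = fun l => homOf f (diff u l) :=
  funext fun l => (map_diff (homOf f) u l).symm

lemma diff_comp_map (φ : G' →ₜ* G) (u : List G → N) :
    diff (fun l => u (l.map φ)) = fun l => diff u (l.map φ) :=
  funext fun l => diff_map φ u l

variable [CompactSpace G] [TotallyDisconnectedSpace G] [DiscreteTopology M]
  [CompactSpace G'] [TotallyDisconnectedSpace G'] [DiscreteTopology N]

/-- The map on cocycles on lists induced by an equivariant map. -/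
def mapCocycles {φ : G' →ₜ* G} (f : TopRep.res φ M ⟶ N) (n : ℕ) :
    listCocycles M n →+ listCocycles N n :=
  AddMonoidHom.mk' (fun u => ⟨fun l => homOf f (u.1 (l.map φ)),
    comp_map_mem (comp_homOf_mem f u.2.1), by
      change diff _ = 0
      rw [diff_comp_map φ fun l => homOf f (u.1 l), diff_homOf,
        show diff u.1 = 0 from u.2.2]
      ext l
      exact map_zero _⟩)
    fun u u' => Subtype.ext (funext fun l => map_add (homOf f) _ _)

lemma mapCocycles_apply {φ : G' →ₜ* G} (f : TopRep.res φ M ⟶ N) (n : ℕ) (u : listCocycles M n)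
    (l : List G') : (mapCocycles f n u).1 l = homOf f (u.1 (l.map φ)) := rfl

lemma mapHCont_listClass' (φ : G' →ₜ* G) (f : TopRep.res φ M ⟶ N) (n : ℕ) (u : listCocycles M n) :
    mapHCont φ f n (listClass M n u) = listClass N n (mapCocycles f n u) :=
  mapHCont_listClass M φ f n u _ fun _ => rfl

lemma listClass_eq_iff (n : ℕ) (u u' : listCocycles M n) :
    listClass M n u = listClass M n u' ↔
      ∃ w ∈ listCochains (MonoidHom.id G) (endHom M) n, diff w = u.1 - u'.1 := by
  rw [← sub_eq_zero, ← map_sub, listClass_eq_zero_iff]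
  rfl

/-- Homomorphisms that differ by an inner automorphism induce the same map on cohomology. -/
lemma mapHCont_eq_of_conj {φ φ' : G' →ₜ* G} (f : TopRep.res φ M ⟶ N) (f' : TopRep.res φ' M ⟶ N)
    (γ : G) (hφ : ∀ σ, φ' σ * γ = γ * φ σ) (hf : ∀ m, homOf f m = homOf f' (endHom M γ m)) (n : ℕ) :
    mapHCont φ f n = mapHCont φ' f' n := by
  ext α
  obtain ⟨u, rfl⟩ := listClass_surjective M n α
  rw [mapHCont_listClass', mapHCont_listClass', eq_comm, listClass_eq_iff]
  -- The relation `φ' σ * γ = γ * φ σ` and the equivariance of `u` turn conjugation into right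
  -- translation by `γ`, which changes a cocycle by a coboundary only.
  obtain ⟨w, hw, h⟩ := exists_sub_eq_diff (φ := (φ' : G' →* G)) φ'.continuous_toFun
    (comp_homOf_mem f' u.2.1) (by
      rw [diff_homOf, show diff u.1 = 0 from u.2.2]
      ext l
      exact map_zero _) γ
  refine ⟨w, hw, ?_⟩
  ext l
  rw [← h, Pi.sub_apply, mapCocycles_apply, mapCocycles_apply, hf, ← u.2.1.2.2.1]
  simp [Function.comp_def, hφ]

/-- The restriction map in cohomology from a coinduced module is bijective if the kernel of `φ`
has no higher cohomology. -/
theorem mapHCont_bijective [T2Space G] (φ : G' →ₜ* G) (f : TopRep.res φ M ⟶ N)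
    (hN : HasOpenStabilizers (endHom N)) (hac : IsKerAcyclic (φ : G' →* G) (endHom N))
    (hinj : ∀ m, (∀ g, homOf f (endHom M g m) = 0) → m = 0)
    (hsurj : ∀ u : G → N, (∃ U : OpenNormalSubgroup G, ∀ x y, x⁻¹ * y ∈ U → u x = u y) →
      (∀ σ g, u (φ σ * g) = endHom N σ (u g)) → ∃ m, ∀ g, homOf f (endHom M g m) = u g)
    (n : ℕ) : Function.Bijective (mapHCont φ f n) := by
  have hinj' : ∀ m m', (∀ g, homOf f (endHom M g m) = homOf f (endHom M g m')) → m = m' := by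
    intro m m' h
    refine sub_eq_zero.1 (hinj _ fun g => ?_)
    rw [map_sub (endHom M g : M →+ M), map_sub, h, sub_self]
  -- The hypotheses identify `M` with the smooth equivariant functions `G → N`, by `m ↦ (g ↦ f (g
  -- m))`. Hence composition with `f` identifies cochains with values in `M` with cochains on `G`
  -- that have values in `N` and are equivariant along `φ`: `hlift` is surjectivity, `hext`
  -- injectivity.
  have hlift : ∀ n, ∀ y ∈ listCochains (φ : G' →* G) (endHom N) n,
      ∃ y' ∈ listCochains (MonoidHom.id G) (endHom M) n, ∀ l, homOf f (y' l) = y l := by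
    rintro n y ⟨h1, h2, h3, U, h4⟩
    have : ∀ l : List G, ∃ m, ∀ g, homOf f (endHom M g m) = y (l.map (g * ·)) := by
      intro l
      refine hsurj (fun g => y (l.map (g * ·))) ⟨U, fun x x' hx => h4 _ _ ?_⟩ fun σ g => ?_
      · induction l with
        | nil => exact .nil
        | cons z l ih =>
          refine .cons ?_ ih
          simpa [mul_assoc] using OpenNormalSubgroup.conj_inv_mem hx z
      · rw [← h3]
        simp [Function.comp_def, mul_assoc]
    choose y' hy' using this
    refine ⟨y', ⟨?_, fun l hl => ?_, fun σ l => ?_, U, fun l l' hl => ?_⟩, fun l => ?_⟩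
    · exact hinj _ fun g => (hy' [] g).trans h1
    · exact hinj _ fun g => (hy' l g).trans (h2 _ (by simpa using hl))
    · refine hinj' _ _ fun g => ?_
      rw [hy', show endHom M g (endHom M σ (y' l)) = endHom M (g * σ) (y' l) by
        rw [map_mul]; rfl, hy']
      simp [Function.comp_def, mul_assoc]
    · refine hinj' _ _ fun g => ?_
      rw [hy', hy']
      exact h4 _ _ (hl.mul_left g)
    · have h := hy' l 1
      rw [map_one] at h
      simpa using h
  have hext : ∀ n, ∀ u ∈ listCochains (MonoidHom.id G) (endHom M) n,
      ∀ u' ∈ listCochains (MonoidHom.id G) (endHom M) n,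
      (∀ l, homOf f (u l) = homOf f (u' l)) → u = u' := by
    intro n u hu u' hu' h
    ext l
    refine hinj' _ _ fun g => ?_
    rw [← hu.2.2.1, ← hu'.2.2.1, h]
  constructor
  · rw [injective_iff_map_eq_zero]
    intro α hα
    obtain ⟨u, rfl⟩ := listClass_surjective M n α
    rw [mapHCont_listClass', listClass_eq_zero_iff] at hα
    obtain ⟨w, hw, hwu⟩ := hα
    obtain ⟨y, hy, hyu⟩ := exists_diff_eq_of_map_eq (φ := (φ : G' →* G)) φ.continuous_toFun hN hac
      (comp_homOf_mem f u.2.1) (by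
        rw [diff_homOf, show diff u.1 = 0 from u.2.2]
        ext l
        exact map_zero _) hw fun m => (congrFun hwu m).symm
    obtain ⟨y', hy', hyy⟩ := hlift n y hy
    rw [listClass_eq_zero_iff]
    refine ⟨y', hy', hext _ _ (diff_mem_listCochains hy') _ u.2.1 fun l => ?_⟩
    rw [← congrFun hyu l, map_diff]
    simp_rw [hyy]
  · intro α
    obtain ⟨w, rfl⟩ := listClass_surjective N n α
    obtain ⟨v, hv, hdv, y, hy, hvy⟩ := exists_map_eq_add_diff (φ := (φ : G' →* G))
      φ.continuous_toFun hN hac w.2.1 w.2.2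
    obtain ⟨v', hv', hvv⟩ := hlift _ v hv
    refine ⟨listClass M n ⟨v', hv', ?_⟩, ?_⟩
    · refine hext _ _ (diff_mem_listCochains hv') _ (zero_mem _) fun l => ?_
      rw [map_diff]
      simp_rw [hvv]
      simp [hdv]
    · rw [mapHCont_listClass', listClass_eq_iff]
      refine ⟨y, hy, ?_⟩
      ext l
      rw [Pi.sub_apply, mapCocycles_apply, hvv]
      exact eq_sub_of_add_eq' (hvy l).symm

end HomOf

/-! ### The long exact sequence of a patching sequence -/

section LongExact

variable {G : Type u} [Group G] [TopologicalSpace G] [IsTopologicalGroup G]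
  {M : TopRep.{u} ℤ G} {V : Type v} {E : Type w} {N : V → TopRep.{u} ℤ G} {P : E → TopRep.{u} ℤ G}
  {l r : E → V}

/-- The sequence of `G`-modules `0 → M → ∏ N_v → ∏ P_e → 0`, in which the last map is the
difference of two maps, is exact, and the stabilizers of the elements of `N_v` are open. -/
structure IsPatchingSequence (j : ∀ v, TopRep.res (ContinuousMonoidHom.id G) M ⟶ N v)
    (dl : ∀ e, TopRep.res (ContinuousMonoidHom.id G) (N (l e)) ⟶ P e)
    (dr : ∀ e, TopRep.res (ContinuousMonoidHom.id G) (N (r e)) ⟶ P e) : Prop where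
  inj : ∀ m, (∀ v, homOf (j v) m = 0) → m = 0
  comp : ∀ m e, homOf (dl e) (homOf (j (l e)) m) = homOf (dr e) (homOf (j (r e)) m)
  exact : ∀ b : ∀ v, N v, (∀ e, homOf (dl e) (b (l e)) = homOf (dr e) (b (r e))) →
    ∃ m, ∀ v, homOf (j v) m = b v
  surj : ∀ c : ∀ e, P e, ∃ b : ∀ v, N v, ∀ e,
    homOf (dl e) (b (l e)) - homOf (dr e) (b (r e)) = c e
  stab : ∀ v, HasOpenStabilizers (endHom (N v))

lemma homOf_id_endHom {N' : TopRep.{u} ℤ G}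
    (f : TopRep.res (ContinuousMonoidHom.id G) M ⟶ N') (σ : G) (m : M) :
    homOf f (endHom M σ m) = endHom N' σ (homOf f m) :=
  homOf_endHom f σ m

lemma comp_homOf_id_mem {N' : TopRep.{u} ℤ G}
    (f : TopRep.res (ContinuousMonoidHom.id G) M ⟶ N') {n : ℕ} {u : List G → M}
    (hu : u ∈ listCochains (MonoidHom.id G) (endHom M) n) :
    (fun x => homOf f (u x)) ∈ listCochains (MonoidHom.id G) (endHom N') n :=
  comp_homOf_mem f hu

variable {j : ∀ v, TopRep.res (ContinuousMonoidHom.id G) M ⟶ N v}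
  {dl : ∀ e, TopRep.res (ContinuousMonoidHom.id G) (N (l e)) ⟶ P e}
  {dr : ∀ e, TopRep.res (ContinuousMonoidHom.id G) (N (r e)) ⟶ P e}

namespace IsPatchingSequence

lemma inj' (h : IsPatchingSequence j dl dr) {m m' : M} (hm : ∀ v, homOf (j v) m = homOf (j v) m') :
    m = m' :=
  sub_eq_zero.1 (h.inj _ fun v => by rw [map_sub, hm, sub_self])

/-- No section of the surjection is needed: the preimages of the values of `z` are nonempty sets
permuted by `G`, and `exists_equivariant_choice` applies, since finitely many vertices leave a
common open stabilizer. -/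
lemma exists_lift [Finite V] [Finite E] [CompactSpace G] (h : IsPatchingSequence j dl dr) (n : ℕ)
    (z : ∀ e, List G → P e) (hz : ∀ e, z e ∈ listCochains (MonoidHom.id G) (endHom (P e)) n) :
    ∃ b : ∀ v, List G → N v, (∀ v, b v ∈ listCochains (MonoidHom.id G) (endHom (N v)) n) ∧
      ∀ e x, homOf (dl e) (b (l e) x) - homOf (dr e) (b (r e) x) = z e x := by
  obtain _ | n := n
  · exact ⟨0, fun v => zero_mem _, fun e x => by simp [listCochains_zero (hz e)]⟩
  choose U hU using fun e => (hz e).2.2.2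
  obtain ⟨U', hU'⟩ := Finite.exists_ge U
  obtain ⟨β, W, h1, h2, h3⟩ := exists_equivariant_choice (MonoidHom.id G)
    (fun σ (b : ∀ v, N v) v => endHom (N v) σ (b v))
    (fun b => by ext v; rw [map_one]; rfl) (fun σ τ b => by ext v; rw [map_mul]; rfl) n
    (fun x => {b | ∀ e, homOf (dl e) (b (l e)) - homOf (dr e) (b (r e)) = z e x})
    (fun σ x b _ hb e => by
      refine Eq.trans ?_ ((congrArg (endHom (P e) σ) (hb e)).trans ((hz e).2.2.1 σ x).symm)
      rw [homOf_id_endHom, homOf_id_endHom]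
      exact (map_sub (endHom (P e) σ : P e →+ P e) _ _).symm)
    U' (fun x x' hx _ b hb e => by rw [hb e, hU e x x' (hx.mono (hU' e))])
    (fun x _ => by
      obtain ⟨b, hb⟩ := h.surj fun e => z e x
      choose S hS using fun v => h.stab v (b v)
      obtain ⟨S', hS'⟩ := Finite.exists_ge S
      exact ⟨b, hb, S', fun σ hσ => funext fun v => hS v σ (hS' v hσ)⟩)
  refine ⟨fun v x => if x.length = n + 1 then β x v else 0, fun v => ⟨by simp,
    fun x hx => if_neg hx, fun σ x => ?_, W, fun x x' hx => ?_⟩, fun e x => ?_⟩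
  · by_cases hx : x.length = n + 1
    · simp only [List.length_map, hx, if_true]
      exact congrFun (h2 σ x hx) v
    · simp [hx]
  · by_cases hl : x.length = n + 1
    · simp only [← hx.length_eq, hl, if_true]
      rw [h3 x x' hx hl]
    · simp [← hx.length_eq, hl]
  · by_cases hx : x.length = n + 1
    · simpa only [hx, if_true] using h1 x hx e
    · simp [hx, (hz e).2.1 x hx]

/-- As `M` embeds in the product of the `N v`, support, equivariance and smoothness of `a` can be
checked on the `b v`. -/
lemma exists_descent [Finite V] (h : IsPatchingSequence j dl dr) (n : ℕ) (b : ∀ v, List G → N v)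
    (hb : ∀ v, b v ∈ listCochains (MonoidHom.id G) (endHom (N v)) n)
    (he : ∀ e x, homOf (dl e) (b (l e) x) = homOf (dr e) (b (r e) x)) :
    ∃ a ∈ listCochains (MonoidHom.id G) (endHom M) n, ∀ v x, homOf (j v) (a x) = b v x := by
  choose a ha using fun x => h.exact (fun v => b v x) fun e => he e x
  choose U hU using fun v => (hb v).2.2.2
  obtain ⟨U', hU'⟩ := Finite.exists_ge U
  refine ⟨a, ⟨h.inj _ fun v => (ha _ v).trans (hb v).1,
    fun x hx => h.inj _ fun v => (ha _ v).trans ((hb v).2.1 x hx),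
    fun σ x => h.inj' fun v => ?_, U', fun x x' hx => h.inj' fun v => ?_⟩, fun v x => ha x v⟩
  · rw [homOf_id_endHom, ha, ha]
    exact (hb v).2.2.1 σ x
  · rw [ha, ha, hU v x x' (hx.mono (hU' v))]

end IsPatchingSequence

section

variable [CompactSpace G] [TotallyDisconnectedSpace G] [DiscreteTopology M]
  [∀ v, DiscreteTopology (N v)] [∀ e, DiscreteTopology (P e)]

variable (j dl dr) in
/-- The relation between a family of cocycles with values in `P_e` and a cocycle with values in `M`
given by the snake construction. -/
def Snake (n : ℕ) (z : ∀ e, List G → P e) (a : List G → M) : Prop :=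
  ∃ b : ∀ v, List G → N v, (∀ v, b v ∈ listCochains (MonoidHom.id G) (endHom (N v)) (n + 1)) ∧
    (∀ v x, homOf (j v) (a x) = diff (b v) x) ∧
    ∀ e x, homOf (dl e) (b (l e) x) - homOf (dr e) (b (r e) x) = z e x

lemma Snake.sub {n : ℕ} {z z' : ∀ e, List G → P e} {a a' : List G → M} (h : Snake j dl dr n z a)
    (h' : Snake j dl dr n z' a') : Snake j dl dr n (z - z') (a - a') := by
  obtain ⟨b, h1, h2, h3⟩ := h
  obtain ⟨b', h1', h2', h3'⟩ := h'
  refine ⟨b - b', fun v => sub_mem (h1 v) (h1' v), fun v x => ?_, fun e x => ?_⟩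
  · simp only [Pi.sub_apply, map_sub, h2, h2']
  · simp only [Pi.sub_apply, map_sub, ← h3, ← h3']
    abel

lemma Snake.add {n : ℕ} {z z' : ∀ e, List G → P e} {a a' : List G → M} (h : Snake j dl dr n z a)
    (h' : Snake j dl dr n z' a') : Snake j dl dr n (z + z') (a + a') := by
  obtain ⟨b, h1, h2, h3⟩ := h
  obtain ⟨b', h1', h2', h3'⟩ := h'
  refine ⟨b + b', fun v => add_mem (h1 v) (h1' v), fun v x => ?_, fun e x => ?_⟩
  · simp only [Pi.add_apply, map_add, h2, h2']
  · simp only [Pi.add_apply, map_add, ← h3, ← h3']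
    abel

lemma diff_homOf_id {N' : TopRep.{u} ℤ G}
    (f : TopRep.res (ContinuousMonoidHom.id G) M ⟶ N') (u : List G → M) (x : List G) :
    diff (fun x => homOf f (u x)) x = homOf f (diff u x) :=
  congrFun (diff_homOf f u) x

variable [Finite V] [Finite E]

lemma IsPatchingSequence.exists_snake (h : IsPatchingSequence j dl dr) {n : ℕ}
    (z : ∀ e, listCocycles (P e) n) :
    ∃ a : listCocycles M (n + 1), Snake j dl dr n (fun e => (z e).1) a.1 := by
  obtain ⟨b, hb, hbz⟩ := h.exists_lift (n + 1) (fun e => (z e).1) fun e => (z e).2.1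
  obtain ⟨a, ha, hab⟩ := h.exists_descent (n + 2) (fun v => diff (b v))
    (fun v => diff_mem_listCochains (hb v)) fun e x => by
      rw [← diff_homOf_id, ← diff_homOf_id, ← sub_eq_zero, ← Pi.sub_apply, ← map_sub,
        show ((fun x => homOf (dl e) (b (l e) x)) - fun x => homOf (dr e) (b (r e) x)) = (z e).1
          from funext (hbz e), show diff (z e).1 = 0 from (z e).2.2]
      rfl
  refine ⟨⟨a, ha, funext fun x => h.inj _ fun v => ?_⟩, b, hb, hab, hbz⟩
  rw [← diff_homOf_id, funext (hab v), diff_diff]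
  rfl

/-- This makes the connecting map well defined. If `z = d w` and `c` lifts `w`, the cochains `b - d
c` agree on the edges and descend to a primitive of `a`. -/
lemma IsPatchingSequence.snake_listClass_eq_zero (h : IsPatchingSequence j dl dr) {n : ℕ}
    {z : ∀ e, listCocycles (P e) n} {a : listCocycles M (n + 1)}
    (hs : Snake j dl dr n (fun e => (z e).1) a.1) (hz : ∀ e, listClass (P e) n (z e) = 0) :
    listClass M (n + 1) a = 0 := by
  obtain ⟨b, hb, hab, hbz⟩ := hs
  choose w hw hwz using fun e => (listClass_eq_zero_iff (P e) n (z e)).1 (hz e)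
  obtain ⟨c, hc, hcw⟩ := h.exists_lift n w hw
  obtain ⟨a', ha', hab'⟩ := h.exists_descent (n + 1) (fun v => b v - diff (c v))
    (fun v => sub_mem (hb v) (diff_mem_listCochains (hc v))) fun e x => by
      have h1 := congrFun (congrArg diff (funext (hcw e))) x
      rw [hwz e, ← show _ = (z e).1 x from hbz e x] at h1
      have h2 : diff (fun x => homOf (dl e) (c (l e) x) - homOf (dr e) (c (r e) x)) x =
          homOf (dl e) (diff (c (l e)) x) - homOf (dr e) (diff (c (r e)) x) := by
        rw [← diff_homOf_id, ← diff_homOf_id, ← Pi.sub_apply, ← map_sub]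
        rfl
      rw [h2] at h1
      simp only [Pi.sub_apply, map_sub]
      rw [sub_eq_sub_iff_sub_eq_sub, h1]
  rw [listClass_eq_zero_iff]
  refine ⟨a', ha', funext fun x => h.inj' fun v => ?_⟩
  rw [← diff_homOf_id, funext (hab' v), hab v]
  rw [map_sub, diff_diff, sub_zero]

lemma mapCocycles_id_apply {N' : TopRep.{u} ℤ G} [DiscreteTopology N']
    (f : TopRep.res (ContinuousMonoidHom.id G) M ⟶ N') {n : ℕ} (u : listCocycles M n)
    (x : List G) : (mapCocycles f n u).1 x = homOf f (u.1 x) := by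
  exact congrArg (fun y => homOf f (u.1 y)) (List.map_id x)

variable (j) in
/-- The map from the cohomology of `M` to the product of the cohomology groups of `N_v`. -/
def vertexMap (n : ℕ) : HCont M n →+ ∀ v, HCont (N v) n :=
  AddMonoidHom.pi fun v => mapHCont (ContinuousMonoidHom.id G) (j v) n

variable (dl dr) in
/-- The map from the product of the cohomology groups of `N_v` to the product of the cohomology
groups of `P_e` that is given by differences. -/
def edgeMap (n : ℕ) : (∀ v, HCont (N v) n) →+ ∀ e, HCont (P e) n :=
  AddMonoidHom.pi fun e =>
    (mapHCont (ContinuousMonoidHom.id G) (dl e) n).comp (Pi.evalAddMonoidHom _ (l e)) -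
      (mapHCont (ContinuousMonoidHom.id G) (dr e) n).comp (Pi.evalAddMonoidHom _ (r e))

lemma vertexMap_listClass {n : ℕ} (u : listCocycles M n) (v : V) :
    vertexMap j n (listClass M n u) v = listClass (N v) n (mapCocycles (j v) n u) :=
  mapHCont_listClass' _ (j v) n u

lemma edgeMap_listClass {n : ℕ} (u : ∀ v, listCocycles (N v) n) (e : E) :
    edgeMap dl dr n (fun v => listClass (N v) n (u v)) e =
      listClass (P e) n (mapCocycles (dl e) n (u (l e)) - mapCocycles (dr e) n (u (r e))) := by
  rw [map_sub, ← mapHCont_listClass', ← mapHCont_listClass']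
  rfl

lemma exists_listClass_eq {n : ℕ} {V : Type*} {N : V → TopRep.{u} ℤ G}
    [∀ v, DiscreteTopology (N v)] (α : ∀ v, HCont (N v) n) :
    ∃ u : ∀ v, listCocycles (N v) n, (fun v => listClass (N v) n (u v)) = α := by
  choose u hu using fun v => listClass_surjective (N v) n (α v)
  exact ⟨u, funext hu⟩

namespace IsPatchingSequence

lemma vertexMap_zero_injective (h : IsPatchingSequence j dl dr) :
    Function.Injective (vertexMap j 0) := by
  rw [injective_iff_map_eq_zero]
  intro α hα
  obtain ⟨u, rfl⟩ := listClass_surjective M 0 α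
  rw [listClass_eq_zero_iff]
  refine ⟨0, zero_mem _, funext fun x => h.inj' fun v => ?_⟩
  have h1 := congrFun hα v
  rw [vertexMap_listClass, Pi.zero_apply, listClass_eq_zero_iff] at h1
  obtain ⟨w, hw, h1⟩ := h1
  have h2 := congrFun h1 x
  rw [mapCocycles_id_apply, listCochains_zero hw, map_zero] at h2
  rw [← h2, map_zero, Pi.zero_apply, Pi.zero_apply, map_zero]

lemma exact_vertexMap_edgeMap (h : IsPatchingSequence j dl dr) (n : ℕ) :
    Function.Exact (vertexMap j n) (edgeMap dl dr n) := by
  intro α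
  constructor
  · intro hα
    obtain ⟨u, rfl⟩ := exists_listClass_eq α
    have h1 : ∀ e, ∃ w ∈ listCochains (MonoidHom.id G) (endHom (P e)) n, diff w =
        (mapCocycles (dl e) n (u (l e)) - mapCocycles (dr e) n (u (r e))).1 := fun e => by
      rw [← listClass_eq_zero_iff, ← edgeMap_listClass, hα]
      rfl
    choose w hw hwz using h1
    -- Correcting `u` by the coboundary of `c` makes the differences vanish as cochains and not only
    -- as classes.
    obtain ⟨c, hc, hcw⟩ := h.exists_lift n w hw
    obtain ⟨a, ha, hab⟩ := h.exists_descent (n + 1) (fun v => (u v).1 - diff (c v))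
      (fun v => sub_mem (u v).2.1 (diff_mem_listCochains (hc v))) fun e x => by
        have h1 := congrFun (congrArg diff (funext (hcw e))) x
        have h2 : diff (fun x => homOf (dl e) (c (l e) x) - homOf (dr e) (c (r e) x)) x =
            homOf (dl e) (diff (c (l e)) x) - homOf (dr e) (diff (c (r e)) x) := by
          rw [← diff_homOf_id, ← diff_homOf_id, ← Pi.sub_apply, ← map_sub]
          rfl
        rw [hwz e, h2, AddSubgroup.coe_sub, Pi.sub_apply, mapCocycles_id_apply,
          mapCocycles_id_apply] at h1
        simp only [Pi.sub_apply, map_sub]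
        rw [sub_eq_sub_iff_sub_eq_sub, h1]
    refine ⟨listClass M n ⟨a, ha, funext fun x => h.inj _ fun v => ?_⟩, funext fun v => ?_⟩
    · rw [← diff_homOf_id, funext (hab v)]
      rw [map_sub, diff_diff, sub_zero, show diff (u v).1 = 0 from (u v).2.2]
      rfl
    · rw [vertexMap_listClass, eq_comm, listClass_eq_iff]
      refine ⟨c v, hc v, funext fun x => ?_⟩
      rw [Pi.sub_apply, mapCocycles_id_apply]
      simp [hab]
  · rintro ⟨α, rfl⟩
    obtain ⟨u, rfl⟩ := listClass_surjective M n α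
    ext e
    rw [funext (vertexMap_listClass u), edgeMap_listClass]
    refine (congrArg (listClass (P e) n) ?_).trans (map_zero (listClass (P e) n))
    refine Subtype.ext (funext fun x => ?_)
    rw [AddSubgroup.coe_sub, Pi.sub_apply, mapCocycles_id_apply, mapCocycles_id_apply,
      mapCocycles_id_apply, mapCocycles_id_apply, h.comp, sub_self]
    rfl

/-- The long exact cohomology sequence of a short exact sequence of discrete modules. -/
theorem exists_connecting (h : IsPatchingSequence j dl dr) (n : ℕ) :
    ∃ δ : (∀ e, HCont (P e) n) →+ HCont M (n + 1),
      (∀ (z : ∀ e, listCocycles (P e) n) (a : listCocycles M (n + 1)),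
        Snake j dl dr n (fun e => (z e).1) a.1 →
          δ (fun e => listClass (P e) n (z e)) = listClass M (n + 1) a) ∧
      Function.Exact (edgeMap dl dr n) δ ∧ Function.Exact δ (vertexMap j (n + 1)) := by
  choose z hz using fun β : ∀ e, HCont (P e) n => exists_listClass_eq β
  choose a ha using fun z : ∀ e, listCocycles (P e) n => h.exists_snake z
  -- Independence of all choices: the difference of two snakes is a snake for a family with trivial
  -- classes.
  have key : ∀ (z' : ∀ e, listCocycles (P e) n) (a' : listCocycles M (n + 1)),
      Snake j dl dr n (fun e => (z' e).1) a'.1 →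
        listClass M (n + 1) (a (z fun e => listClass (P e) n (z' e))) =
          listClass M (n + 1) a' := by
    intro z' a' h'
    rw [← sub_eq_zero, ← map_sub]
    refine h.snake_listClass_eq_zero (z := z (fun e => listClass (P e) n (z' e)) - z')
      ((ha _).sub h') fun e => ?_
    rw [Pi.sub_apply, map_sub, sub_eq_zero]
    exact congrFun (hz _) e
  let δ : (∀ e, HCont (P e) n) →+ HCont M (n + 1) :=
    AddMonoidHom.mk' (fun β => listClass M (n + 1) (a (z β))) fun β β' => by
      rw [← map_add]
      refine Eq.trans ?_ (key (z β + z β') _ ((ha _).add (ha _)))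
      congr 3
      rw [← congrArg₂ (· + ·) (hz β) (hz β')]
      ext e
      exact (map_add _ _ _).symm
  have hδ : ∀ (z' : ∀ e, listCocycles (P e) n) (a' : listCocycles M (n + 1)),
      Snake j dl dr n (fun e => (z' e).1) a'.1 →
        δ (fun e => listClass (P e) n (z' e)) = listClass M (n + 1) a' := key
  refine ⟨δ, hδ, fun β => ⟨fun hβ => ?_, ?_⟩, fun α => ⟨fun hα => ?_, ?_⟩⟩
  · obtain ⟨z, rfl⟩ := exists_listClass_eq β
    obtain ⟨a, b, hb, hab, hbz⟩ := h.exists_snake z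
    rw [hδ z a ⟨b, hb, hab, hbz⟩, listClass_eq_zero_iff] at hβ
    obtain ⟨c, hc, hca⟩ := hβ
    -- When `a = d c`, subtracting the image of `c` turns the lifts `b` into cocycles without
    -- changing their differences.
    let β : ∀ v, listCocycles (N v) n := fun v =>
      ⟨b v - fun x => homOf (j v) (c x), show _ ∈ listCochains _ _ _ from
        sub_mem (hb v) (comp_homOf_id_mem (j v) hc), by
        change diff _ = 0
        ext x
        rw [map_sub, Pi.sub_apply, diff_homOf_id, ← hab, hca, sub_self]
        rfl⟩
    refine ⟨fun v => listClass (N v) n (β v), funext fun e => ?_⟩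
    rw [edgeMap_listClass]
    congr 1
    ext x
    rw [AddSubgroup.coe_sub, Pi.sub_apply, mapCocycles_id_apply, mapCocycles_id_apply]
    change homOf (dl e) (b (l e) x - homOf (j (l e)) (c x)) -
      homOf (dr e) (b (r e) x - homOf (j (r e)) (c x)) = (z e).1 x
    rw [map_sub, map_sub, h.comp, sub_sub_sub_cancel_right]
    exact hbz e x
  · rintro ⟨α, rfl⟩
    obtain ⟨u, rfl⟩ := exists_listClass_eq α
    rw [funext (edgeMap_listClass u), hδ _ 0, map_zero]
    refine ⟨fun v => (u v).1, fun v => (u v).2.1, fun v x => ?_, fun e x => ?_⟩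
    · rw [show diff (u v).1 = 0 from (u v).2.2]
      exact map_zero _
    · change _ = (mapCocycles (dl e) n (u (l e))).1 x - (mapCocycles (dr e) n (u (r e))).1 x
      rw [mapCocycles_id_apply, mapCocycles_id_apply]
  · obtain ⟨a, rfl⟩ := listClass_surjective M (n + 1) α
    have h1 : ∀ v, ∃ b ∈ listCochains (MonoidHom.id G) (endHom (N v)) (n + 1),
        diff b = (mapCocycles (j v) (n + 1) a).1 := fun v => by
      rw [← listClass_eq_zero_iff, ← vertexMap_listClass, hα]
      rfl
    choose b hb hba using h1
    have hab : ∀ v x, homOf (j v) (a.1 x) = diff (b v) x := fun v x => by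
      rw [hba, mapCocycles_id_apply]
    -- The differences of the primitives `b` are cocycles, because `M` has the same image from both
    -- ends of an edge.
    let z : ∀ e, listCocycles (P e) n := fun e =>
      ⟨(fun x => homOf (dl e) (b (l e) x)) - fun x => homOf (dr e) (b (r e) x),
        show _ ∈ listCochains _ _ _ from
          sub_mem (comp_homOf_id_mem (dl e) (hb _)) (comp_homOf_id_mem (dr e) (hb _)), by
        change diff _ = 0
        ext x
        rw [map_sub, Pi.sub_apply, diff_homOf_id, diff_homOf_id, ← hab, ← hab, h.comp, sub_self]
        rfl⟩
    exact ⟨_, hδ z a ⟨b, hb, hab, fun e x => rfl⟩⟩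
  · rintro ⟨β, rfl⟩
    obtain ⟨z, rfl⟩ := exists_listClass_eq β
    obtain ⟨a, b, hb, hab, hbz⟩ := h.exists_snake z
    rw [hδ z a ⟨b, hb, hab, hbz⟩]
    ext v
    rw [vertexMap_listClass, Pi.zero_apply, listClass_eq_zero_iff]
    refine ⟨b v, hb v, funext fun x => ?_⟩
    rw [mapCocycles_id_apply, hab]

end IsPatchingSequence

end

end LongExact

section Composition

variable {G G' G'' : Type u} [Group G] [TopologicalSpace G] [IsTopologicalGroup G]
  [CompactSpace G] [TotallyDisconnectedSpace G]
  [Group G'] [TopologicalSpace G'] [IsTopologicalGroup G'] [CompactSpace G']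
  [TotallyDisconnectedSpace G']
  [Group G''] [TopologicalSpace G''] [IsTopologicalGroup G''] [CompactSpace G'']
  [TotallyDisconnectedSpace G'']
  {M : TopRep.{u} ℤ G} {N : TopRep.{u} ℤ G'} {P : TopRep.{u} ℤ G''}
  [DiscreteTopology M] [DiscreteTopology N] [DiscreteTopology P]

lemma mapHCont_mapHCont {φ : G' →ₜ* G} {ψ : G'' →ₜ* G'} {χ : G'' →ₜ* G}
    (f : TopRep.res φ M ⟶ N) (g : TopRep.res ψ N ⟶ P) (h : TopRep.res χ M ⟶ P)
    (hχ : ∀ σ, φ (ψ σ) = χ σ) (hh : ∀ m, homOf g (homOf f m) = homOf h m) (n : ℕ) (α : HCont M n) :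
    mapHCont ψ g n (mapHCont φ f n α) = mapHCont χ h n α := by
  obtain ⟨u, rfl⟩ := listClass_surjective M n α
  rw [mapHCont_listClass', mapHCont_listClass', mapHCont_listClass']
  congr 1
  ext l
  rw [mapCocycles_apply, mapCocycles_apply, mapCocycles_apply, hh, List.map_map]
  simp [Function.comp_def, hχ]

end Composition

/-! ### Compatibility of the comparison maps with restriction -/

section Comparison

variable {F : Type u} [Field F] (A : Over (Spec (CommRingCat.of F))) [GrpObj A] [IsCommMonObj A]
variable {K L : Type u} [Field K] [Field L] [Algebra F K] [Algebra F L]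

lemma Points.map_map_of_comp {R S T : Type u} [CommRing R] [CommRing S] [CommRing T]
    [Algebra F R] [Algebra F S] [Algebra F T] {f : R →ₐ[F] S} {g : S →ₐ[F] T} {h : R →ₐ[F] T}
    (hh : ∀ x, g (f x) = h x) (x : Points A R) :
    Points.map A g (Points.map A f x) = Points.map A h x := by
  rw [Points.map_map]
  exact DFunLike.congr_fun (congrArg (Points.map A) (AlgHom.ext hh)) _

instance (K : Type u) [Field K] [Algebra F K] : DiscreteTopology (galRep A K) :=
  inferInstanceAs (DiscreteTopology (Points A _))

instance (K : Type u) [Field K] [Algebra F K] : DiscreteTopology (tensorRep A K) :=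
  inferInstanceAs (DiscreteTopology (Points A _))

lemma tensorToSep_tmul (a : K) (b : SeparableClosure F) : tensorToSep F K (a ⊗ₜ b) =
    algebraMap K (SeparableClosure K) a * sepEmbedding (Algebra.ofId F K) b :=
  Algebra.TensorProduct.productMap_apply_tmul _ _ _ _

lemma homOf_fromTensorRep_toTensorRep (x : galRep A F) :
    homOf (fromTensorRep A K) (homOf (toTensorRep A K) x) =
      homOf (galRepMap A (Algebra.ofId F K)) x :=
  Points.map_map_of_comp A (fun x => by
    rw [Algebra.TensorProduct.includeRight_apply, tensorToSep_tmul, map_one, one_mul]) x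

lemma resH_ofId (n : ℕ) (α : H A F n) : resH A (Algebra.ofId F K) n α =
    tensorToH A K n (mapHCont (ContinuousMonoidHom.id _) (toTensorRep A K) n α) :=
  (mapHCont_mapHCont (toTensorRep A K) (fromTensorRep A K) (galRepMap A (Algebra.ofId F K))
    (fun _ => rfl) (homOf_fromTensorRep_toTensorRep A) n α).symm

/-- `F^sep` is normal over `F`, so all its embeddings over `F` in one field have the same image. -/
lemma exists_gal_sepEmbedding {Ω : Type u} [Field Ω] [Algebra F Ω]
    (j j' : SeparableClosure F →ₐ[F] Ω) : ∃ γ : Gal(SeparableClosure F/F), ∀ x, j x = j' (γ x) := by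
  let : Algebra (SeparableClosure F) Ω := j'.toRingHom.toAlgebra
  have : IsScalarTower F (SeparableClosure F) Ω :=
    .of_algebraMap_eq fun x => (j'.commutes x).symm
  refine ⟨Normal.algHomEquivAut F Ω (SeparableClosure F) j, fun x => ?_⟩
  exact (AlgHom.restrictNormal_commutes j (SeparableClosure F) x).symm

lemma sepEmbedding_tensorToSep_absGalRestrict (φ : K →ₐ[F] L) (σ : Gal(SeparableClosure L/L))
    (x : K ⊗[F] SeparableClosure F) :
    sepEmbedding φ (tensorToSep F K (tensorAction F K
      (((absGalRestrict (Algebra.ofId F K)).comp (absGalRestrict φ)).toMonoidHom σ) x)) =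
      galAction F L σ (sepEmbedding φ (tensorToSep F K x)) := by
  induction x with
  | zero => simp
  | add a b ha hb => simp only [map_add, ha, hb]
  | tmul a b =>
    change sepEmbedding φ (tensorToSep F K
      (a ⊗ₜ absGalRestrict (Algebra.ofId F K) (absGalRestrict φ σ) b)) =
        σ (sepEmbedding φ (tensorToSep F K (a ⊗ₜ b)))
    rw [tensorToSep_tmul, tensorToSep_tmul, sepEmbedding_absGalRestrict, map_mul, map_mul,
      map_mul, sepEmbedding_absGalRestrict, sepEmbedding_algebraMap, AlgEquiv.commutes]

lemma tensorToSep_map_absGalRestrict (φ : K →ₐ[F] L) (σ : Gal(SeparableClosure L/L))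
    (x : K ⊗[F] SeparableClosure F) :
    tensorToSep F L (Algebra.TensorProduct.map φ (AlgHom.id F _) (tensorAction F K
      ((absGalRestrict (Algebra.ofId F L)).toMonoidHom σ) x)) =
      galAction F L σ (tensorToSep F L (Algebra.TensorProduct.map φ (AlgHom.id F _) x)) := by
  induction x with
  | zero => simp
  | add a b ha hb => simp only [map_add, ha, hb]
  | tmul a b =>
    change tensorToSep F L (φ a ⊗ₜ absGalRestrict (Algebra.ofId F L) σ b) =
      σ (tensorToSep F L (φ a ⊗ₜ b))
    rw [tensorToSep_tmul, tensorToSep_tmul, sepEmbedding_absGalRestrict, map_mul,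
      AlgEquiv.commutes]

/-- The homomorphism `K ⊗ F^sep → L^sep` through `K^sep`, for an extension `φ : K → L`. -/
def throughSepHom (φ : K →ₐ[F] L) : K ⊗[F] SeparableClosure F →ₐ[F] SeparableClosure L :=
  (sepEmbedding φ).comp (tensorToSep F K)

lemma throughSepHom_apply (φ : K →ₐ[F] L) (x : K ⊗[F] SeparableClosure F) :
    throughSepHom φ x = sepEmbedding φ (tensorToSep F K x) := rfl

/-- The homomorphism `K ⊗ F^sep → L^sep` through `L ⊗ F^sep`, for an extension `φ : K → L`. -/
def throughTensorHom (φ : K →ₐ[F] L) : K ⊗[F] SeparableClosure F →ₐ[F] SeparableClosure L :=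
  (tensorToSep F L).comp (Algebra.TensorProduct.map φ (AlgHom.id F _))

lemma throughTensorHom_apply (φ : K →ₐ[F] L) (x : K ⊗[F] SeparableClosure F) :
    throughTensorHom φ x =
      tensorToSep F L (Algebra.TensorProduct.map φ (AlgHom.id F _) x) := rfl

/-- The map `A(K ⊗ F^sep) → A(L^sep)` through `K^sep`, for an extension `φ : K → L`. -/
def throughSep (φ : K →ₐ[F] L) :
    TopRep.res ((absGalRestrict (Algebra.ofId F K)).comp (absGalRestrict φ))
      (tensorRep A K) ⟶ galRep A L :=
  pointsRepMap A ((absGalRestrict (Algebra.ofId F K)).comp (absGalRestrict φ)).toMonoidHom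
    (throughSepHom φ) (sepEmbedding_tensorToSep_absGalRestrict φ)

/-- The map `A(K ⊗ F^sep) → A(L^sep)` through `L ⊗ F^sep`, for an extension `φ : K → L`. -/
def throughTensor (φ : K →ₐ[F] L) :
    TopRep.res (absGalRestrict (Algebra.ofId F L)) (tensorRep A K) ⟶ galRep A L :=
  pointsRepMap A (absGalRestrict (Algebra.ofId F L)).toMonoidHom (throughTensorHom φ)
    (tensorToSep_map_absGalRestrict φ)

lemma homOf_fromTensorRep (x : tensorRep A K) :
    homOf (fromTensorRep A K) x = Points.map A (tensorToSep F K) x := rfl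

lemma homOf_galRepMap (φ : K →ₐ[F] L) (x : galRep A K) :
    homOf (galRepMap A φ) x = Points.map A (sepEmbedding φ) x := rfl

lemma homOf_tensorRepMap (φ : K →ₐ[F] L) (x : tensorRep A K) :
    homOf (tensorRepMap A φ) x =
      Points.map A (Algebra.TensorProduct.map φ (AlgHom.id F (SeparableClosure F))) x := rfl

lemma homOf_throughSep (φ : K →ₐ[F] L) (x : tensorRep A K) :
    homOf (throughSep A φ) x = Points.map A (throughSepHom φ) x := rfl

lemma homOf_throughTensor (φ : K →ₐ[F] L) (x : tensorRep A K) :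
    homOf (throughTensor A φ) x = Points.map A (throughTensorHom φ) x := rfl

lemma endHom_tensorRep (σ : Gal(SeparableClosure F/F)) (x : tensorRep A K) :
    endHom (tensorRep A K) σ x = Points.map A (tensorAction F K σ).toAlgHom x := rfl

lemma homOf_galRepMap_fromTensorRep (φ : K →ₐ[F] L) (x : tensorRep A K) :
    homOf (galRepMap A φ) (homOf (fromTensorRep A K) x) = homOf (throughSep A φ) x := by
  rw [homOf_throughSep, homOf_galRepMap, homOf_fromTensorRep]
  exact Points.map_map_of_comp A (fun x => (throughSepHom_apply φ x).symm) x

lemma homOf_fromTensorRep_tensorRepMap (φ : K →ₐ[F] L) (x : tensorRep A K) :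
    homOf (fromTensorRep A L) (homOf (tensorRepMap A φ) x) = homOf (throughTensor A φ) x := by
  rw [homOf_throughTensor, homOf_fromTensorRep, homOf_tensorRepMap]
  exact Points.map_map_of_comp A (fun x => (throughTensorHom_apply φ x).symm) x

/-- The two routes use two embeddings of `F^sep` in `L^sep`. These differ by some `γ` in the Galois
group of `F`, so the two maps differ by an inner automorphism. -/
lemma mapHCont_throughSep (φ : K →ₐ[F] L) (n : ℕ) :
    mapHCont ((absGalRestrict (Algebra.ofId F K)).comp (absGalRestrict φ)) (throughSep A φ) n =
      mapHCont (absGalRestrict (Algebra.ofId F L)) (throughTensor A φ) n := by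
  obtain ⟨γ, hγ⟩ := exists_gal_sepEmbedding
    ((sepEmbedding φ).comp (sepEmbedding (Algebra.ofId F K))) (sepEmbedding (Algebra.ofId F L))
  have h1 : ∀ x, throughTensorHom φ ((tensorAction F K γ).toAlgHom x) = throughSepHom φ x := by
    intro x
    rw [throughTensorHom_apply, throughSepHom_apply]
    induction x with
    | zero => simp
    | add a b ha hb => simp only [map_add, ha, hb]
    | tmul a b =>
      change tensorToSep F L (φ a ⊗ₜ γ b) = sepEmbedding φ (tensorToSep F K (a ⊗ₜ b))
      rw [tensorToSep_tmul, tensorToSep_tmul, map_mul, sepEmbedding_algebraMap, ← hγ]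
      rfl
  refine mapHCont_eq_of_conj (throughSep A φ) (throughTensor A φ) γ (fun σ => ?_) (fun m => ?_) n
  · refine AlgEquiv.ext fun x => (sepEmbedding (Algebra.ofId F L)).injective ?_
    change sepEmbedding (Algebra.ofId F L) (absGalRestrict (Algebra.ofId F L) σ (γ x)) =
      sepEmbedding (Algebra.ofId F L)
        (γ (absGalRestrict (Algebra.ofId F K) (absGalRestrict φ σ) x))
    rw [sepEmbedding_absGalRestrict, ← hγ, ← hγ, AlgHom.comp_apply, AlgHom.comp_apply,
      sepEmbedding_absGalRestrict, sepEmbedding_absGalRestrict]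
  · rw [homOf_throughTensor, homOf_throughSep, endHom_tensorRep]
    exact (Points.map_map_of_comp A h1 m).symm

lemma resH_tensorToH (φ : K →ₐ[F] L) (n : ℕ) (α : HCont (tensorRep A K) n) :
    resH A φ n (tensorToH A K n α) =
      tensorToH A L n (mapHCont (ContinuousMonoidHom.id _) (tensorRepMap A φ) n α) := by
  have h1 := mapHCont_mapHCont (fromTensorRep A K) (galRepMap A φ) (throughSep A φ) (fun _ => rfl)
    (homOf_galRepMap_fromTensorRep A φ) n α
  have h2 := mapHCont_mapHCont (tensorRepMap A φ) (fromTensorRep A L) (throughTensor A φ)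
    (fun _ => rfl) (homOf_fromTensorRep_tensorRepMap A φ) n α
  exact h1.trans ((DFunLike.congr_fun (mapHCont_throughSep A φ n) α).trans h2.symm)

end Comparison

/-! ### Points of schemes locally of finite type -/

section AffineOpen

variable {X : Scheme.{u}} {U : X.Opens} (hU : IsAffineOpen U)

lemma exists_specMap_fromSpec {R : CommRingCat.{u}} (x : Spec R ⟶ X) (h : ∀ p, x p ∈ U) :
    ∃ φ : Γ(X, U) ⟶ R, Spec.map φ ≫ hU.fromSpec = x := by
  have hx : Set.range x ⊆ Set.range hU.fromSpec := by
    rw [hU.range_fromSpec]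
    rintro _ ⟨p, rfl⟩
    exact h p
  refine ⟨Spec.preimage (IsOpenImmersion.lift hU.fromSpec x hx), ?_⟩
  rw [Spec.map_preimage, IsOpenImmersion.lift_fac]

lemma specMap_fromSpec_injective {R : CommRingCat.{u}} {φ ψ : Γ(X, U) ⟶ R}
    (h : Spec.map φ ≫ hU.fromSpec = Spec.map ψ ≫ hU.fromSpec) : φ = ψ :=
  Spec.map_injective ((cancel_mono hU.fromSpec).1 h)

/-- The ring of functions on an affine open of a scheme locally of finite type over a field is
generated by finitely many functions. -/
lemma exists_finset_generators {F : Type u} [Field F] (f : X ⟶ Spec (CommRingCat.of F))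
    [LocallyOfFiniteType f] : ∃ s : Finset Γ(X, U), ∀ (L : CommRingCat.{u}) (α β : Γ(X, U) ⟶ L),
      Spec.map α ≫ hU.fromSpec ≫ f = Spec.map β ≫ hU.fromSpec ≫ f →
        (∀ b ∈ s, α b = β b) → α = β := by
  have hT := isAffineOpen_top (Spec (CommRingCat.of F))
  have hle : U ≤ f ⁻¹ᵁ ⊤ := le_top
  have hft := f.finiteType_appLE hT hU hle
  algebraize [(f.appLE ⊤ U hle).hom]
  obtain ⟨s, hs⟩ := hft.out
  refine ⟨s, fun L α β h hb => ?_⟩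
  have h1 : f.appLE ⊤ U hle ≫ α = f.appLE ⊤ U hle ≫ β := by
    refine specMap_fromSpec_injective hT ?_
    rw [Spec.map_comp, Spec.map_comp, Category.assoc, Category.assoc,
      hT.SpecMap_appLE_fromSpec f hU hle, h]
  ext b
  have hb' : b ∈ Algebra.adjoin Γ(Spec (CommRingCat.of F), ⊤) (s : Set Γ(X, U)) := hs ▸ trivial
  induction hb' using Algebra.adjoin_induction with
  | mem x hx => exact hb x hx
  | algebraMap r => exact ConcreteCategory.congr_hom h1 r
  | add x y _ _ hx hy => rw [map_add, map_add, hx, hy]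
  | mul x y _ _ hx hy => rw [map_mul, map_mul, hx, hy]

end AffineOpen

section Points

variable {F : Type u} [Field F] {A : Over (Spec (CommRingCat.of F))}
variable {R S : Type u} [CommRing R] [Algebra F R] [CommRing S] [Algebra F S]

/-- The morphism of schemes underlying a point. -/
def Points.hom (x : Points A R) : Spec (CommRingCat.of R) ⟶ A.left := (Additive.toMul x).left

lemma Points.hom_injective {x y : Points A R} (h : x.hom = y.hom) : x = y :=
  congrArg Additive.ofMul (Over.OverMorphism.ext h)

lemma Points.hom_comp (x : Points A R) :
    x.hom ≫ A.hom = Spec.map (CommRingCat.ofHom (algebraMap F R)) :=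
  Over.w (Additive.toMul x)

lemma Points.exists_hom_eq (x : Spec (CommRingCat.of R) ⟶ A.left)
    (h : x ≫ A.hom = Spec.map (CommRingCat.ofHom (algebraMap F R))) :
    ∃ y : Points A R, y.hom = x :=
  ⟨Additive.ofMul (Over.homMk x h), rfl⟩

variable [GrpObj A] [IsCommMonObj A]

lemma Points.hom_map (f : R →ₐ[F] S) (x : Points A R) :
    (Points.map A f x).hom = Spec.map (CommRingCat.ofHom f.toRingHom) ≫ x.hom := rfl

open MonObj MonoidalCategory CartesianMonoidalCategory in
lemma Points.hom_zero :
    (0 : Points A R).hom = Spec.map (CommRingCat.ofHom (algebraMap F R)) ≫ η[A].left := rfl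

open MonObj MonoidalCategory CartesianMonoidalCategory in
/-- Points are determined by their values on a jointly injective family of homomorphisms. -/
lemma Points.map_jointly_injective {J : Type*} (f : J → R →ₐ[F] S) (hf : ∀ r, (∀ i, f i r = 0) → r = 0)
    (x : Points A R) (hx : ∀ i, Points.map A (f i) x = 0) : x = 0 := by
  -- The unit section is a rational point, hence a closed immersion, so the locus where `x` is
  -- trivial is cut out by an ideal `I` of `R`.
  have hη : IsClosedImmersion (η[A]).left := inferInstance
  have hc : IsClosedImmersion (Limits.pullback.fst x.hom η[A].left) := inferInstance
  obtain ⟨I, e, he⟩ := IsClosedImmersion.Spec_iff.1 hc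
  -- Every `f i` factors through `R ⧸ I`, so joint injectivity forces `I` to vanish.
  have hI : I = ⊥ := by
    refine le_bot_iff.1 fun r hr => hf r fun i => ?_
    have h1 : Spec.map (CommRingCat.ofHom (f i).toRingHom) ≫ x.hom =
        Spec.map (CommRingCat.ofHom (algebraMap F S)) ≫ η[A].left :=
      congrArg Points.hom (hx i)
    have h2 : (Limits.pullback.lift _ _ h1 ≫ e.hom) ≫
        Spec.map (CommRingCat.ofHom (Ideal.Quotient.mk I)) =
          Spec.map (CommRingCat.ofHom (f i).toRingHom) := by
      rw [Category.assoc, ← he, Limits.pullback.lift_fst]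
    obtain ⟨ψ, hψ⟩ := Spec.map_surjective (Limits.pullback.lift _ _ h1 ≫ e.hom)
    rw [← hψ, ← Spec.map_comp] at h2
    have h3 := ConcreteCategory.congr_hom (Spec.map_injective h2) r
    have h4 : Ideal.Quotient.mk I r = 0 := Ideal.Quotient.eq_zero_iff_mem.2 hr
    refine h3.symm.trans ?_
    change ψ (Ideal.Quotient.mk I r) = 0
    rw [h4, map_zero]
  subst hI
  have hiso : IsIso (Spec.map (CommRingCat.ofHom (Ideal.Quotient.mk (⊥ : Ideal R)))) := by
    have : IsIso (CommRingCat.ofHom (Ideal.Quotient.mk (⊥ : Ideal R))) :=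
      (RingEquiv.quotientBot R).symm.toCommRingCatIso.isIso_hom
    infer_instance
  have hiso' : IsIso (Limits.pullback.fst x.hom η[A].left) := by
    rw [he]
    infer_instance
  have h5 : x.hom = (inv (Limits.pullback.fst x.hom η[A].left) ≫
      Limits.pullback.snd x.hom η[A].left) ≫ η[A].left := by
    rw [Category.assoc, ← Limits.pullback.condition, IsIso.inv_hom_id_assoc]
  generalize inv (Limits.pullback.fst x.hom η[A].left) ≫
    Limits.pullback.snd x.hom η[A].left = k at h5
  have h6 : η[A].left ≫ A.hom = 𝟙 _ := by simp
  have h7 : k ≫ η[A].left = k ≫ (η[A].left ≫ A.hom) ≫ η[A].left := by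
    rw [h6]
    exact (congrArg (k ≫ ·) (Category.id_comp _)).symm
  refine Points.hom_injective ?_
  rw [Points.hom_zero, ← x.hom_comp, Category.assoc]
  refine h5.trans (h7.trans ?_)
  rw [h5]
  simp only [Category.assoc]

/-- If a family of homomorphisms to a field depends continuously on a parameter, then so does the
family of the induced maps on points. -/
lemma Points.continuous_map [LocallyOfFiniteType A.hom] {G : Type*} [TopologicalSpace G]
    {L : Type u} [Field L] [Algebra F L] (θ : G → (R →ₐ[F] L))
    (hθ : ∀ r, IsLocallyConstant fun g => θ g r) (x : Points A R) :
    Continuous fun g => Points.map A (θ g) x := by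
  refine (IsLocallyConstant.iff_eventually_eq _).2 (fun g => ?_) |>.continuous
  -- Around `p`, the morphism `x` is given on a basic open set of some `r` by a homomorphism from
  -- `Γ(A.left, U)`, which sends the finitely many generators to fractions `c b / r ^ k b`. So for
  -- parameters near `g` the point only depends on the values of `θ` at `r` and at the `c b`.
  let p : Spec (CommRingCat.of R) :=
    Spec.map (CommRingCat.ofHom (θ g).toRingHom) (IsLocalRing.closedPoint L)
  obtain ⟨_, ⟨U, hU, rfl⟩, hpU, -⟩ :=
    A.left.isBasis_affineOpens.exists_subset_of_mem_open (Set.mem_univ (x.hom p)) isOpen_univ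
  obtain ⟨_, ⟨_, ⟨r, rfl⟩, rfl⟩, hpr, hrU⟩ := PrimeSpectrum.isBasis_basic_opens.exists_subset_of_mem_open
    (show p ∈ x.hom ⁻¹ᵁ U from hpU) (x.hom ⁻¹ᵁ U).2
  have hgr : θ g r ≠ 0 := fun h => hpr (by
    change θ g r ∈ IsLocalRing.maximalIdeal L
    rw [h]
    exact zero_mem _)
  let Rr := Localization.Away r
  let j : CommRingCat.of R ⟶ CommRingCat.of Rr := CommRingCat.ofHom (algebraMap R Rr)
  obtain ⟨φ, hφ⟩ := exists_specMap_fromSpec hU (Spec.map j ≫ x.hom) fun q => hrU (by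
    change r ∉ Ideal.comap (algebraMap R Rr) q.asIdeal
    intro h
    exact q.2.ne_top (Ideal.eq_top_of_isUnit_mem _ h (IsLocalization.Away.algebraMap_isUnit r)))
  obtain ⟨s, hs⟩ := exists_finset_generators hU A.hom
  choose k c hc using fun b : Γ(A.left, U) => IsLocalization.Away.surj r (φ b : Rr)
  have hev : ∀ᶠ h in nhds g, θ h r = θ g r ∧ ∀ b ∈ s, θ h (c b) = θ g (c b) := by
    refine ((hθ r).eventually_eq g).and ((Filter.eventually_all_finset s).2 fun b _ => ?_)
    exact (hθ (c b)).eventually_eq g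
  filter_upwards [hev] with h hh
  have hlift : ∀ h : G, θ h r ≠ 0 → ∃ ψ : CommRingCat.of Rr ⟶ CommRingCat.of L,
      j ≫ ψ = CommRingCat.ofHom (θ h).toRingHom := fun h hr => by
    have hu : IsUnit ((θ h).toRingHom r) := IsUnit.mk0 _ hr
    refine ⟨CommRingCat.ofHom (IsLocalization.Away.lift (S := Rr) r hu), ?_⟩
    ext y
    exact IsLocalization.Away.lift_eq r hu y
  obtain ⟨ψ, hψ⟩ := hlift g hgr
  obtain ⟨ψ', hψ'⟩ := hlift h (hh.1.symm ▸ hgr)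
  have key : ∀ (h : G) (ψ : CommRingCat.of Rr ⟶ CommRingCat.of L),
      j ≫ ψ = CommRingCat.ofHom (θ h).toRingHom →
        (Points.map A (θ h) x).hom = Spec.map (φ ≫ ψ) ≫ hU.fromSpec := fun h ψ hψ => by
    rw [Points.hom_map, ← hψ, Spec.map_comp, Spec.map_comp, Category.assoc, Category.assoc, hφ]
  refine Points.hom_injective ?_
  rw [key h ψ' hψ', key g ψ hψ]
  congr 2
  refine hs _ _ _ ?_ fun b hb => ?_
  · rw [← Category.assoc, ← Category.assoc, ← key h ψ' hψ', ← key g ψ hψ, Points.hom_comp,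
      Points.hom_comp]
  · have h1 := hc b
    have e1 : ∀ (h : G) (ψ : CommRingCat.of Rr ⟶ CommRingCat.of L),
      j ≫ ψ = CommRingCat.ofHom (θ h).toRingHom → ψ (φ b) * θ h r ^ k b = θ h (c b) :=
      fun h ψ hψ => by
        have h2 : ∀ y, ψ (algebraMap R Rr y) = θ h y :=
          fun y => ConcreteCategory.congr_hom hψ y
        rw [← h2, ← h2, ← map_pow, ← map_mul, h1]
    have e2 := e1 h ψ' hψ'
    rw [hh.1, hh.2 b hb, ← e1 g ψ hψ] at e2
    exact mul_right_cancel₀ (pow_ne_zero _ hgr) e2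

end Points

/-! ### The algebra `K ⊗ F^sep` as equivariant functions on the Galois group -/

section FiniteGalois

variable {F E Ω : Type*} [Field F] [Field E] [Field Ω] [Algebra F E] [Algebra F Ω]
  [FiniteDimensional F E] [IsGalois F E]

variable (F E) in
lemma nonempty_basis_gal : Nonempty (Module.Basis Gal(E/F) F E) :=
  ⟨(Module.finBasis F E).reindex
    (Finite.equivFinOfCardEq (IsGalois.card_aut_eq_finrank F E)).symm⟩

/-- Indexing the basis by the Galois group makes the matrix of conjugates square; it is invertible
by Dedekind's independence of embeddings. -/
lemma exists_sum_eq (j : E →ₐ[F] Ω) (β : Module.Basis Gal(E/F) F E) (u : Gal(E/F) → Ω) :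
    ∃ a : Gal(E/F) → Ω, ∀ g, ∑ i, a i * j (g (β i)) = u g := by
  classical
  let M : Matrix Gal(E/F) Gal(E/F) Ω := Matrix.of fun g i => j (g (β i))
  have hM : IsUnit M := by
    rw [← Matrix.linearIndependent_rows_iff_isUnit, Fintype.linearIndependent_iff]
    intro c hc g
    have h1 : LinearIndependent Ω fun g : Gal(E/F) => (j.comp g.toAlgHom).toLinearMap :=
      (linearIndependent_toLinearMap F E Ω).comp (fun g : Gal(E/F) => j.comp g.toAlgHom)
        fun g g' h => AlgEquiv.ext fun x => j.injective (DFunLike.congr_fun h x)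
    refine Fintype.linearIndependent_iff.1 h1 c (β.ext fun i => ?_) g
    have h2 := congrFun hc i
    simpa [M, Finset.sum_apply, LinearMap.sum_apply] using h2
  have hdet := (Matrix.isUnit_iff_isUnit_det M).1 hM
  refine ⟨M⁻¹.mulVec u, fun g => ?_⟩
  have h3 : M.mulVec (M⁻¹.mulVec u) = u := by
    rw [Matrix.mulVec_mulVec, Matrix.mul_nonsing_inv _ hdet, Matrix.one_mulVec]
  rw [← congrFun h3 g]
  exact Finset.sum_congr rfl fun i _ => mul_comm _ _

/-- By `exists_sum_eq` the linear system is a surjective endomorphism of a finite-dimensional space,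
hence injective. -/
lemma eq_zero_of_sum_eq_zero (j : E →ₐ[F] Ω) (β : Module.Basis Gal(E/F) F E) (a : Gal(E/F) → Ω)
    (ha : ∀ g : Gal(E/F), ∑ i, a i * j (g (β i)) = 0) : a = 0 := by
  let T : (Gal(E/F) → Ω) →ₗ[Ω] (Gal(E/F) → Ω) :=
    { toFun a g := ∑ i, a i * j (g (β i))
      map_add' a b := by ext g; simp [add_mul, Finset.sum_add_distrib]
      map_smul' c a := by ext g; simp [mul_assoc, Finset.mul_sum] }
  have hT : Function.Surjective T := fun u =>
    (exists_sum_eq j β u).imp fun a ha => funext ha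
  exact LinearMap.injective_iff_surjective.2 hT ((funext ha).trans (map_zero T).symm)

end FiniteGalois

section InfiniteGalois

variable {F N K Ω : Type*} [Field F] [Field N] [Algebra F N] [IsGalois F N]
  [Field K] [Algebra F K] [Field Ω] [Algebra F Ω] [Algebra K Ω] [IsScalarTower F K Ω]
  (j : N →ₐ[F] Ω)

lemma exists_eq_sum_tmul (E : FiniteGaloisIntermediateField F N) (β : Module.Basis Gal(E/F) F E)
    {x : K ⊗[F] N} {S : Finset (K × N)} (hx : x = ∑ i ∈ S, i.1 ⊗ₜ[F] i.2)
    (hS : ∀ i ∈ S, i.2 ∈ E.toIntermediateField) :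
    ∃ a : Gal(E/F) → K, x = ∑ g, a g ⊗ₜ[F] (β g : N) := by
  subst hx
  refine Finset.sum_induction (p := fun x : K ⊗[F] N => ∃ a : Gal(E/F) → K,
    x = ∑ g, a g ⊗ₜ[F] (β g : N)) _ ?_ ⟨0, by simp⟩ fun i hi => ?_
  · rintro _ _ ⟨a, rfl⟩ ⟨b, rfl⟩
    exact ⟨a + b, by simp [TensorProduct.add_tmul, Finset.sum_add_distrib]⟩
  · refine ⟨fun g => (β.repr ⟨i.2, hS i hi⟩ g) • i.1, ?_⟩
    have h := congrArg (Subtype.val : E → N) (β.sum_repr ⟨i.2, hS i hi⟩)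
    simp_rw [TensorProduct.smul_tmul, ← TensorProduct.tmul_sum]
    congr 1
    refine h.symm.trans ?_
    exact (map_sum E.toIntermediateField.val _ _).trans
      (Finset.sum_congr rfl fun g _ => map_smul E.toIntermediateField.val _ _)

/-- The homomorphisms `K ⊗ N → Ω` for the elements of the Galois group of `N` are jointly
injective. -/
lemma eq_zero_of_forall_gal (x : K ⊗[F] N) (θ : Gal(N/F) → (K ⊗[F] N →ₐ[F] Ω))
    (hθ : ∀ g a b, θ g (a ⊗ₜ b) = algebraMap K Ω a * j (g b)) (hx : ∀ g, θ g x = 0) : x = 0 := by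
  obtain ⟨S, hS⟩ := TensorProduct.exists_finset x
  -- A tensor involves finitely many elements of `N`, so a finite Galois level suffices.
  let E := FiniteGaloisIntermediateField.adjoin F (Prod.snd '' (S : Set (K × N)))
  obtain ⟨β⟩ := nonempty_basis_gal F E
  obtain ⟨a, rfl⟩ := exists_eq_sum_tmul E β hS fun i hi =>
    FiniteGaloisIntermediateField.subset_adjoin F _ ⟨i, hi, rfl⟩
  have h := eq_zero_of_sum_eq_zero (j.comp E.toIntermediateField.val) β
    (fun g => algebraMap K Ω (a g)) fun g => by
      obtain ⟨g, rfl⟩ := AlgEquiv.restrictNormalHom_surjective N g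
      rw [← hx g, map_sum]
      refine Finset.sum_congr rfl fun i _ => ?_
      rw [hθ]
      exact congrArg (fun y => algebraMap K Ω (a i) * j y)
        (AlgEquiv.restrictNormal_commutes g E (β i))
  refine Finset.sum_eq_zero fun g _ => ?_
  rw [(algebraMap K Ω).injective ((congrFun h g).trans (map_zero _).symm), TensorProduct.zero_tmul]

/-- A smooth function on the Galois group of `N` that is equivariant comes from `K ⊗ N`. -/
lemma exists_forall_gal_eq [IsGalois K Ω] (φ : Gal(Ω/K) → Gal(N/F))
    (hφ : ∀ σ x, j (φ σ x) = σ (j x)) (θ : Gal(N/F) → (K ⊗[F] N →ₐ[F] Ω))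
    (hθ : ∀ g a b, θ g (a ⊗ₜ b) = algebraMap K Ω a * j (g b)) (u : Gal(N/F) → Ω)
    (U : OpenNormalSubgroup Gal(N/F)) (hu : ∀ g h, g⁻¹ * h ∈ U → u g = u h)
    (heq : ∀ σ g, u (φ σ * g) = σ (u g)) : ∃ x, ∀ g, θ g x = u g := by
  obtain ⟨E, hE⟩ := (InfiniteGalois.krullTopology_mem_nhds_one_iff_of_isGalois (U : Set Gal(N/F))).1
    (U.isOpen'.mem_nhds (one_mem U))
  obtain ⟨β⟩ := nonempty_basis_gal F E
  choose s hs using AlgEquiv.restrictNormalHom_surjective (F := F) (K₁ := E) N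
  -- The coefficients are first found in `Ω`. The equivariance of `u` and the uniqueness of the
  -- solution show that they are Galois invariant, hence in `K`.
  obtain ⟨a, ha⟩ := exists_sum_eq (j.comp E.toIntermediateField.val) β fun g => u (s g)
  have hr : ∀ (g : Gal(N/F)) (x : E), (AlgEquiv.restrictNormalHom E g x : N) = g x :=
    fun g x => AlgEquiv.restrictNormal_commutes g E x
  have ha' : ∀ g : Gal(N/F), ∑ i, a i * j (g (β i)) = u g := by
    intro g
    rw [← hu (s (AlgEquiv.restrictNormalHom E g)) g, ← ha]
    · exact Finset.sum_congr rfl fun i _ => congrArg (fun y => a i * j y) (hr g (β i)).symm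
    · refine hE ((FiniteGaloisIntermediateField.mem_fixingSubgroup_iff _ _).2 ?_)
      rw [map_mul, map_inv, hs, inv_mul_cancel]
  have hfix : ∀ i, a i ∈ Set.range (algebraMap K Ω) := by
    intro i
    rw [InfiniteGalois.mem_range_algebraMap_iff_fixed]
    intro σ
    have h := eq_zero_of_sum_eq_zero (j.comp E.toIntermediateField.val) β
      (fun g => σ (a g) - a g) fun g => by
        obtain ⟨g, rfl⟩ := AlgEquiv.restrictNormalHom_surjective N g
        have h1 := ha' g
        have h2 := congrArg σ (ha' ((φ σ)⁻¹ * g))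
        rw [← heq, mul_inv_cancel_left, ← h1, map_sum] at h2
        simp_rw [sub_mul]
        rw [Finset.sum_sub_distrib, sub_eq_zero]
        refine Eq.trans (Finset.sum_congr rfl fun i _ => ?_) (h2.trans
          (Finset.sum_congr rfl fun i _ => congrArg (fun y => a i * j y) (hr g (β i)).symm))
        rw [map_mul, ← hφ, ← AlgEquiv.mul_apply, mul_inv_cancel_left]
        exact congrArg (fun y => σ (a i) * j y) (hr g (β i))
    exact sub_eq_zero.1 (congrFun h i)
  choose c hc using hfix
  refine ⟨∑ i, c i ⊗ₜ (β i : N), fun g => ?_⟩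
  rw [map_sum, ← ha']
  exact Finset.sum_congr rfl fun i _ => by rw [hθ, hc]

end InfiniteGalois

/-! ### Open stabilizers in the modules of points -/

section Stabilizers

variable {F : Type u} [Field F] {K : Type u} [Field K] [Algebra F K]

lemma isLocallyConstant_gal_apply (x : SeparableClosure K) :
    IsLocallyConstant fun σ : Gal(SeparableClosure K/K) => σ x := by
  refine (IsLocallyConstant.iff_eventually_eq _).2 fun σ => ?_
  have h1 : (MulAction.stabilizer Gal(SeparableClosure K/K) x : Set _) ∈
      nhds (1 : Gal(SeparableClosure K/K)) :=
    (stabilizer_isOpen_of_isIntegral x).mem_nhds (one_mem _)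
  have h2 : Filter.Tendsto (fun τ => σ⁻¹ * τ) (nhds σ) (nhds 1) := by
    have := (continuous_const_mul σ⁻¹).tendsto σ
    rwa [inv_mul_cancel] at this
  filter_upwards [h2 h1] with τ hτ
  have h3 : (σ⁻¹ * τ) x = x := hτ
  rw [AlgEquiv.mul_apply, AlgEquiv.aut_inv, AlgEquiv.symm_apply_eq] at h3
  exact h3

variable (F K) in
/-- The homomorphism `K ⊗ F^sep → K^sep` given by the action of an element of the Galois group on
the second factor. -/
def tensorGal (g : Gal(SeparableClosure F/F)) :
    K ⊗[F] SeparableClosure F →ₐ[F] SeparableClosure K :=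
  (tensorToSep F K).comp (tensorAction F K g).toAlgHom

lemma tensorGal_apply (g : Gal(SeparableClosure F/F)) (x : K ⊗[F] SeparableClosure F) :
    tensorGal F K g x = tensorToSep F K ((tensorAction F K g).toAlgHom x) := rfl

lemma tensorGal_tmul (g : Gal(SeparableClosure F/F)) (a : K) (b : SeparableClosure F) :
    tensorGal F K g (a ⊗ₜ b) =
      algebraMap K (SeparableClosure K) a * sepEmbedding (Algebra.ofId F K) (g b) :=
  tensorToSep_tmul a (g b)

lemma isLocallyConstant_tensorGal (x : K ⊗[F] SeparableClosure F) :
    IsLocallyConstant fun g => tensorGal F K g x := by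
  induction x with
  | zero =>
    simp_rw [map_zero]
    exact IsLocallyConstant.const 0
  | add x y hx hy =>
    simp_rw [map_add]
    exact hx.add hy
  | tmul a b =>
    simp_rw [tensorGal_tmul]
    exact (isLocallyConstant_gal_apply b).comp
      fun y => algebraMap K (SeparableClosure K) a * sepEmbedding (Algebra.ofId F K) y

lemma eq_zero_of_tensorGal (x : K ⊗[F] SeparableClosure F) (hx : ∀ g, tensorGal F K g x = 0) :
    x = 0 :=
  eq_zero_of_forall_gal (sepEmbedding (Algebra.ofId F K)) x (tensorGal F K) tensorGal_tmul hx

variable (A : Over (Spec (CommRingCat.of F))) [GrpObj A] [IsCommMonObj A]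

lemma homOf_fromTensorRep_endHom (g : Gal(SeparableClosure F/F)) (x : tensorRep A K) :
    homOf (fromTensorRep A K) (endHom (tensorRep A K) g x) = Points.map A (tensorGal F K g) x := by
  rw [homOf_fromTensorRep, endHom_tensorRep]
  exact Points.map_map_of_comp A (fun x => (tensorGal_apply g x).symm) x

lemma Points.eq_zero_of_tensorGal (x : Points A (K ⊗[F] SeparableClosure F))
    (hx : ∀ g, Points.map A (tensorGal F K g) x = 0) : x = 0 := by
  have key := @Points.map_jointly_injective F _ A (K ⊗[F] SeparableClosure F) (SeparableClosure K)
    _ _ _ _ _ _ Gal(SeparableClosure F/F) (tensorGal F K)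
  exact key GammaPatching.eq_zero_of_tensorGal x hx

lemma eq_zero_of_homOf_fromTensorRep (x : tensorRep A K)
    (hx : ∀ g, homOf (fromTensorRep A K) (endHom (tensorRep A K) g x) = 0) : x = 0 := by
  refine Points.eq_zero_of_tensorGal A x fun g => ?_
  rw [← homOf_fromTensorRep_endHom]
  exact hx g

variable [LocallyOfFiniteType A.hom]

lemma hasOpenStabilizers_galRep : HasOpenStabilizers (endHom (galRep A K)) := by
  intro x
  have hc : Continuous fun σ : Gal(SeparableClosure K/K) => endHom (galRep A K) σ x :=
    Points.continuous_map (A := A) (fun σ => (galAction F K σ).toAlgHom)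
      (fun y => isLocallyConstant_gal_apply y) x
  obtain ⟨U, hU⟩ := exists_openNormalSubgroup_of_continuous hc
  refine ⟨U, fun σ hσ => ?_⟩
  have := hU 1 σ (by simpa using hσ)
  rw [map_one] at this
  exact this.symm

/-- Continuity is only available for points over fields, so it is tested through the jointly
injective maps `tensorGal F K g`. One subgroup works for all `g`, because `g⁻¹ * (g * σ) = σ`. -/
lemma hasOpenStabilizers_tensorRep : HasOpenStabilizers (endHom (tensorRep A K)) := by
  intro x
  have hc := @Points.continuous_map F _ A (K ⊗[F] SeparableClosure F) _ _ _ _ _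
    Gal(SeparableClosure F/F) _ (SeparableClosure K) _ _ (tensorGal F K)
  obtain ⟨U, hU⟩ := exists_openNormalSubgroup_of_continuous (hc isLocallyConstant_tensorGal x)
  refine ⟨U, fun σ hσ => sub_eq_zero.1 (eq_zero_of_homOf_fromTensorRep A _ fun g => ?_)⟩
  have h1 : endHom (tensorRep A K) g (endHom (tensorRep A K) σ x) =
      endHom (tensorRep A K) (g * σ) x := by
    rw [map_mul]
    rfl
  rw [map_sub (endHom (tensorRep A K) g : tensorRep A K →+ tensorRep A K), map_sub, h1,
    sub_eq_zero, homOf_fromTensorRep_endHom, homOf_fromTensorRep_endHom]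
  exact (hU g (g * σ) (by simpa using hσ)).symm

end Stabilizers

/-! ### Points as equivariant functions on the Galois group -/

section AffineFactor

variable {X : Scheme.{u}} {R S : CommRingCat.{u}}

/-- The ring homomorphism corresponding to a morphism from an affine scheme into an affine open. -/
def factorHom {U : X.Opens} (hU : IsAffineOpen U) (x : Spec R ⟶ X) (h : ∀ p, x p ∈ U) :
    Γ(X, U) ⟶ R :=
  (exists_specMap_fromSpec hU x h).choose

lemma specMap_factorHom {U : X.Opens} (hU : IsAffineOpen U) (x : Spec R ⟶ X) (h : ∀ p, x p ∈ U) :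
    Spec.map (factorHom hU x h) ≫ hU.fromSpec = x :=
  (exists_specMap_fromSpec hU x h).choose_spec

lemma factorHom_specMap {U : X.Opens} (hU : IsAffineOpen U) (x : Spec R ⟶ X) (h : ∀ p, x p ∈ U)
    (f : R ⟶ S) (y : Spec S ⟶ X) (hy : Spec.map f ≫ x = y) (h' : ∀ p, y p ∈ U) :
    factorHom hU y h' = factorHom hU x h ≫ f := by
  refine specMap_fromSpec_injective hU ?_
  rw [specMap_factorHom, Spec.map_comp, Category.assoc, specMap_factorHom, hy]

variable {I : Type u} {U : I → X.Opens} (hU : ∀ i, IsAffineOpen (U i))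

/-- The product of the rings of functions on finitely many affine opens. -/
abbrev sectionsProd (U : I → X.Opens) : CommRingCat.{u} := CommRingCat.of (∀ i, Γ(X, U i))

/-- The ring homomorphism from a product corresponding to a morphism from an affine scheme into one
of the affine opens. -/
def factorProd (i : I) (x : Spec R ⟶ X) (h : ∀ p, x p ∈ U i) : sectionsProd U ⟶ R :=
  CommRingCat.ofHom (Pi.evalRingHom (fun i => Γ(X, U i)) i) ≫ factorHom (hU i) x h

/-- The index equality is a hypothesis, so that the affine open may change along a propositional
equality. -/
lemma factorProd_specMap {i j : I} (hij : j = i) (x : Spec R ⟶ X) (h : ∀ p, x p ∈ U i)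
    (f : R ⟶ S) (y : Spec S ⟶ X) (hy : Spec.map f ≫ x = y) (h' : ∀ p, y p ∈ U j) :
    factorProd hU j y h' = factorProd hU i x h ≫ f := by
  subst hij
  rw [factorProd, factorProd, factorHom_specMap (hU j) x h f y hy, Category.assoc]

/-- The morphism from the spectrum of a finite product of rings of functions on affine opens. -/
def fromSpecProd [Finite I] : Spec (sectionsProd U) ⟶ X :=
  inv (sigmaSpec fun i => Γ(X, U i)) ≫ Limits.Sigma.desc fun i => (hU i).fromSpec

lemma specMap_factorProd [Finite I] (i : I) (x : Spec R ⟶ X) (h : ∀ p, x p ∈ U i) :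
    Spec.map (factorProd hU i x h) ≫ fromSpecProd hU = x := by
  rw [factorProd, Spec.map_comp, Category.assoc, fromSpecProd, ← ι_sigmaSpec, Category.assoc,
    IsIso.hom_inv_id_assoc, Limits.Sigma.ι_desc, specMap_factorHom]

end AffineFactor

section Descent

variable {F : Type u} [Field F] {A : Over (Spec (CommRingCat.of F))} [GrpObj A] [IsCommMonObj A]
variable {R : Type u} [CommRing R] [Algebra F R] {L : Type u} [Field L] [Algebra F L]
  {G : Type*} [Group G] [TopologicalSpace G] [IsTopologicalGroup G] [CompactSpace G]

/-- If the elements of a ring are the smooth equivariant functions on a group with values in a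
field, then the same is true of the points of `A`. -/
lemma Points.exists_map_eq {P : Type*} (α : P → (L →ₐ[F] L)) (β : P → G → G)
    (θ : G → (R →ₐ[F] L)) (hθ : ∀ r, (∀ g, θ g r = 0) → r = 0) (U : OpenNormalSubgroup G)
    (hring : ∀ u : G → L, (∀ g h, g⁻¹ * h ∈ U → u g = u h) →
      (∀ σ g, u (β σ g) = α σ (u g)) → ∃ r, ∀ g, θ g r = u g)
    (u : G → Points A L) (hU : ∀ g h, g⁻¹ * h ∈ U → u g = u h)
    (hu : ∀ σ g, u (β σ g) = Points.map A (α σ) (u g)) :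
    ∃ x : Points A R, ∀ g, Points.map A (θ g) x = u g := by
  have hθ' : ∀ r r', (∀ g, θ g r = θ g r') → r = r' := fun r r' h =>
    sub_eq_zero.1 (hθ _ fun g => by rw [map_sub, h, sub_self])
  let s : G → A.left := fun g => (u g).hom (IsLocalRing.closedPoint L)
  have hs : ∀ g p, (u g).hom p = s g := fun g p =>
    congrArg (u g).hom (Subsingleton.elim (α := PrimeSpectrum L) p (IsLocalRing.closedPoint L))
  -- As `u` is constant modulo `U`, it meets finitely many points of `A`, and finitely many affine
  -- opens suffice.
  have hfin : Finite (Set.range s) := by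
    have h1 : Set.range s ⊆ Set.range fun q : G ⧸ U.toSubgroup => s q.out := by
      rintro _ ⟨g, rfl⟩
      refine ⟨(g : G ⧸ U.toSubgroup), ?_⟩
      have h2 : (Quotient.out (g : G ⧸ U.toSubgroup))⁻¹ * g ∈ U.toSubgroup :=
        QuotientGroup.eq.1 (QuotientGroup.out_eq' _)
      exact congrArg (fun y : Points A L => y.hom (IsLocalRing.closedPoint L)) (hU _ _ h2)
    exact ((Set.finite_range _).subset h1).to_subtype
  have haff : ∀ i : Set.range s, ∃ W : A.left.Opens, IsAffineOpen W ∧ i.1 ∈ W := fun i => by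
    obtain ⟨_, ⟨W, hW, rfl⟩, hiW, -⟩ :=
      A.left.isBasis_affineOpens.exists_subset_of_mem_open (Set.mem_univ i.1) isOpen_univ
    exact ⟨W, hW, hiW⟩
  choose W hW hiW using haff
  let t : G → Set.range s := fun g => ⟨s g, g, rfl⟩
  have hm : ∀ g p, (u g).hom p ∈ W (t g) := fun g p => (hs g p).symm ▸ hiW (t g)
  -- All values of `u` factor through the disjoint union of these opens, which is affine; they
  -- become homomorphisms from one ring.
  let Φ : G → (sectionsProd W ⟶ CommRingCat.of L) := fun g => factorProd hW (t g) (u g).hom (hm g)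
  have hΦU : ∀ g h, g⁻¹ * h ∈ U → Φ g = Φ h := fun g h hgh => by
    have h1 := factorProd_specMap hW (i := t h) (j := t g)
      (Subtype.ext (congrArg (fun y : Points A L => y.hom (IsLocalRing.closedPoint L))
        (hU g h hgh))) (u h).hom (hm h) (𝟙 _) (u g).hom (by
        rw [Spec.map_id, Category.id_comp, hU g h hgh]) (hm g)
    rwa [Category.comp_id] at h1
  have hΦα : ∀ σ g, Φ (β σ g) = Φ g ≫ CommRingCat.ofHom (α σ).toRingHom := fun σ g => by
    have h1 : Spec.map (CommRingCat.ofHom (α σ).toRingHom) ≫ (u g).hom = (u (β σ g)).hom := by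
      rw [hu, Points.hom_map]
    refine factorProd_specMap hW (Subtype.ext ?_) _ _ _ _ h1 _
    change (u (β σ g)).hom _ = s g
    rw [← h1]
    exact hs g _
  -- Each section `b` yields an equivariant function with values in `L`, hence an element of `R`;
  -- joint injectivity makes `m` a ring homomorphism.
  choose m hm' using fun b : sectionsProd W => hring (fun g => Φ g b)
    (fun g h hgh => by rw [hΦU g h hgh]) (fun σ g => by rw [hΦα]; rfl)
  let M : sectionsProd W ⟶ CommRingCat.of R := CommRingCat.ofHom
    { toFun := m
      map_one' := hθ' _ _ fun g => by rw [hm', map_one, map_one]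
      map_zero' := hθ' _ _ fun g => by rw [hm', map_zero, map_zero]
      map_mul' := fun b c => hθ' _ _ fun g => by rw [hm', map_mul, map_mul, hm', hm']
      map_add' := fun b c => hθ' _ _ fun g => by rw [hm', map_add, map_add, hm', hm'] }
  have hM : ∀ g, M ≫ CommRingCat.ofHom (θ g).toRingHom = Φ g := fun g => by
    ext b
    exact hm' b g
  have hy : ∀ g, Spec.map (CommRingCat.ofHom (θ g).toRingHom) ≫ Spec.map M ≫ fromSpecProd hW =
      (u g).hom := fun g => by
    rw [← Category.assoc, ← Spec.map_comp, hM]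
    exact specMap_factorProd hW _ _ _
  obtain ⟨ψ, hψ⟩ := Spec.map_surjective ((Spec.map M ≫ fromSpecProd hW) ≫ A.hom)
  have hψ' : ψ = CommRingCat.ofHom (algebraMap F R) := by
    ext c
    refine hθ' _ _ fun g => ?_
    have h1 : ψ ≫ CommRingCat.ofHom (θ g).toRingHom = CommRingCat.ofHom (algebraMap F L) := by
      refine Spec.map_injective ?_
      rw [Spec.map_comp, hψ, ← Category.assoc, hy, Points.hom_comp]
    exact (ConcreteCategory.congr_hom h1 c).trans ((θ g).commutes c).symm
  obtain ⟨y, hy'⟩ := Points.exists_hom_eq (Spec.map M ≫ fromSpecProd hW) (hψ.symm.trans (by rw [hψ']))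
  refine ⟨y, fun g => Points.hom_injective ?_⟩
  rw [Points.hom_map, hy', hy]

end Descent

section Surjectivity

variable {F : Type u} [Field F] {K : Type u} [Field K] [Algebra F K]
  (A : Over (Spec (CommRingCat.of F))) [GrpObj A] [IsCommMonObj A]

lemma exists_tensorGal_eq (U : OpenNormalSubgroup Gal(SeparableClosure F/F))
    (u : Gal(SeparableClosure F/F) → SeparableClosure K) (hu : ∀ g h, g⁻¹ * h ∈ U → u g = u h)
    (heq : ∀ (σ : Gal(SeparableClosure K/K)) g,
      u (absGalRestrict (Algebra.ofId F K) σ * g) = (galAction F K σ).toAlgHom (u g)) :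
    ∃ x, ∀ g, tensorGal F K g x = u g :=
  exists_forall_gal_eq (sepEmbedding (Algebra.ofId F K)) (absGalRestrict (Algebra.ofId F K))
    (sepEmbedding_absGalRestrict (Algebra.ofId F K)) (tensorGal F K) tensorGal_tmul u U hu heq

lemma exists_homOf_fromTensorRep_eq (u : Gal(SeparableClosure F/F) → galRep A K)
    (hU : ∃ U : OpenNormalSubgroup Gal(SeparableClosure F/F), ∀ g h, g⁻¹ * h ∈ U → u g = u h)
    (hu : ∀ σ g, u (absGalRestrict (Algebra.ofId F K) σ * g) = endHom (galRep A K) σ (u g)) :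
    ∃ x, ∀ g, homOf (fromTensorRep A K) (endHom (tensorRep A K) g x) = u g := by
  obtain ⟨U, hU⟩ := hU
  have key := @Points.exists_map_eq F _ A _ _ (K ⊗[F] SeparableClosure F) _ _ (SeparableClosure K)
    _ _ Gal(SeparableClosure F/F) _ _ _ _ Gal(SeparableClosure K/K)
    (fun σ => (galAction F K σ).toAlgHom) (fun σ g => absGalRestrict (Algebra.ofId F K) σ * g)
    (tensorGal F K) eq_zero_of_tensorGal U (exists_tensorGal_eq U) u hU hu
  obtain ⟨x, hx⟩ := key
  exact ⟨x, fun g => (homOf_fromTensorRep_endHom A g x).trans (hx g)⟩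

end Surjectivity

/-! ### The compositum with `F^sep` and the comparison isomorphism -/

section Acyclic

lemma exists_diff_eq_of_addEquiv {P N N' : Type*} [Group P] [TopologicalSpace P] [AddCommGroup N]
    [AddCommGroup N'] {ρ : P →* AddMonoid.End N} {ρ' : P →* AddMonoid.End N'} (f : N ≃+ N')
    (hf : ∀ σ x, f (ρ σ x) = ρ' σ (f x)) {n : ℕ}
    (h : ∀ u ∈ listCochains (MonoidHom.id P) ρ' (n + 1), diff u = 0 →
      ∃ w ∈ listCochains (MonoidHom.id P) ρ' n, diff w = u)
    {u : List P → N} (hu : u ∈ listCochains (MonoidHom.id P) ρ (n + 1)) (hd : diff u = 0) :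
    ∃ w ∈ listCochains (MonoidHom.id P) ρ n, diff w = u := by
  obtain ⟨w, ⟨h1, h2, h3, h4⟩, hw⟩ := h (fun l => f (u l))
    ⟨by simp [hu.1], fun l hl => by simp [hu.2.1 l hl],
      fun σ l => (congrArg f (hu.2.2.1 σ l)).trans (hf σ _), hu.2.2.2.comp f⟩
    (funext fun l => (map_diff (f : N →+ N') u l).symm.trans (by rw [hd]; exact map_zero f))
  refine ⟨fun l => f.symm (w l), ⟨by simp [h1], fun l hl => by simp [h2 l hl], fun σ l => ?_,
    h4.comp f.symm⟩, funext fun l => ?_⟩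
  · refine (congrArg f.symm (h3 σ l)).trans ?_
    rw [AddEquiv.symm_apply_eq, hf, AddEquiv.apply_symm_apply]
  · refine (map_diff (f.symm : N' →+ N) w l).symm.trans ?_
    rw [hw]
    exact f.symm_apply_apply _

variable {F : Type u} [Field F] {K : Type u} [Field K] [Algebra F K] {E : Type u} [Field E]
  [Algebra F E] [Algebra K E] [IsScalarTower F K E] (j : E →ₐ[K] SeparableClosure K)

-- Since `j` embeds `E` over `K` in `K^sep`, the field `K^sep` is separable over `E` and so is a
-- separable closure of `E`.
variable (F) in
lemma exists_sepEquiv : ∃ e : SeparableClosure E ≃ₐ[F] SeparableClosure K,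
    ∀ x : E, e (algebraMap E _ x) = j x := by
  let : Algebra E (SeparableClosure K) := j.toRingHom.toAlgebra
  have : IsScalarTower K E (SeparableClosure K) := .of_algebraMap_eq fun x => (j.commutes x).symm
  have : Algebra.IsSeparable E (SeparableClosure K) :=
    Algebra.isSeparable_tower_top_of_isSeparable K E (SeparableClosure K)
  have : IsSepClosure E (SeparableClosure K) := ⟨inferInstance, inferInstance⟩
  let e := IsSepClosure.equiv E (SeparableClosure E) (SeparableClosure K)
  have he : ∀ x : E, e (algebraMap E _ x) = j x := fun x => e.commutes x
  refine ⟨AlgEquiv.ofRingEquiv (f := e.toRingEquiv) fun x => ?_, he⟩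
  change e (algebraMap F _ x) = _
  rw [IsScalarTower.algebraMap_apply F E (SeparableClosure E), he,
    IsScalarTower.algebraMap_apply F K E, AlgHom.commutes,
    ← IsScalarTower.algebraMap_apply F K (SeparableClosure K)]

lemma exists_galEmbedding (e : SeparableClosure E ≃ₐ[F] SeparableClosure K)
    (he : ∀ x : E, e (algebraMap E _ x) = j x) :
    ∃ ψ : Gal(SeparableClosure E/E) →* Gal(SeparableClosure K/K), Continuous ψ ∧
      ∀ σ x, ψ σ (e x) = e (σ x) := by
  let ψ₀ : Gal(SeparableClosure E/E) → Gal(SeparableClosure K/K) := fun σ =>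
    AlgEquiv.ofRingEquiv (f := (e.symm.toRingEquiv.trans σ.toRingEquiv).trans e.toRingEquiv)
      fun x => by
        change e (σ (e.symm (algebraMap K _ x))) = algebraMap K _ x
        have h1 : algebraMap K (SeparableClosure K) x = e (algebraMap E _ (algebraMap K E x)) := by
          rw [he, AlgHom.commutes]
        rw [h1, AlgEquiv.symm_apply_apply, AlgEquiv.commutes]
  have hψ₀ : ∀ σ x, ψ₀ σ (e x) = e (σ x) := fun σ x =>
    congrArg (fun y => e (σ y)) (e.symm_apply_apply x)
  let ψ : Gal(SeparableClosure E/E) →* Gal(SeparableClosure K/K) := MonoidHom.mk' ψ₀ fun σ τ => by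
    ext x
    obtain ⟨x, rfl⟩ := e.surjective x
    rw [AlgEquiv.mul_apply, hψ₀, hψ₀, hψ₀, AlgEquiv.mul_apply]
  refine ⟨ψ, continuous_of_continuousAt_one ψ ?_, hψ₀⟩
  rw [ContinuousAt, map_one, Filter.tendsto_def]
  intro U hU
  obtain ⟨L, hL, hLU⟩ := (krullTopology_mem_nhds_one_iff K (SeparableClosure K) U).1 hU
  let b := Module.finBasis K L
  have key : ∀ i, (MulAction.stabilizer Gal(SeparableClosure E/E)
      (e.symm (b i : SeparableClosure K)) : Set Gal(SeparableClosure E/E)) ∈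
        nhds (1 : Gal(SeparableClosure E/E)) := fun i =>
    (stabilizer_isOpen_of_isIntegral _).mem_nhds (one_mem _)
  refine Filter.mem_of_superset (Filter.iInter_mem.2 key) fun σ hσ => hLU ?_
  have hfix : ∀ i, ψ σ (b i : SeparableClosure K) = b i := fun i => by
    have h1 : σ (e.symm (b i : SeparableClosure K)) = e.symm (b i : SeparableClosure K) :=
      Set.mem_iInter.1 hσ i
    have h2 := hψ₀ σ (e.symm (b i : SeparableClosure K))
    rwa [h1, AlgEquiv.apply_symm_apply] at h2
  have hlin : (ψ σ).toLinearMap ∘ₗ L.val.toLinearMap = L.val.toLinearMap := b.ext hfix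
  rw [SetLike.mem_coe, IntermediateField.mem_fixingSubgroup_iff]
  exact fun x hx => LinearMap.congr_fun hlin ⟨x, hx⟩

-- A separable polynomial over `F` splits in `F^sep`, so all its roots in `K^sep` come from there.
variable (F) in
lemma fieldRange_sepEmbedding :
    (separableClosure F (SeparableClosure K) : Set (SeparableClosure K)) =
      Set.range (sepEmbedding (Algebra.ofId F K)) := by
  ext x
  constructor
  · intro hx
    replace hx : (minpoly F x).Separable := mem_separableClosure_iff.1 hx
    have h1 : ((minpoly F x).map (algebraMap F (SeparableClosure F))).Splits :=
      IsSepClosed.splits_codomain _ hx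
    refine h1.mem_range_of_isRoot (i := (sepEmbedding (Algebra.ofId F K)).toRingHom)
      (Polynomial.map_ne_zero hx.ne_zero) ?_
    rw [Polynomial.map_map, show (sepEmbedding (Algebra.ofId F K)).toRingHom.comp
      (algebraMap F (SeparableClosure F)) = algebraMap F (SeparableClosure K) from
      (sepEmbedding (Algebra.ofId F K)).comp_algebraMap, Polynomial.IsRoot, Polynomial.eval_map_algebraMap]
    exact minpoly.aeval F x
  · rintro ⟨y, rfl⟩
    exact mem_separableClosure_iff.2 (IsSeparable.map _
      (sepEmbedding (Algebra.ofId F K)).injective (Algebra.IsSeparable.isSeparable F y))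

/-- `K^gd` is generated over `K` by the image of `F^sep`; hence an automorphism over `K` fixes it
exactly when it restricts to the identity of `F^sep`. -/
lemma range_galEmbedding (hj : j.fieldRange = gd F K)
    (e : SeparableClosure E ≃ₐ[F] SeparableClosure K)
    (he : ∀ x : E, e (algebraMap E _ x) = j x)
    (ψ : Gal(SeparableClosure E/E) →* Gal(SeparableClosure K/K))
    (hψ : ∀ σ x, ψ σ (e x) = e (σ x)) :
    ψ.range = (absGalRestrict (Algebra.ofId F K) : _ →* Gal(SeparableClosure F/F)).ker := by
  have hker : ∀ τ : Gal(SeparableClosure K/K), absGalRestrict (Algebra.ofId F K) τ = 1 ↔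
      ∀ x, τ (j x) = j x := by
    intro τ
    have h1 : (∀ x, τ (j x) = j x) ↔ τ ∈ (gd F K).fixingSubgroup := by
      rw [← hj, IntermediateField.mem_fixingSubgroup_iff]
      constructor
      · rintro h _ ⟨x, rfl⟩
        exact h x
      · intro h x
        exact h _ ⟨x, rfl⟩
    have h2 : τ ∈ (gd F K).fixingSubgroup ↔ ∀ y, τ (sepEmbedding (Algebra.ofId F K) y) =
        sepEmbedding (Algebra.ofId F K) y := by
      rw [IntermediateField.mem_fixingSubgroup_iff]
      constructor
      · intro h y
        refine h _ (IntermediateField.subset_adjoin _ _ ?_)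
        rw [fieldRange_sepEmbedding]
        exact ⟨y, rfl⟩
      · intro h x hx
        rw [gd, fieldRange_sepEmbedding] at hx
        induction hx using IntermediateField.adjoin_induction with
        | mem x hx =>
          obtain ⟨y, rfl⟩ := hx
          exact h y
        | algebraMap x => exact τ.commutes x
        | add x y _ _ hx hy => rw [map_add, hx, hy]
        | inv x _ hx => rw [map_inv₀, hx]
        | mul x y _ _ hx hy => rw [map_mul, hx, hy]
    rw [h1, h2]
    constructor
    · intro h y
      rw [← sepEmbedding_absGalRestrict, h]
      rfl
    · intro h
      refine AlgEquiv.ext fun y => (sepEmbedding (Algebra.ofId F K)).injective ?_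
      change sepEmbedding (Algebra.ofId F K) _ = sepEmbedding (Algebra.ofId F K) _
      rw [sepEmbedding_absGalRestrict, h]
      rfl
  ext τ
  rw [MonoidHom.mem_ker]
  refine Iff.trans ?_ (hker τ).symm
  constructor
  · rintro ⟨σ, rfl⟩ x
    rw [← he, hψ, AlgEquiv.commutes]
  · intro h
    refine ⟨AlgEquiv.ofRingEquiv (f := (e.toRingEquiv.trans τ.toRingEquiv).trans
      e.symm.toRingEquiv) fun x => ?_, ?_⟩
    · change e.symm (τ (e (algebraMap E _ x))) = _
      rw [he, h, ← he, AlgEquiv.symm_apply_apply]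
    · refine AlgEquiv.ext fun x => ?_
      obtain ⟨x, rfl⟩ := e.surjective x
      rw [hψ]
      exact e.apply_symm_apply _

variable (A : Over (Spec (CommRingCat.of F))) [GrpObj A] [IsCommMonObj A]

/-- An isomorphism of algebras induces an isomorphism of groups of points. -/
def Points.mapEquiv {R S : Type u} [CommRing R] [Algebra F R] [CommRing S] [Algebra F S]
    (e : R ≃ₐ[F] S) : Points A R ≃+ Points A S where
  toFun := Points.map A e.toAlgHom
  invFun := Points.map A e.symm.toAlgHom
  left_inv x := (Points.map_map_of_comp A (h := AlgHom.id F R) (fun x => e.symm_apply_apply x) x).trans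
    (Points.map_id_apply A x)
  right_inv x := (Points.map_map_of_comp A (h := AlgHom.id F S) (fun x => e.apply_symm_apply x) x).trans
    (Points.map_id_apply A x)
  map_add' := map_add _

lemma exists_diff_eq_of_subsingleton {G : Type u} [Group G] [TopologicalSpace G]
    [IsTopologicalGroup G] [CompactSpace G] [TotallyDisconnectedSpace G] (M : TopRep.{u} ℤ G) [DiscreteTopology M] (n : ℕ)
    [Subsingleton (HCont M n)] (u : List G → M)
    (hu : u ∈ listCochains (MonoidHom.id G) (endHom M) (n + 1)) (hd : diff u = 0) :
    ∃ w ∈ listCochains (MonoidHom.id G) (endHom M) n, diff w = u :=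
  (listClass_eq_zero_iff M n ⟨u, hu, hd⟩).1 (Subsingleton.elim _ _)

/-- The kernel is the Galois group of the compositum, whose cohomology vanishes in positive degrees.
An abstract field `E` with image `gd F K` keeps the two separable closures apart. -/
lemma isKerAcyclic_absGalRestrict_of_fieldRange [LocallyOfFiniteType A.hom] (hj : j.fieldRange = gd F K)
    (hE : ∀ n, 0 < n → Subsingleton (H A E n)) :
    IsKerAcyclic (absGalRestrict (Algebra.ofId F K) : _ →* Gal(SeparableClosure F/F))
      (endHom (galRep A K)) := by
  obtain ⟨e, he⟩ := exists_sepEquiv F j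
  obtain ⟨ψ, hψ, hψe⟩ := exists_galEmbedding j e he
  refine isKerAcyclic_of_range_eq (hasOpenStabilizers_galRep A) hψ ?_
    (range_galEmbedding j hj e he ψ hψe) ?_
  · intro σ τ h
    refine AlgEquiv.ext fun x => e.injective ?_
    rw [← hψe, h, hψe]
  · intro n u hu hd
    have := hE (n + 1) n.succ_pos
    refine exists_diff_eq_of_addEquiv (ρ' := endHom (galRep A E))
      (Points.mapEquiv A e.symm : Points A (SeparableClosure K) ≃+ Points A (SeparableClosure E)) ?_
      (exists_diff_eq_of_subsingleton (galRep A E) (n + 1)) hu hd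
    intro σ x
    have h1 : ∀ y, e.symm.toAlgHom ((galAction F K (ψ σ)).toAlgHom y) =
        ((galAction F E σ).toAlgHom.comp e.symm.toAlgHom) y := by
      intro y
      obtain ⟨y, rfl⟩ := e.surjective y
      change e.symm (ψ σ (e y)) = σ (e.symm (e y))
      rw [hψe, e.symm_apply_apply, e.symm_apply_apply]
    exact (Points.map_map_of_comp A h1 x).trans (Points.map_map _ _ _ _).symm

lemma isKerAcyclic_absGalRestrict [LocallyOfFiniteType A.hom] (hK : IsGloballyDominated A K) :
    IsKerAcyclic (absGalRestrict (Algebra.ofId F K) : _ →* Gal(SeparableClosure F/F))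
      (endHom (galRep A K)) :=
  isKerAcyclic_absGalRestrict_of_fieldRange (gd F K).val A (gd F K).fieldRange_val hK

/-- The four inputs of `mapHCont_bijective` are the open stabilizers, the acyclic kernel from global
domination, and the two halves of the statement that `A(K ⊗ F^sep)` is coinduced from `A(K^sep)`. -/
lemma tensorToH_bijective [LocallyOfFiniteType A.hom] (hK : IsGloballyDominated A K) (n : ℕ) :
    Function.Bijective (tensorToH A K n) :=
  mapHCont_bijective (absGalRestrict (Algebra.ofId F K)) (fromTensorRep A K)
    (hasOpenStabilizers_galRep A) (isKerAcyclic_absGalRestrict A hK)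
    (eq_zero_of_homOf_fromTensorRep A) (exists_homOf_fromTensorRep_eq A) n

end Acyclic

/-! ### Points of a limit of zero-dimensional rings -/

lemma isClosed_of_isCompact_of_isOpen {R : Type*} [CommRing R] [Ring.KrullDimLE 0 R]
    {s : Set (PrimeSpectrum R)} (hc : IsCompact s) (ho : IsOpen s) : IsClosed s := by
  -- A constructible set stable under specialization is closed, and in dimension zero there are no
  -- proper specializations.
  refine PrimeSpectrum.isClosed_of_stableUnderSpecialization_of_isConstructible ?_ ?_
  · intro x y hxy hx
    have h1 : x.asIdeal ≤ y.asIdeal := (PrimeSpectrum.le_iff_specializes x y).2 hxy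
    have h2 : x = y := PrimeSpectrum.ext
      ((inferInstance : x.asIdeal.IsMaximal).eq_of_le y.2.ne_top h1)
    exact h2 ▸ hx
  · exact hc.isConstructible ho

lemma krullDimLE_zero_of_isIntegral (K R : Type*) [Field K] [CommRing R] [Algebra K R]
    [Algebra.IsIntegral K R] : Ring.KrullDimLE 0 R :=
  .mk₀ fun I _ => Ideal.isMaximal_of_isIntegral_of_isMaximal_comap (R := K) I
    (Ideal.isMaximal_of_isPrime _)

section PointsLimit

variable {F : Type u} [Field F] {A : Over (Spec (CommRingCat.of F))} 

lemma quasiSeparatedSpace_left [LocallyOfFiniteType A.hom] : QuasiSeparatedSpace A.left := by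
  have : IsLocallyNoetherian A.left := LocallyOfFiniteType.isLocallyNoetherian A.hom
  infer_instance

/-- `A` is quasi-separated, so the preimage of an affine open is quasi-compact; in dimension zero it
is therefore clopen, hence given by an idempotent. -/
lemma exists_isIdempotentElem_mem_iff [LocallyOfFiniteType A.hom] {R : Type u} [CommRing R]
    [Ring.KrullDimLE 0 R] (x : Spec (CommRingCat.of R) ⟶ A.left) {U : A.left.Opens}
    (hU : IsAffineOpen U) : ∃ ε : R, IsIdempotentElem ε ∧
      ∀ p : PrimeSpectrum R, x p ∈ U ↔ ε ∉ p.asIdeal := by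
  have := quasiSeparatedSpace_left (A := A)
  have h1 : IsCompact (x ⁻¹ᵁ U).1 :=
    x.isCompact_preimage hU.isCompact
  have h2 : IsOpen (x ⁻¹ᵁ U).1 :=
    (x ⁻¹ᵁ U).2
  obtain ⟨ε, hε, h⟩ := PrimeSpectrum.exists_idempotent_basicOpen_eq_of_isClopen
    (R := R) (s := (x ⁻¹ᵁ U).1) ⟨isClosed_of_isCompact_of_isOpen h1 h2, h2⟩
  exact ⟨ε, hε, fun p => Set.ext_iff.1 h p⟩

/-- For an affine target, `hlim` glues the ring homomorphisms. In general all `x v` land in one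
affine open `U`: the idempotents of the preimages of `U` glue to an idempotent of the field `N`,
which is not `0` because `U` was chosen to meet the image of `x v₀`. -/
lemma Points.exists_map_eq_of_limit [GrpObj A] [IsCommMonObj A] [LocallyOfFiniteType A.hom]
    {V E : Type*} {l r : E → V} [Nonempty V] {N : Type u} [Field N] [Algebra F N] {R : V → Type u}
    [∀ v, CommRing (R v)] [∀ v, Algebra F (R v)] [∀ v, Nontrivial (R v)]
    [∀ v, Ring.KrullDimLE 0 (R v)] {S : E → Type u} [∀ e, CommRing (S e)] [∀ e, Algebra F (S e)]
    (i : ∀ v, N →ₐ[F] R v) (fl : ∀ e, R (l e) →ₐ[F] S e) (fr : ∀ e, R (r e) →ₐ[F] S e)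
    (hlim : ∀ b : ∀ v, R v, (∀ e, fl e (b (l e)) = fr e (b (r e))) → ∃ m, ∀ v, i v m = b v)
    (x : ∀ v, Points A (R v))
    (hx : ∀ e, Points.map A (fl e) (x (l e)) = Points.map A (fr e) (x (r e))) :
    ∃ y : Points A N, ∀ v, Points.map A (i v) y = x v := by
  obtain ⟨v₀⟩ := ‹Nonempty V›
  have hinj : ∀ v, Function.Injective (i v) := fun v => (i v).toRingHom.injective
  obtain ⟨p₀⟩ : Nonempty (PrimeSpectrum (R v₀)) := inferInstance
  obtain ⟨_, ⟨U, hU, rfl⟩, hpU, -⟩ := A.left.isBasis_affineOpens.exists_subset_of_mem_open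
    (Set.mem_univ ((x v₀).hom p₀)) isOpen_univ
  choose ε hε hεU using fun v => exists_isIdempotentElem_mem_iff (x v).hom hU
  have hεe : ∀ e, fl e (ε (l e)) = fr e (ε (r e)) := fun e => by
    -- An idempotent is determined by its basic open set, and both sides here give the preimage of
    -- `U` under the same point over `S e`.
    refine PrimeSpectrum.basicOpen_injOn_isIdempotentElem ((hε _).map (fl e)) ((hε _).map (fr e)) ?_
    ext p
    have h1 := hεU (l e) (PrimeSpectrum.comap (fl e).toRingHom p)
    have h2 := hεU (r e) (PrimeSpectrum.comap (fr e).toRingHom p)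
    have h3 : (x (l e)).hom (PrimeSpectrum.comap (fl e).toRingHom p) =
        (x (r e)).hom (PrimeSpectrum.comap (fr e).toRingHom p) :=
      congrArg (fun y : Points A (S e) => y.hom p) (hx e)
    exact h1.symm.trans ((by rw [h3]) : _ ↔ _) |>.trans h2
  obtain ⟨m, hm⟩ := hlim ε hεe
  have hm1 : m = 1 := by
    have h1 : IsIdempotentElem m := hinj v₀ (by
      rw [map_mul, hm]
      exact hε v₀)
    rcases IsIdempotentElem.iff_eq_zero_or_one.1 h1 with h | h
    · refine absurd ?_ ((hεU v₀ p₀).1 hpU)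
      rw [← hm, h, map_zero]
      exact zero_mem _
    · exact h
  have hxU : ∀ v p, (x v).hom p ∈ U := fun v p => by
    refine (hεU v p).2 ?_
    rw [← hm, hm1, map_one]
    exact fun h => p.2.ne_top ((Ideal.eq_top_iff_one _).2 h)
  let φ : ∀ v, Γ(A.left, U) ⟶ CommRingCat.of (R v) := fun v => factorHom hU (x v).hom (hxU v)
  have hφ : ∀ v, Spec.map (φ v) ≫ hU.fromSpec = (x v).hom := fun v =>
    specMap_factorHom hU (x v).hom (hxU v)
  have hφe : ∀ e, φ (l e) ≫ CommRingCat.ofHom (fl e).toRingHom =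
      φ (r e) ≫ CommRingCat.ofHom (fr e).toRingHom := fun e => by
    refine specMap_fromSpec_injective hU ?_
    rw [Spec.map_comp, Spec.map_comp, Category.assoc, Category.assoc, hφ, hφ]
    exact congrArg Points.hom (hx e)
  choose c hc using fun b : Γ(A.left, U) => hlim (fun v => φ v b) fun e =>
    ConcreteCategory.congr_hom (hφe e) b
  let M : Γ(A.left, U) ⟶ CommRingCat.of N := CommRingCat.ofHom
    { toFun := c
      map_one' := hinj v₀ (by rw [hc, map_one, map_one])
      map_zero' := hinj v₀ (by rw [hc, map_zero, map_zero])
      map_mul' := fun b b' => hinj v₀ (by rw [hc, map_mul, map_mul, hc, hc])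
      map_add' := fun b b' => hinj v₀ (by rw [hc, map_add, map_add, hc, hc]) }
  have hM : ∀ v, M ≫ CommRingCat.ofHom (i v).toRingHom = φ v := fun v => by
    ext b
    exact hc b v
  have hy : ∀ v, Spec.map (CommRingCat.ofHom (i v).toRingHom) ≫ Spec.map M ≫ hU.fromSpec =
      (x v).hom := fun v => by
    rw [← Category.assoc, ← Spec.map_comp, hM, hφ]
  obtain ⟨ψ, hψ⟩ := Spec.map_surjective ((Spec.map M ≫ hU.fromSpec) ≫ A.hom)
  have hψ' : ψ = CommRingCat.ofHom (algebraMap F N) := by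
    ext c
    refine hinj v₀ ?_
    have h1 : ψ ≫ CommRingCat.ofHom (i v₀).toRingHom =
        CommRingCat.ofHom (algebraMap F (R v₀)) := by
      refine Spec.map_injective ?_
      rw [Spec.map_comp, hψ, ← Category.assoc, hy, Points.hom_comp]
    exact (ConcreteCategory.congr_hom h1 c).trans ((i v₀).commutes c).symm
  obtain ⟨y, hy'⟩ := Points.exists_hom_eq (Spec.map M ≫ hU.fromSpec) (hψ.symm.trans (by rw [hψ']))
  refine ⟨y, fun v => Points.hom_injective ?_⟩
  rw [Points.hom_map, hy', hy]

end PointsLimit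

section TensorLimit

variable {F : Type*} [Field F] {N : Type*} [CommRing N] [Algebra F N]

lemma basis_repr_tensorMap {ι : Type*} (B : Module.Basis ι F N) {P Q : Type*} [CommRing P]
    [CommRing Q] [Algebra F P] [Algebra F Q] (f : P →ₐ[F] Q) (t : P ⊗[F] N) (i : ι) :
    (Algebra.TensorProduct.basis Q B).repr (Algebra.TensorProduct.map f (AlgHom.id F N) t) i =
      f ((Algebra.TensorProduct.basis P B).repr t i) := by
  induction t with
  | zero => simp
  | tmul a n => simp
  | add x y hx hy => simp only [map_add, Finsupp.add_apply, hx, hy]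

/-- Tensor products over a field preserve certain limits: if `F` is the limit of a
system of algebras, then `N` is the limit of the system of their base changes. -/
lemma exists_includeRight_eq_of_limit {V E : Type*} [Nonempty V] {l r : E → V} {K : V → Type*}
    {L : E → Type*} [∀ v, CommRing (K v)] [∀ v, Nontrivial (K v)] [∀ v, Algebra F (K v)]
    [∀ e, CommRing (L e)] [∀ e, Algebra F (L e)]
    (ιl : ∀ e, K (l e) →ₐ[F] L e) (ιr : ∀ e, K (r e) →ₐ[F] L e)
    (hlim : ∀ b : ∀ v, K v, (∀ e, ιl e (b (l e)) = ιr e (b (r e))) →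
      ∃ m : F, ∀ v, algebraMap F (K v) m = b v)
    (b : ∀ v, K v ⊗[F] N) (hb : ∀ e, Algebra.TensorProduct.map (ιl e) (AlgHom.id F N) (b (l e)) =
      Algebra.TensorProduct.map (ιr e) (AlgHom.id F N) (b (r e))) :
    ∃ m : N, ∀ v, Algebra.TensorProduct.includeRight (R := F) (A := K v) m = b v := by
  obtain ⟨v₀⟩ := ‹Nonempty V›
  let B := Module.Basis.ofVectorSpace F N
  choose c hc using fun i => hlim (fun v => (Algebra.TensorProduct.basis (K v) B).repr (b v) i)
    fun e => by rw [← basis_repr_tensorMap, hb, basis_repr_tensorMap]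
  -- The coordinates glue one at a time in `F`; that almost all of them vanish can be seen at the
  -- single vertex `v₀`, since `F` embeds in `K v₀`.
  have hfin : (Function.support c).Finite := by
    refine ((Algebra.TensorProduct.basis (K v₀) B).repr (b v₀)).hasFiniteSupport.subset
      fun i hi h => hi ((algebraMap F (K v₀)).injective ?_)
    rw [hc, h, map_zero]
  refine ⟨B.repr.symm (Finsupp.ofSupportFinite c hfin), fun v => ?_⟩
  refine (Algebra.TensorProduct.basis (K v) B).repr.injective (Finsupp.ext fun i => ?_)
  rw [← hc, Algebra.TensorProduct.includeRight_apply, Algebra.TensorProduct.basis_repr_tmul]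
  simp [Finsupp.ofSupportFinite_coe]

end TensorLimit

/-! ### Exactness of the patching sequence -/

section Patching

variable {F : Type u} [Field F] {Γ : OrientedGraph.{v, w}} {X : GammaField Γ F}
  (A : Over (Spec (CommRingCat.of F))) [GrpObj A] [IsCommMonObj A]

lemma GammaField.IsGammaOver.exists_algebraMap_eq (hX : X.IsGammaOver) (b : ∀ v, X.Fv v)
    (hb : ∀ e, X.ιl e (b (Γ.l e)) = X.ιr e (b (Γ.r e))) :
    ∃ m : F, ∀ v, algebraMap F (X.Fv v) m = b v := by
  obtain ⟨m, hm⟩ := hX.bijective.surjective ⟨b, hb⟩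
  exact ⟨m, fun v => congrFun (congrArg Subtype.val hm) v⟩

lemma OrientedGraph.Connected.nonempty (h : Γ.Connected) : Nonempty Γ.V :=
  SimpleGraph.Connected.nonempty h

lemma krullDimLE_zero_tensor (F K N : Type*) [Field F] [Field K] [Field N] [Algebra F K]
    [Algebra F N]
    [Algebra.IsIntegral F N] : Ring.KrullDimLE 0 (K ⊗[F] N) :=
  krullDimLE_zero_of_isIntegral K (K ⊗[F] N)

lemma exists_map_includeRight_eq [LocallyOfFiniteType A.hom] (hX : X.IsGammaOver)
    (N : Type u) [Field N] [Algebra F N] [Algebra.IsIntegral F N]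
    (x : ∀ v, Points A (X.Fv v ⊗[F] N))
    (hx : ∀ e, Points.map A (Algebra.TensorProduct.map (X.ιl e) (AlgHom.id F N)) (x (Γ.l e)) =
      Points.map A (Algebra.TensorProduct.map (X.ιr e) (AlgHom.id F N)) (x (Γ.r e))) :
    ∃ y : Points A N, ∀ v, Points.map A Algebra.TensorProduct.includeRight y = x v := by
  have := hX.connected.nonempty
  have (v : Γ.V) : Ring.KrullDimLE 0 (X.Fv v ⊗[F] N) := krullDimLE_zero_tensor F (X.Fv v) N
  exact @Points.exists_map_eq_of_limit F _ A _ _ _ Γ.V Γ.E Γ.l Γ.r _ N _ _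
    (fun v => X.Fv v ⊗[F] N) (fun v => inferInstance) (fun v => inferInstance)
    (fun v => inferInstance) this (fun e => X.Fe e ⊗[F] N) (fun e => inferInstance)
    (fun e => inferInstance)
    (fun v => Algebra.TensorProduct.includeRight)
    (fun e => Algebra.TensorProduct.map (X.ιl e) (AlgHom.id F N))
    (fun e => Algebra.TensorProduct.map (X.ιr e) (AlgHom.id F N))
    (exists_includeRight_eq_of_limit X.ιl X.ιr hX.exists_algebraMap_eq) x hx

end Patching

section Patching

variable {F : Type u} [Field F] {Γ : OrientedGraph.{v, w}} {X : GammaField Γ F}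
  (A : Over (Spec (CommRingCat.of F))) [GrpObj A] [IsCommMonObj A]

lemma Points.eq_zero_of_map_eq_zero {R S : Type u} [CommRing R] [Algebra F R] [CommRing S]
    [Algebra F S] (f : R →ₐ[F] S) (hf : Function.Injective f) (x : Points A R)
    (h : Points.map A f x = 0) : x = 0 :=
  Points.map_jointly_injective (fun _ : Unit => f)
    (fun _ hr => (map_eq_zero_iff f hf).1 (hr ())) x fun _ => h

lemma includeRight_injective (F K N : Type*) [Field F] [Field K] [Field N] [Algebra F K]
    [Algebra F N] :
    Function.Injective (Algebra.TensorProduct.includeRight : N →ₐ[F] K ⊗[F] N) :=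
  (Algebra.TensorProduct.includeRight : N →ₐ[F] K ⊗[F] N).toRingHom.injective

lemma Points.eq_zero_of_map_includeRight (K N : Type u) [Field K] [Algebra F K] [Field N]
    [Algebra F N] (x : Points A N)
    (h : Points.map A (Algebra.TensorProduct.includeRight : N →ₐ[F] K ⊗[F] N) x = 0) : x = 0 :=
  @Points.eq_zero_of_map_eq_zero F _ A _ _ N (K ⊗[F] N) _ _ _ _
    Algebra.TensorProduct.includeRight (includeRight_injective F K N) x h

lemma Points.map_tensorMap_includeRight {K L N : Type u} [Field K] [Algebra F K] [Field L]
    [Algebra F L] [Field N] [Algebra F N] (φ : K →ₐ[F] L) (x : Points A N) :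
    Points.map A (Algebra.TensorProduct.map φ (AlgHom.id F N))
        (Points.map A (Algebra.TensorProduct.includeRight : N →ₐ[F] K ⊗[F] N) x) =
      Points.map A (Algebra.TensorProduct.includeRight : N →ₐ[F] L ⊗[F] N) x :=
  Points.map_map_of_comp A (fun y => by simp) x

lemma homOf_tensorRepMap_toTensorRep {K L : Type u} [Field K] [Algebra F K] [Field L]
    [Algebra F L] (φ : K →ₐ[F] L) (x : galRep A F) :
    homOf (tensorRepMap A φ) (homOf (toTensorRep A K) x) = homOf (toTensorRep A L) x :=
  Points.map_tensorMap_includeRight A φ x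

/-- Injectivity needs a single vertex, exactness in the middle is the gluing of points over the
limit, and surjectivity is separable factorizability. -/
lemma isPatchingSequence [LocallyOfFiniteType A.hom] (hX : X.IsGammaOver)
    (hfact : IsSeparablyFactorizable A X) :
    IsPatchingSequence (fun v => toTensorRep A (X.Fv v)) (fun e => tensorRepMap A (X.ιl e))
      (fun e => tensorRepMap A (X.ιr e)) where
  inj m hm := by
    obtain ⟨v⟩ := hX.connected.nonempty
    exact Points.eq_zero_of_map_includeRight A (X.Fv v) (SeparableClosure F) m (hm v)
  comp m e := (homOf_tensorRepMap_toTensorRep A (X.ιl e) m).trans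
    (homOf_tensorRepMap_toTensorRep A (X.ιr e) m).symm
  exact b hb := exists_map_includeRight_eq A hX (SeparableClosure F) b hb
  surj c := by
    obtain ⟨b, hb⟩ := hfact c
    exact ⟨b, fun e => congrFun hb e⟩
  stab v := hasOpenStabilizers_tensorRep A

end Patching

/-! ### The connecting map in terms of continuous cochains -/

section Cochains

variable {G : Type u} [Group G] [TopologicalSpace G] [IsTopologicalGroup G]
  {M : TopRep.{u} ℤ G} {V : Type v} {E : Type w} {N : V → TopRep.{u} ℤ G} {P : E → TopRep.{u} ℤ G}
  {l r : E → V} {j : ∀ v, TopRep.res (ContinuousMonoidHom.id G) M ⟶ N v}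
  {dl : ∀ e, TopRep.res (ContinuousMonoidHom.id G) (N (l e)) ⟶ P e}
  {dr : ∀ e, TopRep.res (ContinuousMonoidHom.id G) (N (r e)) ⟶ P e}

lemma toList_mapCochains {M N : TopRep.{u} ℤ G}
    (f : TopRep.res (ContinuousMonoidHom.id G) M ⟶ N) (n : ℕ) (c : Cochains M n) (x : List G) :
    toList N n (mapCochains f n c) x = homOf f (toList M n c x) := by
  refine (toList_cochainsMap M (ContinuousMonoidHom.id G) f n c x).trans ?_
  rw [show x.map (ContinuousMonoidHom.id G) = x from List.map_id x]
  rfl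

variable [CompactSpace G] [TotallyDisconnectedSpace G] [DiscreteTopology M]
  [∀ v, DiscreteTopology (N v)] [∀ e, DiscreteTopology (P e)]

lemma snake_cocyclesEquiv {n : ℕ} {b : ∀ v, Cochains (N v) n} {z : ∀ e, Cocycles (P e) n}
    {a : Cocycles M (n + 1)}
    (hb : ∀ v, coboundary (N v) n (b v) = mapCochains (j v) (n + 1) (cocycleVal M (n + 1) a))
    (hz : ∀ e, cocycleVal (P e) n (z e) =
      mapCochains (dl e) n (b (l e)) - mapCochains (dr e) n (b (r e))) :
    Snake j dl dr n (fun e => (cocyclesEquiv (P e) n (z e)).1) (cocyclesEquiv M (n + 1) a).1 := by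
  refine ⟨fun v => toList (N v) n (b v), fun v => toList_mem (N v) n (b v), fun v x => ?_,
    fun e x => ?_⟩
  · rw [cocyclesEquiv_apply, ← toList_mapCochains, ← hb, toList_coboundary]
  · change _ = (cocyclesEquiv (P e) n (z e)).1 x
    rw [cocyclesEquiv_apply, hz, map_sub, Pi.sub_apply, toList_mapCochains, toList_mapCochains]

lemma IsPatchingSequence.exists_connecting_cochains [Finite V] [Finite E]
    (h : IsPatchingSequence j dl dr) (n : ℕ) :
    ∃ δ : (∀ e, HCont (P e) n) →+ HCont M (n + 1),
      (∀ (b : ∀ v, Cochains (N v) n) (z : ∀ e, Cocycles (P e) n) (a : Cocycles M (n + 1)),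
        (∀ v, coboundary (N v) n (b v) =
          mapCochains (j v) (n + 1) (cocycleVal M (n + 1) a)) →
        (∀ e, cocycleVal (P e) n (z e) =
          mapCochains (dl e) n (b (l e)) - mapCochains (dr e) n (b (r e))) →
        δ (fun e => cocycleClass (P e) n (z e)) = cocycleClass M (n + 1) a) ∧
      Function.Exact (edgeMap dl dr n) δ ∧ Function.Exact δ (vertexMap j (n + 1)) := by
  obtain ⟨δ, hδ, h1, h2⟩ := h.exists_connecting n
  refine ⟨δ, fun b z a hb hz => ?_, h1, h2⟩
  have h3 := hδ _ _ (snake_cocyclesEquiv hb hz)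
  rw [listClass_cocyclesEquiv, funext fun e => listClass_cocyclesEquiv (P e) n (z e)] at h3
  exact h3

end Cochains

/-! ### Transport to Galois cohomology of the vertex and edge fields -/

section Main

lemma exact_iff_of_comp_eq {B C D B' C' D' : Type*} [AddGroup B] [AddGroup C]
    [AddGroup D] [AddGroup B'] [AddGroup C'] [AddGroup D'] {f : B →+ C} {g : C →+ D}
    {f' : B' →+ C'} {g' : C' →+ D'} (s : B ≃+ B') (t : C ≃+ C') (u : D ≃+ D')
    (hf : ∀ b, f' (s b) = t (f b)) (hg : ∀ c, g' (t c) = u (g c)) (h : Function.Exact f g) :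
    Function.Exact f' g' := by
  intro c'
  obtain ⟨c, rfl⟩ := t.surjective c'
  rw [hg, map_eq_zero_iff u u.injective, h c]
  constructor
  · rintro ⟨b, rfl⟩
    exact ⟨s b, hf b⟩
  · rintro ⟨b', hb⟩
    obtain ⟨b, rfl⟩ := s.surjective b'
    exact ⟨b, t.injective ((hf b).symm.trans hb)⟩

variable {F : Type u} [Field F] {Γ : OrientedGraph.{v, w}} (X : GammaField Γ F)
  (A : Over (Spec (CommRingCat.of F))) [GrpObj A] [IsCommMonObj A]

/-- The map from the cohomology of `A(F^sep)` to that of the modules `A(F_v ⊗ F^sep)`. -/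
def tensorVertexMap (n : ℕ) : H A F n →+ ∀ v, HCont (tensorRep A (X.Fv v)) n :=
  vertexMap (fun v => toTensorRep A (X.Fv v)) n

/-- The map from the cohomology of the modules `A(F_v ⊗ F^sep)` to that of the modules
`A(F_e ⊗ F^sep)`. -/
def tensorEdgeMap (n : ℕ) : (∀ v, HCont (tensorRep A (X.Fv v)) n) →+
    ∀ e, HCont (tensorRep A (X.Fe e)) n :=
  edgeMap (N := fun v => tensorRep A (X.Fv v)) (P := fun e => tensorRep A (X.Fe e))
    (l := Γ.l) (r := Γ.r) (fun e => tensorRepMap A (X.ιl e)) (fun e => tensorRepMap A (X.ιr e)) n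

lemma resV_apply (n : ℕ) (α : H A F n) (v : Γ.V) :
    resV A X n α v = tensorToH A (X.Fv v) n (tensorVertexMap X A n α v) :=
  resH_ofId A n α

lemma diffVE_tensorToH (n : ℕ) (β : ∀ v, HCont (tensorRep A (X.Fv v)) n) (e : Γ.E) :
    diffVE A X n (fun v => tensorToH A (X.Fv v) n (β v)) e =
      tensorToH A (X.Fe e) n (tensorEdgeMap X A n β e) := by
  refine Eq.trans ?_ (map_sub (tensorToH A (X.Fe e) n) _ _).symm
  exact congrArg₂ (· - ·) (resH_tensorToH A (X.ιl e) n (β (Γ.l e)))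
    (resH_tensorToH A (X.ιr e) n (β (Γ.r e)))

/-- The isomorphisms `H^n(Gal(F), A(K_i ⊗ F^sep)) → H^n(K_i, A)`, if the cohomology of `A` over all
`K_i` is globally dominated. -/
def tensorToHEquiv [LocallyOfFiniteType A.hom] {I : Type*} {K : I → Type u} [∀ i, Field (K i)]
    [∀ i, Algebra F (K i)] (hK : ∀ i, IsGloballyDominated A (K i)) (n : ℕ) :
    (∀ i, HCont (tensorRep A (K i)) n) ≃+ ∀ i, H A (K i) n :=
  AddEquiv.piCongrRight fun i =>
    AddEquiv.ofBijective (tensorToH A (K i) n) (tensorToH_bijective A (hK i) n)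

/-- The connecting map of the patching sequence is precomposed with the inverse of the comparison
isomorphism over the edges; `IsConnecting` evaluates it on images under that isomorphism, where the
two cancel. -/
theorem exists_connecting [LocallyOfFiniteType A.hom] (hX : X.IsGammaOver)
    (hfact : IsSeparablyFactorizable A X) (hdomV : ∀ v, IsGloballyDominated A (X.Fv v))
    (hdomE : ∀ e, IsGloballyDominated A (X.Fe e)) (n : ℕ) :
    ∃ δ : (∀ e, H A (X.Fe e) n) →+ H A F (n + 1), IsConnecting A X n δ ∧
      Function.Exact (diffVE A X n) δ ∧ Function.Exact δ (resV A X (n + 1)) := by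
  obtain ⟨δ, h1, h2, h3⟩ := (isPatchingSequence A hX hfact).exists_connecting_cochains n
  let TE := tensorToHEquiv A hdomE n
  refine ⟨δ.comp TE.symm.toAddMonoidHom, fun b z a hb hz => ?_, ?_, ?_⟩
  · refine Eq.trans ?_ (h1 b z a hb hz)
    exact congrArg δ (TE.symm_apply_apply _)
  · exact exact_iff_of_comp_eq (tensorToHEquiv A hdomV n) TE (AddEquiv.refl _)
      (fun β => funext (diffVE_tensorToH X A n β)) (fun γ => congrArg δ (TE.symm_apply_apply γ)) h2
  · exact exact_iff_of_comp_eq TE (AddEquiv.refl _) (tensorToHEquiv A hdomV (n + 1))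
      (fun γ => congrArg δ (TE.symm_apply_apply γ)) (fun α => funext (resV_apply X A (n + 1) α)) h3

lemma exact_resV_diffVE [LocallyOfFiniteType A.hom] (hX : X.IsGammaOver)
    (hfact : IsSeparablyFactorizable A X) (hdomV : ∀ v, IsGloballyDominated A (X.Fv v))
    (hdomE : ∀ e, IsGloballyDominated A (X.Fe e)) (n : ℕ) :
    Function.Exact (resV A X n) (diffVE A X n) :=
  exact_iff_of_comp_eq (AddEquiv.refl _) (tensorToHEquiv A hdomV n) (tensorToHEquiv A hdomE n)
    (fun α => funext (resV_apply X A n α)) (fun β => funext (diffVE_tensorToH X A n β))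
    ((isPatchingSequence A hX hfact).exact_vertexMap_edgeMap n)

lemma resV_zero_injective [LocallyOfFiniteType A.hom] (hX : X.IsGammaOver)
    (hfact : IsSeparablyFactorizable A X) (hdomV : ∀ v, IsGloballyDominated A (X.Fv v)) :
    Function.Injective (resV A X 0) := by
  intro α α' h
  refine (isPatchingSequence A hX hfact).vertexMap_zero_injective (funext fun v => ?_)
  refine (tensorToH_bijective A (hdomV v) 0).injective ?_
  exact (resV_apply X A 0 α v).symm.trans ((congrFun h v).trans (resV_apply X A 0 α' v))

end Main

end GammaPatching

end

theorem theorem2p13 {F : Type u} [Field F] (Γ : GammaPatching.OrientedGraph.{v, w})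
    (X : GammaPatching.GammaField Γ F) (hX : X.IsGammaOver)
    (A : Over (Spec (CommRingCat.of F))) [GrpObj A] [IsCommMonObj A]
    [LocallyOfFiniteType A.hom] [QuasiCompact A.hom] [Smooth A.hom]
    (hfact : GammaPatching.IsSeparablyFactorizable A X)
    (hdomV : ∀ v, GammaPatching.IsGloballyDominated A (X.Fv v))
    (hdomE : ∀ e, GammaPatching.IsGloballyDominated A (X.Fe e)) :
    ∃ δ : ∀ n : ℕ, (∀ e, GammaPatching.H A (X.Fe e) n) →+ GammaPatching.H A F (n + 1),
      (∀ n, GammaPatching.IsConnecting A X n (δ n)) ∧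
      Function.Injective (GammaPatching.resV A X 0) ∧
      ∀ n, Function.Exact (GammaPatching.resV A X n) (GammaPatching.diffVE A X n) ∧
        Function.Exact (GammaPatching.diffVE A X n) (δ n) ∧
        Function.Exact (δ n) (GammaPatching.resV A X (n + 1)) := by
  choose δ h1 h2 h3 using GammaPatching.exists_connecting X A hX hfact hdomV hdomE
  exact ⟨δ, h1, GammaPatching.resV_zero_injective X A hX hfact hdomV, fun n =>
    ⟨GammaPatching.exact_resV_diffVE X A hX hfact hdomV hdomE n, h2 n, h3 n⟩⟩
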